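/- Let $G$ be a finite group with identity $e$ and $H$ a normal subgroup of $G$; $\delta_{a,b}$ denotes the Kronecker symbol. **The field algebra.** Let $\mathcal F_{H,\mathrm{loc}}$ be the unital complex $*$-algebra generated by $\delta_g(x)$ ($g\in G$, $x\in\mathbb Z$) and $\rho_h(l)$ ($h\in H$, $l\in\mathbb Z+\frac12$) subject to $\sum_{g\in G}\delta_g(x)=I=\rho_e(l)$, $\delta_{g_1}(x)\delta_{g_2}(x)=\delta_{g_1,g_2}\delta_{g_1}(x)$, $\rho_{h_1}(l)\rho_{h_2}(l)=\rho_{h_1h_2}(l)$, $\delta_{g_1}(x)\delta_{g_2}(x')=\delta_{g_2}(x')\delta_{g_1}(x)$, $$\rho_h(l)\delta_g(x)=\begin{cases}\delta_{hg}(x)\rho_h(l), & l<x,\\ \delta_g(x)\rho_h(l), & l>x,\end{cases}\qquad \rho_{h_1}(l)\rho_{h_2}(l')=\begin{cases}\rho_{h_2}(l')\rho_{h_2^{-1}h_1h_2}(l), & l>l',\\ \rho_{h_1h_2h_1^{-1}}(l')\rho_{h_1}(l), & l<l',\end{cases}$$ with $\delta_g(x)^*=\delta_g(x)$ and $\rho_h(l)^*=\rho_{h^{-1}}(l)$.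 Let $\mathcal F_H$ be its C*-completion (the C*-inductive limit of the finite-dimensional local subalgebras). Let $D(H;G)$ be the Hopf algebra with basis $(h,g)$, $h\in H$, $g\in G$, product $(h_1,g_1)(h_2,g_2)=\delta_{h_1g_1,g_1h_2}(h_1,g_1g_2)$, coproduct $\Delta(h,g)=\sum_{t\in H}(t,g)\otimes(t^{-1}h,g)$ and counit $\varepsilon(h,g)=\delta_{h,e}$. It acts on $\mathcal F_H$ by the continuous module algebra action with $(h,g)\delta_f(x)=\delta_{h,e}\,\delta_{gf}(x)$ and $(h,g)\rho_t(l)=\delta_{h,gtg^{-1}}\,\rho_h(l)$. The observable algebra is the C*-subalgebra $$\mathcal A_{(H,G)}=\{F\in\mathcal F_H : a(F)=\varepsilon(a)F\ \text{ for all } a\in D(H;G)\}.$$ For $h\in H$, $g\in G$, $x\in\mathbb Z$, $l\in\mathbb Z+\frac12$ put $$v_h(x)=\sum_{k\in G}\rho_{kh^{-1}k^{-1}}(x-\tfrac12)\,\delta_k(x)\,\rho_{khk^{-1}}(x+\tfrac12),\qquad w_g(l)=\sum_{k\in G}\delta_k(l-\tfrac12)\,\delta_{kg}(l+\tfrac12).$$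 **The iterated twisted tensor product.** For $i\in\mathbb Z$ let $A_i=\mathbb CH$ if $i$ is even and $A_i=\widehat G$, the algebra of complex functions on $G$ with its delta functions $\delta_g$ as basis, if $i$ is odd; both with their usual involutions. For $i<j$ let $R_{i,j}:A_j\otimes A_i\to A_i\otimes A_j$ be the twisting map given by $\delta_g\otimes h\mapsto h\otimes\delta_{h^{-1}g}$ if $j=i+1$ and $i$ is even, by $h\otimes\delta_g\mapsto\delta_{gh^{-1}}\otimes h$ if $j=i+1$ and $i$ is odd, and by the flip if $j-i\ge2$. For integers $n\le m$ let $A_{n,m}=A_n\otimes_{R_{n,n+1}}A_{n+1}\otimes\cdots\otimes_{R_{m-1,m}}A_m$ be the iterated twisted tensor product, in which factors are commuted by $(1\otimes b)(a\otimes1)=R_{i,j}(b\otimes a)$ for $a\in A_i$, $b\in A_j$, $i<j$, with the involution extending those of the factors. Let $\mathcal A=\cdots\otimes_R\mathbb CH\otimes_R\widehat G\otimes_R\mathbb CH\otimes_R\widehat G\otimes_R\cdots$ be the C*-inductive limit of the algebras $A_{n,m}$ under the inclusions that insert units. **Theorem.** There is an isometric $*$-isomorphism $\Phi:\mathcal A\to\mathcal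 A_{(H,G)}$ such that 1. on $A_{0,2}=\mathbb CH\otimes_R\widehat G\otimes_R\mathbb CH$ one has $\Phi(h\otimes\delta_g\otimes f)=v_h(0)\,w_g(\tfrac12)\,v_f(1)$ for $h,f\in H$, $g\in G$; 2. more generally, for all $n\le m$, $\Phi$ maps an elementary tensor $a_n\otimes\cdots\otimes a_m\in A_{n,m}$ with $a_{2x}=h_x\in H$ and $a_{2x+1}=\delta_{g_x}$ to the ordered product $b_nb_{n+1}\cdots b_m$, where $b_{2x}=v_{h_x}(x)$ and $b_{2x+1}=w_{g_x}(x+\tfrac12)$; 3. for all integers $n\le m$, $\Phi$ restricts to an isomorphism from $A_{2n,2m}$ onto the $*$-algebra generated by all $v_h(x)$ with $h\in H$, $x\in\mathbb Z$, $n\le x\le m$, and all $w_g(l)$ with $g\in G$, $l\in\mathbb Z+\frac12$, $n<l<m$. -/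

import Mathlib

open scoped TensorProduct

noncomputable section

set_option linter.unusedSimpArgs false
set_option linter.unusedSectionVars false

namespace GSpin

universe u

/-- A twisting map `R : B ⊗ A → A ⊗ B` between unital complex algebras. -/
structure TwistingMap (A B : Type u) [Ring A] [Algebra ℂ A] [Ring B] [Algebra ℂ B] where
  toLin : B ⊗[ℂ] A →ₗ[ℂ] A ⊗[ℂ] B
  map_one_left : ∀ a : A, toLin (1 ⊗ₜ a) = a ⊗ₜ 1
  map_one_right : ∀ b : B, toLin (b ⊗ₜ 1) = 1 ⊗ₜ b
  /-- `R ∘ (id_B ⊗ m_A) = (m_A ⊗ id_B) ∘ (id_A ⊗ R) ∘ (R ⊗ id_A)` -/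
  comp_mul_right :
    toLin ∘ₗ (LinearMap.mul' ℂ A).lTensor B =
      (LinearMap.mul' ℂ A).rTensor B ∘ₗ (TensorProduct.assoc ℂ A A B).symm.toLinearMap ∘ₗ
        toLin.lTensor A ∘ₗ (TensorProduct.assoc ℂ A B A).toLinearMap ∘ₗ
          toLin.rTensor A ∘ₗ (TensorProduct.assoc ℂ B A A).symm.toLinearMap
  /-- `R ∘ (m_B ⊗ id_A) = (id_A ⊗ m_B) ∘ (R ⊗ id_B) ∘ (id_B ⊗ R)` -/
  comp_mul_left :
    toLin ∘ₗ (LinearMap.mul' ℂ B).rTensor A =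
      (LinearMap.mul' ℂ B).lTensor A ∘ₗ (TensorProduct.assoc ℂ A B B).toLinearMap ∘ₗ
        toLin.rTensor B ∘ₗ (TensorProduct.assoc ℂ B A B).symm.toLinearMap ∘ₗ
          toLin.lTensor B ∘ₗ (TensorProduct.assoc ℂ B B A).toLinearMap

namespace TwistingMap

section
variable {A B : Type u} [Ring A] [Algebra ℂ A] [Ring B] [Algebra ℂ B] (R : TwistingMap A B)

/-- `u ⊗ v ↦ (u ⊗ 1) · R (v ⊗ a)` -/
def pushR (a : A) : A ⊗[ℂ] B →ₗ[ℂ] A ⊗[ℂ] B :=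
  (LinearMap.mul' ℂ A).rTensor B ∘ₗ (TensorProduct.assoc ℂ A A B).symm.toLinearMap ∘ₗ
    (R.toLin ∘ₗ (TensorProduct.mk ℂ B A).flip a).lTensor A

/-- `u ⊗ v ↦ R (b ⊗ u) · (1 ⊗ v)` -/
def pushL (b : B) : A ⊗[ℂ] B →ₗ[ℂ] A ⊗[ℂ] B :=
  (LinearMap.mul' ℂ B).lTensor A ∘ₗ (TensorProduct.assoc ℂ A B B).toLinearMap ∘ₗ
    (R.toLin ∘ₗ TensorProduct.mk ℂ B A b).rTensor B

theorem pushR_tmul (a u : A) (v : B) :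
    R.pushR a (u ⊗ₜ v) = (LinearMap.mulLeft ℂ u).rTensor B (R.toLin (v ⊗ₜ a)) := by
  simp only [pushR, LinearMap.comp_apply, LinearMap.lTensor_tmul, LinearMap.flip_apply,
    TensorProduct.mk_apply]
  induction R.toLin (v ⊗ₜ a) using TensorProduct.induction_on with
  | zero => simp only [LinearMap.map_zero, LinearEquiv.map_zero, TensorProduct.zero_tmul,
      TensorProduct.tmul_zero]
  | tmul x y => simp
  | add x y hx hy => simp only [TensorProduct.tmul_add,
        LinearMap.map_add, LinearEquiv.map_add, hx, hy]

theorem pushL_tmul (b : B) (u : A) (v : B) :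
    R.pushL b (u ⊗ₜ v) = (LinearMap.mulRight ℂ v).lTensor A (R.toLin (b ⊗ₜ u)) := by
  simp only [pushL, LinearMap.comp_apply, LinearMap.rTensor_tmul, TensorProduct.mk_apply]
  induction R.toLin (b ⊗ₜ u) using TensorProduct.induction_on with
  | zero => simp only [LinearMap.map_zero, LinearEquiv.map_zero, TensorProduct.zero_tmul,
      TensorProduct.tmul_zero]
  | tmul x y => simp
  | add x y hx hy => simp only [TensorProduct.add_tmul,
        LinearMap.map_add, LinearEquiv.map_add, hx, hy]

theorem map_mul_right (b : B) (a a' : A) :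
    R.toLin (b ⊗ₜ (a * a')) = R.pushR a' (R.toLin (b ⊗ₜ a)) := by
  have h := LinearMap.congr_fun R.comp_mul_right (b ⊗ₜ (a ⊗ₜ a'))
  simp only [LinearMap.comp_apply, LinearMap.lTensor_tmul, LinearMap.mul'_apply,
    LinearEquiv.coe_coe, TensorProduct.assoc_symm_tmul, LinearMap.rTensor_tmul] at h
  rw [h]
  induction R.toLin (b ⊗ₜ a) using TensorProduct.induction_on with
  | zero => simp only [LinearMap.map_zero, LinearEquiv.map_zero, TensorProduct.zero_tmul,
      TensorProduct.tmul_zero]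
  | tmul x y => simp [pushR]
  | add x y hx hy => simp only [TensorProduct.add_tmul,
        LinearMap.map_add, LinearEquiv.map_add, hx, hy]

theorem map_mul_left (b b' : B) (a : A) :
    R.toLin ((b * b') ⊗ₜ a) = R.pushL b (R.toLin (b' ⊗ₜ a)) := by
  have h := LinearMap.congr_fun R.comp_mul_left ((b ⊗ₜ b') ⊗ₜ a)
  simp only [LinearMap.comp_apply, LinearMap.lTensor_tmul, LinearMap.mul'_apply,
    LinearEquiv.coe_coe, TensorProduct.assoc_tmul, LinearMap.rTensor_tmul] at h
  rw [h]
  induction R.toLin (b' ⊗ₜ a) using TensorProduct.induction_on with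
  | zero => simp only [LinearMap.map_zero, LinearEquiv.map_zero, TensorProduct.zero_tmul,
      TensorProduct.tmul_zero]
  | tmul x y => simp [pushL]
  | add x y hx hy => simp only [TensorProduct.tmul_add,
        LinearMap.map_add, LinearEquiv.map_add, hx, hy]

/-- Twisting maps from the elementwise form of the axioms. -/
theorem comp_mul_right_of (T : B ⊗[ℂ] A →ₗ[ℂ] A ⊗[ℂ] B)
    (h : ∀ (b : B) (a a' : A), T (b ⊗ₜ (a * a')) =
      ((LinearMap.mul' ℂ A).rTensor B ∘ₗ (TensorProduct.assoc ℂ A A B).symm.toLinearMap ∘ₗ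
        (T ∘ₗ (TensorProduct.mk ℂ B A).flip a').lTensor A) (T (b ⊗ₜ a))) :
    T ∘ₗ (LinearMap.mul' ℂ A).lTensor B =
      (LinearMap.mul' ℂ A).rTensor B ∘ₗ (TensorProduct.assoc ℂ A A B).symm.toLinearMap ∘ₗ
        T.lTensor A ∘ₗ (TensorProduct.assoc ℂ A B A).toLinearMap ∘ₗ
          T.rTensor A ∘ₗ (TensorProduct.assoc ℂ B A A).symm.toLinearMap := by
  refine TensorProduct.ext' fun b x => ?_
  induction x using TensorProduct.induction_on with
  | zero => simp only [LinearMap.map_zero, LinearEquiv.map_zero, TensorProduct.zero_tmul,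
      TensorProduct.tmul_zero]
  | add x y hx hy => simp only [TensorProduct.tmul_add,
        LinearMap.map_add, LinearEquiv.map_add, hx, hy]
  | tmul a a' =>
    simp only [LinearMap.comp_apply, LinearMap.lTensor_tmul, LinearMap.mul'_apply,
      LinearEquiv.coe_coe, TensorProduct.assoc_symm_tmul, LinearMap.rTensor_tmul]
    rw [h]
    induction T (b ⊗ₜ a) using TensorProduct.induction_on with
    | zero => simp only [LinearMap.map_zero, LinearEquiv.map_zero, TensorProduct.zero_tmul,
        TensorProduct.tmul_zero]
    | tmul x y => simp
    | add x y hx hy => simp only [TensorProduct.add_tmul,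
          LinearMap.map_add, LinearEquiv.map_add, hx, hy]

theorem comp_mul_left_of (T : B ⊗[ℂ] A →ₗ[ℂ] A ⊗[ℂ] B)
    (h : ∀ (b b' : B) (a : A), T ((b * b') ⊗ₜ a) =
      ((LinearMap.mul' ℂ B).lTensor A ∘ₗ (TensorProduct.assoc ℂ A B B).toLinearMap ∘ₗ
        (T ∘ₗ TensorProduct.mk ℂ B A b).rTensor B) (T (b' ⊗ₜ a))) :
    T ∘ₗ (LinearMap.mul' ℂ B).rTensor A =
      (LinearMap.mul' ℂ B).lTensor A ∘ₗ (TensorProduct.assoc ℂ A B B).toLinearMap ∘ₗ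
        T.rTensor B ∘ₗ (TensorProduct.assoc ℂ B A B).symm.toLinearMap ∘ₗ
          T.lTensor B ∘ₗ (TensorProduct.assoc ℂ B B A).toLinearMap := by
  refine TensorProduct.ext' fun x a => ?_
  induction x using TensorProduct.induction_on with
  | zero => simp only [LinearMap.map_zero, LinearEquiv.map_zero, TensorProduct.zero_tmul,
      TensorProduct.tmul_zero]
  | add x y hx hy => simp only [TensorProduct.add_tmul,
        LinearMap.map_add, LinearEquiv.map_add, hx, hy]
  | tmul b b' =>
    simp only [LinearMap.comp_apply, LinearMap.lTensor_tmul, LinearMap.mul'_apply,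
      LinearEquiv.coe_coe, TensorProduct.assoc_tmul, LinearMap.rTensor_tmul]
    rw [h]
    induction T (b' ⊗ₜ a) using TensorProduct.induction_on with
    | zero => simp only [LinearMap.map_zero, LinearEquiv.map_zero, TensorProduct.zero_tmul,
        TensorProduct.tmul_zero]
    | tmul x y => simp
    | add x y hx hy => simp only [TensorProduct.tmul_add,
          LinearMap.map_add, LinearEquiv.map_add, hx, hy]

/-- `m_R = (m_A ⊗ m_B) ∘ (id_A ⊗ R ⊗ id_B)` on `(A ⊗ B) ⊗ (A ⊗ B)`. -/
def mulMap : (A ⊗[ℂ] B) ⊗[ℂ] (A ⊗[ℂ] B) →ₗ[ℂ] A ⊗[ℂ] B :=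
  TensorProduct.map (LinearMap.mul' ℂ A) (LinearMap.mul' ℂ B) ∘ₗ
    (TensorProduct.assoc ℂ A A (B ⊗[ℂ] B)).symm.toLinearMap ∘ₗ
    (TensorProduct.assoc ℂ A B B).toLinearMap.lTensor A ∘ₗ
    (R.toLin.rTensor B).lTensor A ∘ₗ
    (TensorProduct.assoc ℂ B A B).symm.toLinearMap.lTensor A ∘ₗ
    (TensorProduct.assoc ℂ A B (A ⊗[ℂ] B)).toLinearMap

theorem mulMap_tmul (a a' : A) (b b' : B) :
    R.mulMap ((a ⊗ₜ b) ⊗ₜ (a' ⊗ₜ b')) =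
      TensorProduct.map (LinearMap.mulLeft ℂ a) (LinearMap.mulRight ℂ b')
        (R.toLin (b ⊗ₜ a')) := by
  simp only [mulMap, LinearMap.comp_apply, LinearEquiv.coe_coe, TensorProduct.assoc_tmul,
    LinearMap.lTensor_tmul, TensorProduct.assoc_symm_tmul, LinearMap.rTensor_tmul]
  induction R.toLin (b ⊗ₜ a') using TensorProduct.induction_on with
  | zero => simp only [LinearMap.map_zero, LinearEquiv.map_zero, TensorProduct.zero_tmul,
      TensorProduct.tmul_zero]
  | tmul x y => simp
  | add x y hx hy => simp only [TensorProduct.tmul_add, TensorProduct.add_tmul,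
        LinearMap.map_add, LinearEquiv.map_add, hx, hy]

theorem mulMap_assoc (x y z : A ⊗[ℂ] B) :
    R.mulMap (R.mulMap (x ⊗ₜ y) ⊗ₜ z) = R.mulMap (x ⊗ₜ R.mulMap (y ⊗ₜ z)) := by
  induction x using TensorProduct.induction_on with
  | zero => simp only [LinearMap.map_zero, LinearEquiv.map_zero, TensorProduct.zero_tmul,
      TensorProduct.tmul_zero]
  | add x x' hx hx' => simp only [TensorProduct.add_tmul,
        LinearMap.map_add, LinearEquiv.map_add, hx, hx']
  | tmul a b =>
  induction y using TensorProduct.induction_on with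
  | zero => simp only [LinearMap.map_zero, LinearEquiv.map_zero, TensorProduct.zero_tmul,
      TensorProduct.tmul_zero]
  | add x x' hx hx' => simp only [TensorProduct.add_tmul, TensorProduct.tmul_add,
        LinearMap.map_add, LinearEquiv.map_add, hx, hx']
  | tmul a' b' =>
  induction z using TensorProduct.induction_on with
  | zero => simp only [LinearMap.map_zero, LinearEquiv.map_zero, TensorProduct.zero_tmul,
      TensorProduct.tmul_zero]
  | add x x' hx hx' => simp only [TensorProduct.tmul_add,
        LinearMap.map_add, LinearEquiv.map_add, hx, hx']
  | tmul a'' b'' =>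
  rw [mulMap_tmul, mulMap_tmul]
  have h1 : ∀ X : A ⊗[ℂ] B,
      R.mulMap (TensorProduct.map (LinearMap.mulLeft ℂ a) (LinearMap.mulRight ℂ b') X ⊗ₜ
        (a'' ⊗ₜ b'')) =
      R.mulMap (TensorProduct.map (LinearMap.mulLeft ℂ a) LinearMap.id X ⊗ₜ
        TensorProduct.map LinearMap.id (LinearMap.mulRight ℂ b'') (R.toLin (b' ⊗ₜ a''))) := by
    intro X
    induction X using TensorProduct.induction_on with
    | zero => simp only [LinearMap.map_zero, LinearEquiv.map_zero, TensorProduct.zero_tmul,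
        TensorProduct.tmul_zero]
    | add x y hx hy => simp only [TensorProduct.add_tmul,
          LinearMap.map_add, LinearEquiv.map_add, hx, hy]
    | tmul u v =>
      simp only [TensorProduct.map_tmul, LinearMap.mulLeft_apply, LinearMap.mulRight_apply,
        mulMap_tmul, LinearMap.id_apply, map_mul_left]
      induction R.toLin (b' ⊗ₜ a'') using TensorProduct.induction_on with
      | zero => simp only [LinearMap.map_zero, LinearEquiv.map_zero, TensorProduct.zero_tmul,
          TensorProduct.tmul_zero]
      | add x y hx hy => simp only [TensorProduct.tmul_add,
            LinearMap.map_add, LinearEquiv.map_add, hx, hy]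
      | tmul p q =>
        simp only [pushL_tmul, TensorProduct.map_tmul, mulMap_tmul, LinearMap.mulRight_apply,
          LinearMap.id_apply]
        induction R.toLin (v ⊗ₜ p) using TensorProduct.induction_on with
        | zero => simp only [LinearMap.map_zero, LinearEquiv.map_zero, TensorProduct.zero_tmul,
            TensorProduct.tmul_zero]
        | add x y hx hy => simp only [LinearMap.map_add, LinearEquiv.map_add, hx, hy]
        | tmul s t => simp [mul_assoc]
  have h2 : ∀ Y : A ⊗[ℂ] B,
      R.mulMap ((a ⊗ₜ b) ⊗ₜ
        TensorProduct.map (LinearMap.mulLeft ℂ a') (LinearMap.mulRight ℂ b'') Y) =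
      R.mulMap (TensorProduct.map (LinearMap.mulLeft ℂ a) LinearMap.id (R.toLin (b ⊗ₜ a')) ⊗ₜ
        TensorProduct.map LinearMap.id (LinearMap.mulRight ℂ b'') Y) := by
    intro Y
    induction Y using TensorProduct.induction_on with
    | zero => simp only [LinearMap.map_zero, LinearEquiv.map_zero, TensorProduct.zero_tmul,
        TensorProduct.tmul_zero]
    | add x y hx hy => simp only [TensorProduct.tmul_add,
          LinearMap.map_add, LinearEquiv.map_add, hx, hy]
    | tmul p q =>
      simp only [TensorProduct.map_tmul, LinearMap.mulLeft_apply, LinearMap.mulRight_apply,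
        mulMap_tmul, LinearMap.id_apply, map_mul_right]
      induction R.toLin (b ⊗ₜ a') using TensorProduct.induction_on with
      | zero => simp only [LinearMap.map_zero, LinearEquiv.map_zero, TensorProduct.zero_tmul,
          TensorProduct.tmul_zero]
      | add x y hx hy => simp only [TensorProduct.add_tmul,
            LinearMap.map_add, LinearEquiv.map_add, hx, hy]
      | tmul u v =>
        simp only [pushR_tmul, TensorProduct.map_tmul, mulMap_tmul, LinearMap.mulLeft_apply,
          LinearMap.id_apply]
        induction R.toLin (v ⊗ₜ p) using TensorProduct.induction_on with
        | zero => simp only [LinearMap.map_zero, LinearEquiv.map_zero, TensorProduct.zero_tmul,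
            TensorProduct.tmul_zero]
        | add x y hx hy => simp only [LinearMap.map_add, LinearEquiv.map_add, hx, hy]
        | tmul s t => simp [mul_assoc]
  rw [h1, h2]

/-- The twisted tensor product `A ⊗_R B`: the vector space `A ⊗ B` with the product `m_R`. -/
def Tensor (_R : TwistingMap A B) : Type u := A ⊗[ℂ] B

/-- The elementary tensor `a ⊗ b` in `A ⊗_R B`. -/
def tmul (a : A) (b : B) : R.Tensor := (a ⊗ₜ[ℂ] b : A ⊗[ℂ] B)

instance : AddCommGroup R.Tensor := inferInstanceAs (AddCommGroup (A ⊗[ℂ] B))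
instance : Module ℂ R.Tensor := inferInstanceAs (Module ℂ (A ⊗[ℂ] B))

/-- The identity map, from the tensor product to the twisted tensor product. -/
def of : A ⊗[ℂ] B ≃ₗ[ℂ] R.Tensor := LinearEquiv.refl ℂ (A ⊗[ℂ] B)

instance : Mul R.Tensor := ⟨fun x y => R.of (R.mulMap (R.of.symm x ⊗ₜ R.of.symm y))⟩
instance : One R.Tensor := ⟨R.tmul 1 1⟩

theorem mul_def (x y : A ⊗[ℂ] B) : R.of x * R.of y = R.of (R.mulMap (x ⊗ₜ y)) := rfl
theorem one_def : (1 : R.Tensor) = R.of (1 ⊗ₜ 1) := rfl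
theorem tmul_def (a : A) (b : B) : R.tmul a b = R.of (a ⊗ₜ b) := rfl

theorem mulMap_one_left (x : A ⊗[ℂ] B) : R.mulMap ((1 ⊗ₜ 1) ⊗ₜ x) = x := by
  induction x using TensorProduct.induction_on with
  | zero => simp only [LinearMap.map_zero, LinearEquiv.map_zero, TensorProduct.zero_tmul,
      TensorProduct.tmul_zero]
  | add x y hx hy => simp only [TensorProduct.tmul_add,
        LinearMap.map_add, LinearEquiv.map_add, hx, hy]
  | tmul a b => simp [mulMap_tmul, R.map_one_left]

theorem mulMap_one_right (x : A ⊗[ℂ] B) : R.mulMap (x ⊗ₜ (1 ⊗ₜ 1)) = x := by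
  induction x using TensorProduct.induction_on with
  | zero => simp only [LinearMap.map_zero, LinearEquiv.map_zero, TensorProduct.zero_tmul,
      TensorProduct.tmul_zero]
  | add x y hx hy => simp only [TensorProduct.add_tmul,
        LinearMap.map_add, LinearEquiv.map_add, hx, hy]
  | tmul a b => simp [mulMap_tmul, R.map_one_right]

instance : Ring R.Tensor where
  __ := (inferInstance : AddCommGroup R.Tensor)
  __ := (inferInstance : Mul R.Tensor)
  __ := (inferInstance : One R.Tensor)
  left_distrib x y z := by
    change R.of (R.mulMap (R.of.symm x ⊗ₜ R.of.symm (y + z))) = _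
    rw [map_add, TensorProduct.tmul_add, map_add, map_add]; rfl
  right_distrib x y z := by
    change R.of (R.mulMap (R.of.symm (x + y) ⊗ₜ R.of.symm z)) = _
    rw [map_add, TensorProduct.add_tmul, map_add, map_add]; rfl
  zero_mul x := by
    change R.of (R.mulMap (R.of.symm 0 ⊗ₜ R.of.symm x)) = _
    simp
  mul_zero x := by
    change R.of (R.mulMap (R.of.symm x ⊗ₜ R.of.symm 0)) = _
    simp
  mul_assoc x y z := R.mulMap_assoc x y z
  one_mul x := R.mulMap_one_left x
  mul_one x := R.mulMap_one_right x

instance : Algebra ℂ R.Tensor :=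
  Algebra.ofModule
    (fun r x y => by
      change R.of (R.mulMap (R.of.symm (r • x) ⊗ₜ R.of.symm y)) = _
      rw [map_smul, ← TensorProduct.smul_tmul', map_smul, map_smul]; rfl)
    (fun r x y => by
      change R.of (R.mulMap (R.of.symm x ⊗ₜ R.of.symm (r • y))) = _
      rw [map_smul, TensorProduct.tmul_smul, map_smul, map_smul]; rfl)

theorem tmul_mul_tmul (a a' : A) (b b' : B) :
    R.tmul a b * R.tmul a' b' = R.of (TensorProduct.map (LinearMap.mulLeft ℂ a)
      (LinearMap.mulRight ℂ b') (R.toLin (b ⊗ₜ a'))) := by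
  rw [tmul_def, tmul_def, mul_def, mulMap_tmul]

end

section Star
variable {A B : Type u} [Ring A] [Algebra ℂ A] [StarRing A] [StarModule ℂ A]
  [Ring B] [Algebra ℂ B] [StarRing B] [StarModule ℂ B] (R : TwistingMap A B)

/-- The conjugate linear map `a ⊗ b ↦ R (b* ⊗ a*)` -/
def starMap (x : A ⊗[ℂ] B) : A ⊗[ℂ] B := R.toLin (TensorProduct.comm ℂ A B (star x))

@[simp] theorem starMap_tmul (a : A) (b : B) :
    R.starMap (a ⊗ₜ b) = R.toLin (star b ⊗ₜ star a) := by simp [starMap]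
@[simp] theorem starMap_add (x y : A ⊗[ℂ] B) :
    R.starMap (x + y) = R.starMap x + R.starMap y := by simp [starMap]
@[simp] theorem starMap_zero : R.starMap 0 = 0 := by simp [starMap]
@[simp] theorem starMap_smul (c : ℂ) (x : A ⊗[ℂ] B) :
    R.starMap (c • x) = star c • R.starMap x := by simp [starMap]

/-- The twisting map is compatible with the involutions, that is,
`a ⊗ b ↦ (1 ⊗ b*) (a* ⊗ 1) = R (b* ⊗ a*)` is an involution of `A ⊗ B`. -/
def IsStar : Prop := ∀ x, R.starMap (R.starMap x) = x

theorem starMap_mul (hR : R.IsStar) (x y : A ⊗[ℂ] B) :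
    R.starMap (R.mulMap (x ⊗ₜ y)) = R.mulMap (R.starMap y ⊗ₜ R.starMap x) := by
  -- the special cases `star ((a ⊗ 1) X (1 ⊗ b))`
  have h1 : ∀ (a : A) (b : B) (X : A ⊗[ℂ] B),
      R.starMap (TensorProduct.map (LinearMap.mulLeft ℂ a) (LinearMap.mulRight ℂ b) X) =
        R.mulMap (R.mulMap ((1 ⊗ₜ star b) ⊗ₜ R.starMap X) ⊗ₜ (star a ⊗ₜ 1)) := by
    intro a b X
    induction X using TensorProduct.induction_on with
    | zero => simp
    | add x y hx hy =>
      simp only [TensorProduct.tmul_add, TensorProduct.add_tmul,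
            LinearMap.map_add, LinearEquiv.map_add, hx, hy, starMap_add]
    | tmul u v =>
      simp only [TensorProduct.map_tmul, LinearMap.mulLeft_apply, LinearMap.mulRight_apply,
        starMap_tmul, star_mul, map_mul_left]
      rw [map_mul_right]
      have h3 : ∀ X : A ⊗[ℂ] B, R.pushR (star a) X = R.mulMap (X ⊗ₜ (star a ⊗ₜ 1)) := by
        intro X
        induction X using TensorProduct.induction_on with
        | zero => simp only [LinearMap.map_zero, LinearEquiv.map_zero, TensorProduct.zero_tmul,
            TensorProduct.tmul_zero]
        | add x y hx hy => simp only [TensorProduct.add_tmul,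
              LinearMap.map_add, LinearEquiv.map_add, hx, hy]
        | tmul p q =>
          rw [pushR_tmul, mulMap_tmul, LinearMap.rTensor, LinearMap.mulRight_one]
      have h4 : ∀ X : A ⊗[ℂ] B, R.pushL (star b) X = R.mulMap ((1 ⊗ₜ star b) ⊗ₜ X) := by
        intro X
        induction X using TensorProduct.induction_on with
        | zero => simp only [LinearMap.map_zero, LinearEquiv.map_zero, TensorProduct.zero_tmul,
            TensorProduct.tmul_zero]
        | add x y hx hy => simp only [TensorProduct.tmul_add,
              LinearMap.map_add, LinearEquiv.map_add, hx, hy]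
        | tmul p q =>
          rw [pushL_tmul, mulMap_tmul, LinearMap.lTensor, LinearMap.mulLeft_one]
      rw [h3, h4, mulMap_assoc]
  have h2 : ∀ (a : A) (b : B), R.mulMap ((1 ⊗ₜ b) ⊗ₜ (a ⊗ₜ 1)) = R.toLin (b ⊗ₜ a) := by
    intro a b
    rw [mulMap_tmul, LinearMap.mulLeft_one, LinearMap.mulRight_one, TensorProduct.map_id]; rfl
  have h5 : ∀ (a : A) (b : B), R.mulMap ((a ⊗ₜ 1) ⊗ₜ (1 ⊗ₜ b)) = a ⊗ₜ b := by
    intro a b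
    rw [mulMap_tmul, R.map_one_left]; simp
  induction x using TensorProduct.induction_on with
  | zero => simp
  | add x x' hx hx' =>
    simp only [TensorProduct.add_tmul, TensorProduct.tmul_add,
          LinearMap.map_add, LinearEquiv.map_add, starMap_add, hx, hx']
  | tmul a b =>
  induction y using TensorProduct.induction_on with
  | zero => simp
  | add x x' hx hx' =>
    simp only [TensorProduct.add_tmul, TensorProduct.tmul_add,
          LinearMap.map_add, LinearEquiv.map_add, starMap_add, hx, hx']
  | tmul a' b' =>
  rw [mulMap_tmul, h1]
  have h6 : R.starMap (R.toLin (b ⊗ₜ a')) = star a' ⊗ₜ star b := by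
    have := hR (star a' ⊗ₜ star b)
    simpa using this
  rw [h6, starMap_tmul, starMap_tmul, ← h2, ← h2, ← h5 (star a') (star b)]
  simp only [mulMap_assoc]

/-- A twisting map that is compatible with the involutions. -/
class StarCompat : Prop where
  isStar : R.IsStar

instance [h : R.StarCompat] : StarRing R.Tensor where
  star x := R.of (R.starMap (R.of.symm x))
  star_involutive x := h.isStar x
  star_mul x y := R.starMap_mul h.isStar x y
  star_add x y := R.starMap_add x y

theorem star_def [R.StarCompat] (x : A ⊗[ℂ] B) : star (R.of x) = R.of (R.starMap x) := rfl

instance [R.StarCompat] : StarModule ℂ R.Tensor where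
  star_smul c x := R.starMap_smul c x

end Star
end TwistingMap

namespace TwistingMap

section
variable {A B : Type u} [Ring A] [Algebra ℂ A] [Ring B] [Algebra ℂ B]

/-- The flip `b ⊗ a ↦ a ⊗ b`. -/
def flip (A B : Type u) [Ring A] [Algebra ℂ A] [Ring B] [Algebra ℂ B] : TwistingMap A B where
  toLin := (TensorProduct.comm ℂ B A).toLinearMap
  map_one_left a := by simp
  map_one_right b := by simp
  comp_mul_right := comp_mul_right_of _ (by intros; simp)
  comp_mul_left := comp_mul_left_of _ (by intros; simp)

@[simp] theorem flip_toLin (a : A) (b : B) : (flip A B).toLin (b ⊗ₜ a) = a ⊗ₜ b := rfl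

end

section
variable {A B C : Type u} [Ring A] [Algebra ℂ A] [Ring B] [Algebra ℂ B] [Ring C] [Algebra ℂ C]
  (R₁ : TwistingMap A B) (R₂ : TwistingMap B C) (R₃ : TwistingMap A C)

/-- The compatibility condition (hexagon equation)
`(id_A ⊗ R₂) ∘ (R₃ ⊗ id_B) ∘ (id_C ⊗ R₁) = (R₁ ⊗ id_C) ∘ (id_B ⊗ R₃) ∘ (R₂ ⊗ id_A)`,
as maps `C ⊗ B ⊗ A → A ⊗ B ⊗ C`. -/
def Hexagon : Prop :=
  R₂.toLin.lTensor A ∘ₗ (TensorProduct.assoc ℂ A C B).toLinearMap ∘ₗ R₃.toLin.rTensor B ∘ₗ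
      (TensorProduct.assoc ℂ C A B).symm.toLinearMap ∘ₗ R₁.toLin.lTensor C =
    (TensorProduct.assoc ℂ A B C).toLinearMap ∘ₗ R₁.toLin.rTensor C ∘ₗ
      (TensorProduct.assoc ℂ B A C).symm.toLinearMap ∘ₗ R₃.toLin.lTensor B ∘ₗ
        (TensorProduct.assoc ℂ B C A).toLinearMap ∘ₗ R₂.toLin.rTensor A ∘ₗ
          (TensorProduct.assoc ℂ C B A).symm.toLinearMap

/-- `u ⊗ v ↦ R₁ (b ⊗ u) ⊗ v` -/
def lam (C : Type u) [Ring C] [Algebra ℂ C] (b : B) : A ⊗[ℂ] C →ₗ[ℂ] A ⊗[ℂ] (B ⊗[ℂ] C) :=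
  (TensorProduct.assoc ℂ A B C).toLinearMap ∘ₗ (R₁.toLin ∘ₗ TensorProduct.mk ℂ B A b).rTensor C

/-- The map `T₂ = (R₁ ⊗ id_C) ∘ (id_B ⊗ R₃) : (B ⊗ C) ⊗ A → A ⊗ (B ⊗ C)`. -/
def extLin : (B ⊗[ℂ] C) ⊗[ℂ] A →ₗ[ℂ] A ⊗[ℂ] (B ⊗[ℂ] C) :=
  (TensorProduct.assoc ℂ A B C).toLinearMap ∘ₗ R₁.toLin.rTensor C ∘ₗ
    (TensorProduct.assoc ℂ B A C).symm.toLinearMap ∘ₗ R₃.toLin.lTensor B ∘ₗ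
      (TensorProduct.assoc ℂ B C A).toLinearMap

/-- `p ⊗ q ↦ (id_A ⊗ R₂) (R₃ (c ⊗ p) ⊗ q)` -/
def mu (c : C) : A ⊗[ℂ] B →ₗ[ℂ] A ⊗[ℂ] (B ⊗[ℂ] C) :=
  R₂.toLin.lTensor A ∘ₗ (TensorProduct.assoc ℂ A C B).toLinearMap ∘ₗ
    (R₃.toLin ∘ₗ TensorProduct.mk ℂ C A c).rTensor B

theorem lam_tmul (b : B) (u : A) (v : C) :
    R₁.lam C b (u ⊗ₜ v) = TensorProduct.assoc ℂ A B C (R₁.toLin (b ⊗ₜ u) ⊗ₜ v) := rfl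

theorem extLin_tmul (b : B) (c : C) (a : A) :
    extLin R₁ R₃ ((b ⊗ₜ c) ⊗ₜ a) = R₁.lam C b (R₃.toLin (c ⊗ₜ a)) := by
  simp only [extLin, lam, LinearMap.comp_apply, LinearEquiv.coe_coe, TensorProduct.assoc_tmul,
    LinearMap.lTensor_tmul]
  induction R₃.toLin (c ⊗ₜ a) using TensorProduct.induction_on with
  | zero => simp only [LinearMap.map_zero, LinearEquiv.map_zero, TensorProduct.zero_tmul,
      TensorProduct.tmul_zero]
  | tmul x y => simp
  | add x y hx hy => simp only [TensorProduct.tmul_add,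
        LinearMap.map_add, LinearEquiv.map_add, hx, hy]

theorem mu_tmul (c : C) (p : A) (q : B) :
    mu R₂ R₃ c (p ⊗ₜ q) =
      (R₂.toLin ∘ₗ (TensorProduct.mk ℂ C B).flip q).lTensor A (R₃.toLin (c ⊗ₜ p)) := by
  simp only [mu, LinearMap.comp_apply, LinearMap.rTensor_tmul, TensorProduct.mk_apply,
    LinearEquiv.coe_coe]
  induction R₃.toLin (c ⊗ₜ p) using TensorProduct.induction_on with
  | zero => simp only [LinearMap.map_zero, LinearEquiv.map_zero, TensorProduct.zero_tmul,
      TensorProduct.tmul_zero]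
  | tmul x y => simp
  | add x y hx hy => simp only [TensorProduct.add_tmul,
        LinearMap.map_add, LinearEquiv.map_add, hx, hy]

variable {R₁ R₂ R₃}

theorem hexagon_iff : Hexagon R₁ R₂ R₃ ↔
    ∀ (a : A) (b : B) (c : C),
      mu R₂ R₃ c (R₁.toLin (b ⊗ₜ a)) = extLin R₁ R₃ (R₂.toLin (c ⊗ₜ b) ⊗ₜ a) := by
  have key : ∀ (c : C) (X : A ⊗[ℂ] B),
      (TensorProduct.assoc ℂ A C B) (R₃.toLin.rTensor B
        ((TensorProduct.assoc ℂ C A B).symm (c ⊗ₜ X))) =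
      (TensorProduct.assoc ℂ A C B) ((R₃.toLin ∘ₗ TensorProduct.mk ℂ C A c).rTensor B X) := by
    intro c X
    induction X using TensorProduct.induction_on with
    | zero => simp only [LinearMap.map_zero, LinearEquiv.map_zero, TensorProduct.zero_tmul,
        TensorProduct.tmul_zero]
    | tmul x y => simp
    | add x y hx hy => simp only [TensorProduct.tmul_add,
          LinearMap.map_add, LinearEquiv.map_add, hx, hy]
  constructor
  · intro h a b c
    have := LinearMap.congr_fun h (c ⊗ₜ (b ⊗ₜ a))
    simp only [LinearMap.comp_apply, LinearEquiv.coe_coe, LinearMap.lTensor_tmul, key] at this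
    simpa [mu, extLin] using this
  · intro h
    refine TensorProduct.ext' fun c x => ?_
    induction x using TensorProduct.induction_on with
    | zero => simp only [LinearMap.map_zero, LinearEquiv.map_zero, TensorProduct.zero_tmul,
        TensorProduct.tmul_zero]
    | add x y hx hy => simp only [TensorProduct.tmul_add,
          LinearMap.map_add, LinearEquiv.map_add, hx, hy]
    | tmul b a =>
      have := h a b c
      simp only [LinearMap.comp_apply, LinearEquiv.coe_coe, LinearMap.lTensor_tmul, key]
      simpa [mu, extLin] using this

variable (R₁ R₂ R₃)

/-- `p ⊗ (q ⊗ t) ↦ (id ⊗ m ⊗ id) (R₁ (b ⊗ p) ⊗ q ⊗ t)` -/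
def psi (C : Type u) [Ring C] [Algebra ℂ C] (b : B) :
    A ⊗[ℂ] (B ⊗[ℂ] C) →ₗ[ℂ] A ⊗[ℂ] (B ⊗[ℂ] C) :=
  ((LinearMap.mul' ℂ B).rTensor C ∘ₗ
    (TensorProduct.assoc ℂ B B C).symm.toLinearMap).lTensor A ∘ₗ
  (TensorProduct.assoc ℂ A B (B ⊗[ℂ] C)).toLinearMap ∘ₗ
    (R₁.toLin ∘ₗ TensorProduct.mk ℂ B A b).rTensor (B ⊗[ℂ] C)

/-- `(p ⊗ (q ⊗ t)) ⊗ v ↦ p ⊗ (q ⊗ t v)` -/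
def theta (A B C : Type u) [Ring A] [Algebra ℂ A] [Ring B] [Algebra ℂ B] [Ring C] [Algebra ℂ C] :
    (A ⊗[ℂ] (B ⊗[ℂ] C)) ⊗[ℂ] C →ₗ[ℂ] A ⊗[ℂ] (B ⊗[ℂ] C) :=
  ((LinearMap.mul' ℂ C).lTensor B ∘ₗ (TensorProduct.assoc ℂ B C C).toLinearMap).lTensor A ∘ₗ
    (TensorProduct.assoc ℂ A (B ⊗[ℂ] C) C).toLinearMap

theorem extLin_mul_aux (a : A) (b : B) (c' : C) (Z : B ⊗[ℂ] C) :
    extLin R₁ R₃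
        (TensorProduct.map (LinearMap.mulLeft ℂ b) (LinearMap.mulRight ℂ c') Z ⊗ₜ a) =
      theta A B C ((R₁.psi C b ∘ₗ extLin R₁ R₃ ∘ₗ TensorProduct.mk ℂ _ A Z).rTensor C
        (R₃.toLin (c' ⊗ₜ a))) := by
  induction Z using TensorProduct.induction_on with
  | zero => simp
  | add x y hx hy =>
    rw [map_add, TensorProduct.add_tmul, map_add, hx, hy, map_add, LinearMap.comp_add,
      LinearMap.comp_add, LinearMap.rTensor_add, LinearMap.add_apply, map_add]
  | tmul s t =>
    simp only [TensorProduct.map_tmul, LinearMap.mulLeft_apply, LinearMap.mulRight_apply]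
    rw [extLin_tmul, map_mul_left]
    induction R₃.toLin (c' ⊗ₜ a) using TensorProduct.induction_on with
    | zero => simp only [LinearMap.map_zero, LinearEquiv.map_zero, TensorProduct.zero_tmul,
        TensorProduct.tmul_zero]
    | add x y hx hy => simp only [LinearMap.map_add, LinearEquiv.map_add, hx, hy]
    | tmul u v =>
      simp only [pushL_tmul, LinearMap.rTensor_tmul, LinearMap.comp_apply, TensorProduct.mk_apply,
        extLin_tmul]
      induction R₃.toLin (t ⊗ₜ u) using TensorProduct.induction_on with
      | zero => simp only [LinearMap.map_zero, LinearEquiv.map_zero, TensorProduct.zero_tmul,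
          TensorProduct.tmul_zero]
      | add x y hx hy => simp only [TensorProduct.add_tmul,
            LinearMap.map_add, LinearEquiv.map_add, hx, hy]
      | tmul p q =>
        simp only [LinearMap.lTensor_tmul, lam_tmul, map_mul_left, LinearMap.mulRight_apply]
        induction R₁.toLin (s ⊗ₜ p) using TensorProduct.induction_on with
        | zero => simp only [LinearMap.map_zero, LinearEquiv.map_zero, TensorProduct.zero_tmul,
            TensorProduct.tmul_zero]
        | add x y hx hy => simp only [TensorProduct.add_tmul,
              LinearMap.map_add, LinearEquiv.map_add, hx, hy]
        | tmul p' q' =>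
          simp only [pushL_tmul, psi, LinearMap.comp_apply, TensorProduct.assoc_tmul,
            LinearEquiv.coe_coe, LinearMap.rTensor_tmul, TensorProduct.mk_apply]
          induction R₁.toLin (b ⊗ₜ p') using TensorProduct.induction_on with
          | zero => simp only [LinearMap.map_zero, LinearEquiv.map_zero, TensorProduct.zero_tmul,
              TensorProduct.tmul_zero]
          | add x y hx hy => simp only [TensorProduct.add_tmul,
                LinearMap.map_add, LinearEquiv.map_add, hx, hy]
          | tmul x y => simp [theta]

theorem extLin_mul_left (h : Hexagon R₁ R₂ R₃) (x y : B ⊗[ℂ] C) (a : A) :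
    extLin R₁ R₃ (R₂.mulMap (x ⊗ₜ y) ⊗ₜ a) =
      (R₂.mulMap.lTensor A ∘ₗ (TensorProduct.assoc ℂ A _ _).toLinearMap ∘ₗ
        (extLin R₁ R₃ ∘ₗ TensorProduct.mk ℂ _ A x).rTensor (B ⊗[ℂ] C))
        (extLin R₁ R₃ (y ⊗ₜ a)) := by
  induction y using TensorProduct.induction_on with
  | zero => simp only [LinearMap.map_zero, LinearEquiv.map_zero, TensorProduct.zero_tmul,
      TensorProduct.tmul_zero]
  | add x y hx hy => simp only [TensorProduct.add_tmul, TensorProduct.tmul_add,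
        LinearMap.map_add, LinearEquiv.map_add, hx, hy]
  | tmul b' c' =>
  induction x using TensorProduct.induction_on with
  | zero => simp
  | add x x' hx hx' =>
    rw [TensorProduct.add_tmul, map_add, TensorProduct.add_tmul, map_add, hx, hx', map_add,
      LinearMap.comp_add, LinearMap.rTensor_add]
    simp only [LinearMap.comp_apply, LinearMap.add_apply, LinearMap.map_add, LinearEquiv.map_add]
  | tmul b c =>
  rw [mulMap_tmul, extLin_mul_aux, extLin_tmul]
  induction R₃.toLin (c' ⊗ₜ a) using TensorProduct.induction_on with
  | zero => simp only [LinearMap.map_zero, LinearEquiv.map_zero, TensorProduct.zero_tmul,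
      TensorProduct.tmul_zero]
  | add x y hx hy => simp only [LinearMap.map_add, LinearEquiv.map_add, hx, hy]
  | tmul u v =>
    simp only [LinearMap.rTensor_tmul, LinearMap.comp_apply, TensorProduct.mk_apply, lam_tmul]
    rw [← hexagon_iff.1 h]
    induction R₁.toLin (b' ⊗ₜ u) using TensorProduct.induction_on with
    | zero => simp only [LinearMap.map_zero, LinearEquiv.map_zero, TensorProduct.zero_tmul,
        TensorProduct.tmul_zero]
    | add x y hx hy => simp only [TensorProduct.add_tmul,
          LinearMap.map_add, LinearEquiv.map_add, hx, hy]
    | tmul p q =>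
      simp only [mu_tmul, TensorProduct.assoc_tmul, LinearMap.rTensor_tmul,
        LinearMap.comp_apply, TensorProduct.mk_apply, LinearEquiv.coe_coe, extLin_tmul]
      induction R₃.toLin (c ⊗ₜ p) using TensorProduct.induction_on with
      | zero => simp only [LinearMap.map_zero, LinearEquiv.map_zero, TensorProduct.zero_tmul,
          TensorProduct.tmul_zero]
      | add x y hx hy => simp only [TensorProduct.add_tmul,
            LinearMap.map_add, LinearEquiv.map_add, hx, hy]
      | tmul p₁ c₁ =>
        simp only [lam_tmul, LinearMap.lTensor_tmul, LinearMap.comp_apply, LinearMap.flip_apply,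
          TensorProduct.mk_apply, psi, LinearMap.rTensor_tmul, LinearEquiv.coe_coe]
        induction R₁.toLin (b ⊗ₜ p₁) using TensorProduct.induction_on with
        | zero => simp only [LinearMap.map_zero, LinearEquiv.map_zero, TensorProduct.zero_tmul,
            TensorProduct.tmul_zero]
        | add x y hx hy => simp only [TensorProduct.add_tmul,
              LinearMap.map_add, LinearEquiv.map_add, hx, hy]
        | tmul p₂ b₁ =>
          simp only [TensorProduct.assoc_tmul, LinearMap.lTensor_tmul, mulMap_tmul]
          induction R₂.toLin (c₁ ⊗ₜ q) using TensorProduct.induction_on with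
          | zero => simp only [LinearMap.map_zero, LinearEquiv.map_zero, TensorProduct.zero_tmul,
              TensorProduct.tmul_zero]
          | add x y hx hy => simp only [TensorProduct.add_tmul, TensorProduct.tmul_add,
                LinearMap.map_add, LinearEquiv.map_add, hx, hy]
          | tmul x y => simp [theta]

/-- If the hexagon equation holds, `T₂` is a twisting map
`(B ⊗_{R₂} C) ⊗ A → A ⊗ (B ⊗_{R₂} C)`. -/
def extend (h : Hexagon R₁ R₂ R₃) : TwistingMap A R₂.Tensor where
  toLin := R₂.of.toLinearMap.lTensor A ∘ₗ extLin R₁ R₃ ∘ₗ R₂.of.symm.toLinearMap.rTensor A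
  map_one_left a := by
    rw [one_def]
    simp [extLin, R₁.map_one_left, R₃.map_one_left]
  map_one_right x := by
    obtain ⟨x, rfl⟩ := R₂.of.surjective x
    induction x using TensorProduct.induction_on with
    | zero => simp only [LinearMap.map_zero, LinearEquiv.map_zero, TensorProduct.zero_tmul,
        TensorProduct.tmul_zero]
    | add x y hx hy => simp only [TensorProduct.add_tmul, TensorProduct.tmul_add,
          LinearMap.map_add, LinearEquiv.map_add, hx, hy]
    | tmul b c => simp [extLin, R₁.map_one_right, R₃.map_one_right]
  comp_mul_right := comp_mul_right_of _ (by
    intro x a a'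
    obtain ⟨x, rfl⟩ := R₂.of.surjective x
    simp only [LinearMap.comp_apply, LinearMap.rTensor_tmul, LinearEquiv.coe_coe,
      LinearEquiv.symm_apply_apply]
    induction x using TensorProduct.induction_on with
    | zero => simp only [LinearMap.map_zero, LinearEquiv.map_zero, TensorProduct.zero_tmul,
        TensorProduct.tmul_zero]
    | add x y hx hy => simp only [TensorProduct.add_tmul,
          LinearMap.map_add, LinearEquiv.map_add, hx, hy]
    | tmul b c =>
      rw [extLin_tmul, extLin_tmul, map_mul_right]
      induction R₃.toLin (c ⊗ₜ a) using TensorProduct.induction_on with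
      | zero => simp only [LinearMap.map_zero, LinearEquiv.map_zero, TensorProduct.zero_tmul,
          TensorProduct.tmul_zero]
      | add x y hx hy => simp only [LinearMap.map_add, LinearEquiv.map_add, hx, hy]
      | tmul u v =>
        have h1 : ∀ W : A ⊗[ℂ] C, R₁.lam C b ((LinearMap.mulLeft ℂ u).rTensor C W) =
            ((LinearMap.mul' ℂ A).rTensor (B ⊗[ℂ] C) ∘ₗ
              (TensorProduct.assoc ℂ A A (B ⊗[ℂ] C)).symm.toLinearMap ∘ₗ
              (TensorProduct.assoc ℂ A B C).toLinearMap.lTensor A ∘ₗ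
              (R₁.toLin.rTensor C ∘ₗ (TensorProduct.assoc ℂ B A C).symm.toLinearMap).lTensor A)
            (TensorProduct.assoc ℂ A B (A ⊗[ℂ] C) (R₁.toLin (b ⊗ₜ u) ⊗ₜ W)) := by
          intro W
          induction W using TensorProduct.induction_on with
          | zero => simp only [LinearMap.map_zero, LinearEquiv.map_zero, TensorProduct.zero_tmul,
              TensorProduct.tmul_zero]
          | add x y hx hy => simp only [TensorProduct.tmul_add,
                LinearMap.map_add, LinearEquiv.map_add, hx, hy]
          | tmul p q =>
            simp only [LinearMap.rTensor_tmul, LinearMap.mulLeft_apply, lam_tmul, map_mul_right]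
            induction R₁.toLin (b ⊗ₜ u) using TensorProduct.induction_on with
            | zero => simp only [LinearMap.map_zero, LinearEquiv.map_zero, TensorProduct.zero_tmul,
                TensorProduct.tmul_zero]
            | add x y hx hy => simp only [TensorProduct.add_tmul,
                  LinearMap.map_add, LinearEquiv.map_add, hx, hy]
            | tmul s t =>
              simp only [pushR_tmul, LinearMap.comp_apply, LinearEquiv.coe_coe,
                TensorProduct.assoc_tmul, LinearMap.lTensor_tmul, TensorProduct.assoc_symm_tmul,
                LinearMap.rTensor_tmul]
              induction R₁.toLin (t ⊗ₜ p) using TensorProduct.induction_on with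
              | zero => simp only [LinearMap.map_zero, LinearEquiv.map_zero, TensorProduct.zero_tmul,
                  TensorProduct.tmul_zero]
              | add x y hx hy => simp only [TensorProduct.add_tmul, TensorProduct.tmul_add,
                  LinearMap.map_add, LinearEquiv.map_add, hx, hy]
              | tmul s t => simp
        rw [pushR_tmul, h1, lam_tmul]
        induction R₁.toLin (b ⊗ₜ u) using TensorProduct.induction_on with
        | zero => simp only [LinearMap.map_zero, LinearEquiv.map_zero, TensorProduct.zero_tmul,
            TensorProduct.tmul_zero]
        | add x y hx hy => simp only [TensorProduct.add_tmul,
              LinearMap.map_add, LinearEquiv.map_add, hx, hy]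
        | tmul s t =>
          simp only [LinearMap.comp_apply, LinearEquiv.coe_coe,
            TensorProduct.assoc_tmul, LinearMap.lTensor_tmul, LinearMap.flip_apply,
            TensorProduct.mk_apply, LinearMap.rTensor_tmul, LinearEquiv.symm_apply_apply]
          rw [extLin_tmul]
          induction R₃.toLin (v ⊗ₜ a') using TensorProduct.induction_on with
          | zero => simp only [LinearMap.map_zero, LinearEquiv.map_zero, TensorProduct.zero_tmul,
              TensorProduct.tmul_zero]
          | add x y hx hy => simp only [TensorProduct.tmul_add,
                LinearMap.map_add, LinearEquiv.map_add, hx, hy]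
          | tmul p q =>
            rw [lam_tmul]
            simp only [TensorProduct.assoc_symm_tmul, LinearMap.rTensor_tmul]
            induction R₁.toLin (t ⊗ₜ p) using TensorProduct.induction_on with
            | zero => simp only [LinearMap.map_zero, LinearEquiv.map_zero, TensorProduct.zero_tmul,
                TensorProduct.tmul_zero]
            | add x y hx hy => simp only [TensorProduct.add_tmul, TensorProduct.tmul_add,
                LinearMap.map_add, LinearEquiv.map_add, hx, hy]
            | tmul s t => simp)
  comp_mul_left := comp_mul_left_of _ (by
    intro x y a
    obtain ⟨x, rfl⟩ := R₂.of.surjective x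
    obtain ⟨y, rfl⟩ := R₂.of.surjective y
    rw [mul_def]
    simp only [LinearMap.comp_apply, LinearMap.rTensor_tmul, LinearEquiv.coe_coe,
      LinearEquiv.symm_apply_apply]
    rw [extLin_mul_left R₁ R₂ R₃ h]
    induction extLin R₁ R₃ (y ⊗ₜ a) using TensorProduct.induction_on with
    | zero => simp only [LinearMap.map_zero, LinearEquiv.map_zero, TensorProduct.zero_tmul,
        TensorProduct.tmul_zero]
    | add x y hx hy => simp only [LinearMap.map_add, LinearEquiv.map_add, hx, hy]
    | tmul p z =>
      simp only [LinearMap.comp_apply, LinearMap.rTensor_tmul, LinearEquiv.coe_coe,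
        LinearMap.lTensor_tmul, TensorProduct.mk_apply, LinearEquiv.symm_apply_apply]
      induction extLin R₁ R₃ (x ⊗ₜ p) using TensorProduct.induction_on with
      | zero => simp only [LinearMap.map_zero, LinearEquiv.map_zero, TensorProduct.zero_tmul,
          TensorProduct.tmul_zero]
      | add x y hx hy => simp only [TensorProduct.add_tmul,
            LinearMap.map_add, LinearEquiv.map_add, hx, hy]
      | tmul q w => simp [mul_def])

theorem extend_toLin (h : Hexagon R₁ R₂ R₃) (x : B ⊗[ℂ] C) (a : A) :
    (extend R₁ R₂ R₃ h).toLin (R₂.of x ⊗ₜ a) =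
      R₂.of.toLinearMap.lTensor A (extLin R₁ R₃ (x ⊗ₜ a)) := by
  simp [extend]

end
end TwistingMap

namespace TwistingMap

section
variable {A B D E : Type u} [Ring A] [Algebra ℂ A] [Ring B] [Algebra ℂ B]
  [Ring D] [Algebra ℂ D] [Ring E] [Algebra ℂ E]
  (R : TwistingMap A B) (RA : TwistingMap A D) (RB : TwistingMap B D) (T : TwistingMap D E)
  (TA : TwistingMap A E) (TB : TwistingMap B E)

/-- The hexagon equation is inherited by the maps `extend`. -/
theorem Hexagon.extend (hA : Hexagon RA T TA) (hB : Hexagon RB T TB)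
    (hD : Hexagon R RB RA) (hE : Hexagon R TB TA) :
    Hexagon R (TwistingMap.extend RB T TB hB) (TwistingMap.extend RA T TA hA) := by
  rw [hexagon_iff]
  intro a b x
  obtain ⟨x, rfl⟩ := T.of.surjective x
  rw [extend_toLin]
  induction x using TensorProduct.induction_on with
  | zero => simp [mu]
  | add x y hx hy =>
    have : mu (TwistingMap.extend RB T TB hB) (TwistingMap.extend RA T TA hA) (T.of (x + y)) =
        mu (TwistingMap.extend RB T TB hB) (TwistingMap.extend RA T TA hA) (T.of x) +
        mu (TwistingMap.extend RB T TB hB) (TwistingMap.extend RA T TA hA) (T.of y) := by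
      simp only [mu,
            LinearMap.map_add, LinearEquiv.map_add, LinearMap.comp_add, LinearMap.rTensor_add]
    rw [this, LinearMap.add_apply, hx, hy]
    simp only [TensorProduct.add_tmul, LinearMap.map_add, LinearEquiv.map_add]
  | tmul d e =>
    let P : (A ⊗[ℂ] (B ⊗[ℂ] D)) ⊗[ℂ] E →ₗ[ℂ] A ⊗[ℂ] (B ⊗[ℂ] (D ⊗[ℂ] E)) :=
      (TensorProduct.assoc ℂ B D E).toLinearMap.lTensor A ∘ₗ
        (TensorProduct.assoc ℂ A (B ⊗[ℂ] D) E).toLinearMap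
    let Λ : A ⊗[ℂ] (B ⊗[ℂ] E) →ₗ[ℂ] A ⊗[ℂ] (B ⊗[ℂ] (D ⊗[ℂ] E)) :=
      P ∘ₗ (mu RB RA d).rTensor E ∘ₗ (TensorProduct.assoc ℂ A B E).symm.toLinearMap
    let W : D ⊗[ℂ] (B ⊗[ℂ] E) →ₗ[ℂ] B ⊗[ℂ] (D ⊗[ℂ] E) :=
      (TensorProduct.assoc ℂ B D E).toLinearMap ∘ₗ RB.toLin.rTensor E ∘ₗ
        (TensorProduct.assoc ℂ D B E).symm.toLinearMap
    have hW : ∀ (d : D) (Y : B ⊗[ℂ] E), W (d ⊗ₜ Y) = RB.lam E d Y := by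
      intro d Y
      induction Y using TensorProduct.induction_on with
      | zero => simp only [LinearMap.map_zero, LinearEquiv.map_zero, TensorProduct.zero_tmul,
          TensorProduct.tmul_zero]
      | add x y hx hy => simp only [TensorProduct.tmul_add,
            LinearMap.map_add, LinearEquiv.map_add, hx, hy]
      | tmul q e => simp [W, lam_tmul]
    have hΛ : ∀ (p : A) (Y : B ⊗[ℂ] E), Λ (p ⊗ₜ Y) =
        W.lTensor A (TensorProduct.assoc ℂ A D (B ⊗[ℂ] E) (RA.toLin (d ⊗ₜ p) ⊗ₜ Y)) := by
      intro p Y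
      induction Y using TensorProduct.induction_on with
      | zero => simp only [LinearMap.map_zero, LinearEquiv.map_zero, TensorProduct.zero_tmul,
          TensorProduct.tmul_zero]
      | add x y hx hy => simp only [TensorProduct.tmul_add,
            LinearMap.map_add, LinearEquiv.map_add, hx, hy]
      | tmul q e =>
        simp only [Λ, LinearMap.comp_apply, LinearEquiv.coe_coe, TensorProduct.assoc_symm_tmul,
          LinearMap.rTensor_tmul, mu_tmul]
        induction RA.toLin (d ⊗ₜ p) using TensorProduct.induction_on with
        | zero => simp only [LinearMap.map_zero, LinearEquiv.map_zero, TensorProduct.zero_tmul,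
            TensorProduct.tmul_zero]
        | add x y hx hy => simp only [TensorProduct.add_tmul,
              LinearMap.map_add, LinearEquiv.map_add, hx, hy]
        | tmul p₂ d₁ => simp [P, hW, lam_tmul]
    have h1 : ∀ X : A ⊗[ℂ] B,
        mu (TwistingMap.extend RB T TB hB) (TwistingMap.extend RA T TA hA) (T.of (d ⊗ₜ e)) X =
          (T.of.toLinearMap.lTensor B).lTensor A (Λ (mu TB TA e X)) := by
      intro X
      induction X using TensorProduct.induction_on with
      | zero => simp only [LinearMap.map_zero, LinearEquiv.map_zero, TensorProduct.zero_tmul,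
          TensorProduct.tmul_zero]
      | add x y hx hy => simp only [LinearMap.map_add, LinearEquiv.map_add, hx, hy]
      | tmul p q =>
        rw [mu_tmul, mu_tmul, extend_toLin, extLin_tmul]
        induction TA.toLin (e ⊗ₜ p) using TensorProduct.induction_on with
        | zero => simp only [LinearMap.map_zero, LinearEquiv.map_zero, TensorProduct.zero_tmul,
            TensorProduct.tmul_zero]
        | add x y hx hy => simp only [LinearMap.map_add, LinearEquiv.map_add, hx, hy]
        | tmul p₁ e₁ =>
          simp only [lam_tmul, LinearMap.lTensor_tmul, LinearMap.comp_apply, LinearMap.flip_apply,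
            TensorProduct.mk_apply, hΛ]
          induction RA.toLin (d ⊗ₜ p₁) using TensorProduct.induction_on with
          | zero => simp only [LinearMap.map_zero, LinearEquiv.map_zero, TensorProduct.zero_tmul,
              TensorProduct.tmul_zero]
          | add x y hx hy => simp only [TensorProduct.add_tmul,
                LinearMap.map_add, LinearEquiv.map_add, hx, hy]
          | tmul p₂ d₁ =>
            simp only [TensorProduct.assoc_tmul, LinearMap.lTensor_tmul, hW, LinearMap.comp_apply,
              LinearMap.flip_apply, TensorProduct.mk_apply, LinearEquiv.coe_coe, extend_toLin,
              extLin_tmul]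
    have h2 : ∀ (e₁ : E) (X : B ⊗[ℂ] D),
        extLin R (TwistingMap.extend RA T TA hA) (T.of.toLinearMap.lTensor B
          (TensorProduct.assoc ℂ B D E (X ⊗ₜ e₁)) ⊗ₜ a) =
        (T.of.toLinearMap.lTensor B).lTensor A (P ((extLin R RA).rTensor E
          ((TensorProduct.assoc ℂ (B ⊗[ℂ] D) A E).symm (X ⊗ₜ TA.toLin (e₁ ⊗ₜ a))))) := by
      intro e₁ X
      induction X using TensorProduct.induction_on with
      | zero => simp only [LinearMap.map_zero, LinearEquiv.map_zero, TensorProduct.zero_tmul,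
          TensorProduct.tmul_zero]
      | add x y hx hy => simp only [TensorProduct.add_tmul,
            LinearMap.map_add, LinearEquiv.map_add, hx, hy]
      | tmul b₂ d₁ =>
        simp only [TensorProduct.assoc_tmul, LinearMap.lTensor_tmul, extLin_tmul, extend_toLin,
          LinearEquiv.coe_coe]
        induction TA.toLin (e₁ ⊗ₜ a) using TensorProduct.induction_on with
        | zero => simp only [LinearMap.map_zero, LinearEquiv.map_zero, TensorProduct.zero_tmul,
            TensorProduct.tmul_zero]
        | add x y hx hy => simp only [TensorProduct.tmul_add,
              LinearMap.map_add, LinearEquiv.map_add, hx, hy]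
        | tmul a₁ e₂ =>
          simp only [lam_tmul, TensorProduct.assoc_symm_tmul, LinearMap.rTensor_tmul, extLin_tmul]
          induction RA.toLin (d₁ ⊗ₜ a₁) using TensorProduct.induction_on with
          | zero => simp only [LinearMap.map_zero, LinearEquiv.map_zero, TensorProduct.zero_tmul,
              TensorProduct.tmul_zero]
          | add x y hx hy => simp only [TensorProduct.add_tmul,
                LinearMap.map_add, LinearEquiv.map_add, hx, hy]
          | tmul a₂ d₂ =>
            simp only [TensorProduct.assoc_tmul, LinearMap.lTensor_tmul, lam_tmul,
              LinearEquiv.coe_coe]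
            induction R.toLin (b₂ ⊗ₜ a₂) using TensorProduct.induction_on with
            | zero => simp only [LinearMap.map_zero, LinearEquiv.map_zero, TensorProduct.zero_tmul,
                TensorProduct.tmul_zero]
            | add x y hx hy => simp only [TensorProduct.add_tmul,
                  LinearMap.map_add, LinearEquiv.map_add, hx, hy]
            | tmul x y => simp [P]
    rw [h1, hexagon_iff.1 hE, extLin_tmul]
    induction TB.toLin (e ⊗ₜ b) using TensorProduct.induction_on with
    | zero => simp only [LinearMap.map_zero, LinearEquiv.map_zero, TensorProduct.zero_tmul,
        TensorProduct.tmul_zero]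
    | add x y hx hy => simp only [TensorProduct.add_tmul,
          LinearMap.map_add, LinearEquiv.map_add, hx, hy]
    | tmul b₁ e₁ =>
      rw [extLin_tmul, lam_tmul, h2]
      congr 1
      induction TA.toLin (e₁ ⊗ₜ a) using TensorProduct.induction_on with
      | zero => simp only [LinearMap.map_zero, LinearEquiv.map_zero, TensorProduct.zero_tmul,
          TensorProduct.tmul_zero]
      | add x y hx hy => simp only [TensorProduct.tmul_add,
            LinearMap.map_add, LinearEquiv.map_add, hx, hy]
      | tmul a₁ e₂ =>
        simp only [lam_tmul, TensorProduct.assoc_symm_tmul, LinearMap.rTensor_tmul]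
        rw [← hexagon_iff.1 hD]
        simp [Λ]

end

section Star
variable {A B C : Type u} [Ring A] [Algebra ℂ A] [StarRing A] [StarModule ℂ A]
  [Ring B] [Algebra ℂ B] [StarRing B] [StarModule ℂ B]
  [Ring C] [Algebra ℂ C] [StarRing C] [StarModule ℂ C]
  (R₁ : TwistingMap A B) (R₂ : TwistingMap B C) (R₃ : TwistingMap A C)

theorem StarCompat.extend (h : Hexagon R₁ R₂ R₃) [h₁ : R₁.StarCompat] [h₂ : R₂.StarCompat]
    [h₃ : R₃.StarCompat] : (TwistingMap.extend R₁ R₂ R₃ h).StarCompat := by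
  let S := (TwistingMap.extend R₁ R₂ R₃ h).starMap
  have hS : ∀ (a : A) (Q : B ⊗[ℂ] C), S (a ⊗ₜ R₂.of Q) =
      R₂.of.toLinearMap.lTensor A (extLin R₁ R₃ (R₂.starMap Q ⊗ₜ star a)) := by
    intro a Q
    simp only [S, starMap_tmul, star_def, extend_toLin]
  have h1 : ∀ (X : A ⊗[ℂ] B) (c : C),
      S (R₂.of.toLinearMap.lTensor A (TensorProduct.assoc ℂ A B C (X ⊗ₜ c))) =
        R₂.of.toLinearMap.lTensor A (mu R₂ R₃ (star c) (R₁.starMap X)) := by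
    intro X c
    induction X using TensorProduct.induction_on with
    | zero => simp [S]
    | add x y hx hy =>
      simp only [S, TensorProduct.add_tmul,
            LinearMap.map_add, LinearEquiv.map_add, starMap_add] at hx hy ⊢
      rw [hx, hy]
    | tmul a b =>
      simp only [TensorProduct.assoc_tmul, LinearMap.lTensor_tmul, LinearEquiv.coe_coe, hS,
        starMap_tmul]
      rw [hexagon_iff.1 h]
  have h2 : ∀ (Y : A ⊗[ℂ] B) (c : C),
      S (R₂.of.toLinearMap.lTensor A (mu R₂ R₃ (star c) Y)) =
        R₂.of.toLinearMap.lTensor A (TensorProduct.assoc ℂ A B C (R₁.starMap Y ⊗ₜ c)) := by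
    intro Y c
    induction Y using TensorProduct.induction_on with
    | zero => simp [S]
    | add x y hx hy =>
      simp only [S, TensorProduct.add_tmul,
            LinearMap.map_add, LinearEquiv.map_add, starMap_add] at hx hy ⊢
      rw [hx, hy]
    | tmul p q =>
      have h3 : ∀ W : A ⊗[ℂ] C,
          S (R₂.of.toLinearMap.lTensor A
            ((R₂.toLin ∘ₗ (TensorProduct.mk ℂ C B).flip q).lTensor A W)) =
          R₂.of.toLinearMap.lTensor A (R₁.lam C (star q) (R₃.starMap W)) := by
        intro W
        induction W using TensorProduct.induction_on with
        | zero => simp [S]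
        | add x y hx hy =>
          simp only [S, LinearMap.map_add, LinearEquiv.map_add, starMap_add] at hx hy ⊢
          rw [hx, hy]
        | tmul p₁ c₁ =>
          simp only [LinearMap.lTensor_tmul, LinearMap.comp_apply, LinearMap.flip_apply,
            TensorProduct.mk_apply, LinearEquiv.coe_coe, hS]
          have h4 := h₂.isStar (star q ⊗ₜ star c₁)
          simp only [starMap_tmul, star_star] at h4
          rw [h4, extLin_tmul, starMap_tmul]
      rw [mu_tmul, h3]
      have h4 := h₃.isStar (star p ⊗ₜ c)
      simp only [starMap_tmul, star_star] at h4
      rw [h4, lam_tmul, starMap_tmul]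
  refine ⟨fun x => ?_⟩
  change S (S x) = x
  induction x using TensorProduct.induction_on with
  | zero => simp [S]
  | add x y hx hy =>
    simp only [S, starMap_add] at hx hy ⊢
    rw [hx, hy]
  | tmul a y =>
    obtain ⟨y, rfl⟩ := R₂.of.surjective y
    induction y using TensorProduct.induction_on with
    | zero => simp [S]
    | add x y hx hy =>
      simp only [S, TensorProduct.tmul_add,
            LinearMap.map_add, LinearEquiv.map_add, starMap_add] at hx hy ⊢
      rw [hx, hy]
    | tmul b c =>
      have h5 := h1 (a ⊗ₜ b) c
      simp only [TensorProduct.assoc_tmul, LinearMap.lTensor_tmul, LinearEquiv.coe_coe] at h5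
      rw [h5, h2, h₁.isStar]
      simp

instance (A B : Type u) [Ring A] [Algebra ℂ A] [StarRing A] [StarModule ℂ A]
    [Ring B] [Algebra ℂ B] [StarRing B] [StarModule ℂ B] : (flip A B).StarCompat where
  isStar x := by
    induction x using TensorProduct.induction_on with
    | zero => simp
    | add x y hx hy => rw [starMap_add, starMap_add, hx, hy]
    | tmul a b => simp

/-- `a ↦ a ⊗ 1` -/
def includeLeft (R : TwistingMap A B) [h : R.StarCompat] : A →⋆ₐ[ℂ] R.Tensor where
  toFun a := R.tmul a 1
  map_one' := rfl
  map_mul' a a' := by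
    rw [tmul_mul_tmul, R.map_one_left]; simp [tmul_def]
  map_zero' := by simp [tmul_def]
  map_add' a a' := by simp [tmul_def, TensorProduct.add_tmul]
  commutes' r := by
    rw [Algebra.algebraMap_eq_smul_one, Algebra.algebraMap_eq_smul_one, one_def, tmul_def,
      ← map_smul, TensorProduct.smul_tmul']
  map_star' a := by
    rw [tmul_def, tmul_def, star_def, starMap_tmul, star_one, R.map_one_left]

/-- `b ↦ 1 ⊗ b` -/
def includeRight (R : TwistingMap A B) [h : R.StarCompat] : B →⋆ₐ[ℂ] R.Tensor where
  toFun b := R.tmul 1 b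
  map_one' := rfl
  map_mul' a a' := by
    rw [tmul_mul_tmul, R.map_one_right]; simp [tmul_def]
  map_zero' := by simp [tmul_def]
  map_add' a a' := by simp [tmul_def, TensorProduct.tmul_add]
  commutes' r := by
    rw [Algebra.algebraMap_eq_smul_one, Algebra.algebraMap_eq_smul_one, one_def, tmul_def,
      ← map_smul, TensorProduct.tmul_smul]
  map_star' a := by
    rw [tmul_def, tmul_def, star_def, starMap_tmul, star_one, R.map_one_right]

/-- `id ⊗ f : A ⊗_R B → A ⊗_{R'} C` for a `*`-homomorphism `f : B → C` that
intertwines the twisting maps `R` and `R'`. -/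
def mapRight (R : TwistingMap A B) (R' : TwistingMap A C) [R.StarCompat] [R'.StarCompat]
    (f : B →⋆ₐ[ℂ] C)
    (hf : ∀ (a : A) (b : B), R'.toLin (f b ⊗ₜ a) =
      f.toAlgHom.toLinearMap.lTensor A (R.toLin (b ⊗ₜ a))) :
    R.Tensor →⋆ₐ[ℂ] R'.Tensor where
  toFun x := R'.of (f.toAlgHom.toLinearMap.lTensor A (R.of.symm x))
  map_one' := by simp [one_def]
  map_zero' := by simp
  map_add' x y := by simp
  commutes' r := by
    rw [Algebra.algebraMap_eq_smul_one, Algebra.algebraMap_eq_smul_one]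
    simp [one_def]
  map_mul' x y := by
    obtain ⟨x, rfl⟩ := R.of.surjective x
    obtain ⟨y, rfl⟩ := R.of.surjective y
    simp only [mul_def, LinearEquiv.symm_apply_apply]
    congr 1
    induction x using TensorProduct.induction_on with
    | zero => simp only [LinearMap.map_zero, LinearEquiv.map_zero, TensorProduct.zero_tmul,
        TensorProduct.tmul_zero]
    | add x y hx hy => simp only [TensorProduct.add_tmul,
          LinearMap.map_add, LinearEquiv.map_add, hx, hy]
    | tmul a b =>
    induction y using TensorProduct.induction_on with
    | zero => simp only [LinearMap.map_zero, LinearEquiv.map_zero, TensorProduct.zero_tmul,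
        TensorProduct.tmul_zero]
    | add x y hx hy => simp only [TensorProduct.tmul_add,
          LinearMap.map_add, LinearEquiv.map_add, hx, hy]
    | tmul a' b' =>
      simp only [LinearMap.lTensor_tmul, mulMap_tmul]
      change _ = TensorProduct.map _ _ (R'.toLin (f b ⊗ₜ a'))
      rw [hf]
      induction R.toLin (b ⊗ₜ a') using TensorProduct.induction_on with
      | zero => simp only [LinearMap.map_zero, LinearEquiv.map_zero, TensorProduct.zero_tmul,
          TensorProduct.tmul_zero]
      | add x y hx hy => simp only [LinearMap.map_add, LinearEquiv.map_add, hx, hy]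
      | tmul u v => simp
  map_star' x := by
    obtain ⟨x, rfl⟩ := R.of.surjective x
    simp only [star_def, LinearEquiv.symm_apply_apply]
    congr 1
    induction x using TensorProduct.induction_on with
    | zero => simp
    | add x y hx hy => simp only [LinearMap.map_add, LinearEquiv.map_add, starMap_add, hx, hy]
    | tmul a b =>
      simp only [LinearMap.lTensor_tmul, starMap_tmul, ← hf]
      rw [map_star]
      rfl

@[simp] theorem mapRight_tmul (R : TwistingMap A B) (R' : TwistingMap A C) [R.StarCompat]
    [R'.StarCompat] (f : B →⋆ₐ[ℂ] C)
    (hf : ∀ (a : A) (b : B), R'.toLin (f b ⊗ₜ a) =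
      f.toAlgHom.toLinearMap.lTensor A (R.toLin (b ⊗ₜ a))) (a : A) (b : B) :
    mapRight R R' f hf (R.tmul a b) = R'.tmul a (f b) := by
  rfl

/-- Two `*`-homomorphisms on `A ⊗_R B` agree if they agree on elementary tensors. -/
theorem hom_ext {R : TwistingMap A B} [R.StarCompat] {D : Type*} [Ring D] [Algebra ℂ D] [Star D]
    {f g : R.Tensor →⋆ₐ[ℂ] D} (h : ∀ a b, f (R.tmul a b) = g (R.tmul a b)) : f = g := by
  ext x
  obtain ⟨x, rfl⟩ := R.of.surjective x
  induction x using TensorProduct.induction_on with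
  | zero => simp
  | add x y hx hy => simp only [map_add, hx, hy]
  | tmul a b => exact h a b

theorem tmul_eq (R : TwistingMap A B) [R.StarCompat] (a : A) (b : B) :
    R.tmul a b = R.includeLeft a * R.includeRight b := by
  change _ = R.tmul a 1 * R.tmul 1 b
  rw [tmul_mul_tmul, R.map_one_left]
  simp [tmul_def]

end Star
end TwistingMap

/-- Data for iterated twisted tensor products: `*`-algebras `A i`, `i ∈ ℤ`, with twisting maps
`R i j : A j ⊗ A i → A i ⊗ A j` for `i < j` which are compatible for all `i < j < k`. -/
structure TwistSystem (A : ℤ → Type u) [∀ i, Ring (A i)] [∀ i, Algebra ℂ (A i)]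
    [∀ i, StarRing (A i)] [∀ i, StarModule ℂ (A i)] where
  R : ∀ i j, i < j → TwistingMap (A i) (A j)
  starCompat : ∀ i j h, (R i j h).StarCompat
  hexagon : ∀ i j k (hij : i < j) (hjk : j < k),
    TwistingMap.Hexagon (R i j hij) (R j k hjk) (R i k (hij.trans hjk))

namespace TwistSystem

variable {A : ℤ → Type u} [∀ i, Ring (A i)] [∀ i, Algebra ℂ (A i)]
    [∀ i, StarRing (A i)] [∀ i, StarModule ℂ (A i)] (𝔖 : TwistSystem A)

/-- A `*`-algebra together with twisting maps `T i` with all the factors `A i`, `i < n`, which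
satisfy the hexagon equations (the data carried along in the inductive construction of
`A_n ⊗ ⋯ ⊗ A_m`). -/
structure Stage (n : ℤ) where
  carrier : Type u
  [ring : Ring carrier]
  [algebra : Algebra ℂ carrier]
  [starRing : StarRing carrier]
  [starModule : StarModule ℂ carrier]
  T : ∀ i, i < n → TwistingMap (A i) carrier
  starCompat : ∀ i h, (T i h).StarCompat
  hexagon : ∀ i j (hij : i < j) (hj : j < n),
    TwistingMap.Hexagon (𝔖.R i j hij) (T j hj) (T i (hij.trans hj))

attribute [instance] Stage.ring Stage.algebra Stage.starRing Stage.starModule Stage.starCompat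
attribute [instance] TwistSystem.starCompat

/-- A single factor `A n`. -/
def Stage.base (n : ℤ) : 𝔖.Stage n where
  carrier := A n
  T i h := 𝔖.R i n h
  starCompat i h := 𝔖.starCompat i n h
  hexagon i j hij hj := 𝔖.hexagon i j n hij hj

variable {𝔖}

/-- Adjoining a factor on the left: `S ↦ A n ⊗_{T n} S`. -/
def Stage.cons {n : ℤ} (S : 𝔖.Stage (n + 1)) : 𝔖.Stage n where
  carrier := (S.T n (lt_add_one n)).Tensor
  T i h := TwistingMap.extend (𝔖.R i n h) (S.T n (lt_add_one n)) (S.T i (h.trans (lt_add_one n)))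
    (S.hexagon i n h (lt_add_one n))
  starCompat _ _ := TwistingMap.StarCompat.extend _ _ _ _
  hexagon i j hij hj := TwistingMap.Hexagon.extend _ _ _ _ _ _ _ _
    (𝔖.hexagon i j n hij hj) (S.hexagon i j hij (hj.trans (lt_add_one n)))

/-- The elementary tensor `a ⊗ s` in `A n ⊗ S`. -/
def Stage.tmul {n : ℤ} (S : 𝔖.Stage (n + 1)) (a : A n) (s : S.carrier) : S.cons.carrier :=
  (S.T n (lt_add_one n)).tmul a s

/-- `S → A n ⊗ S`, `s ↦ 1 ⊗ s` -/
def Stage.inr {n : ℤ} (S : 𝔖.Stage (n + 1)) : S.carrier →⋆ₐ[ℂ] S.cons.carrier :=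
  (S.T n (lt_add_one n)).includeRight

theorem Stage.inr_apply {n : ℤ} (S : 𝔖.Stage (n + 1)) (s : S.carrier) :
    S.inr s = S.tmul 1 s := rfl

theorem Stage.hom_ext {n : ℤ} {S : 𝔖.Stage (n + 1)} {D : Type*} [Ring D] [Algebra ℂ D] [Star D]
    {f g : S.cons.carrier →⋆ₐ[ℂ] D} (h : ∀ a s, f (S.tmul a s) = g (S.tmul a s)) : f = g :=
  TwistingMap.hom_ext (R := S.T n (lt_add_one n)) h

variable (𝔖)

/-- The iterated twisted tensor product `A_n ⊗ A_{n+1} ⊗ ⋯ ⊗ A_{n+k}`, with its twisting maps. -/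
def stage : (k : ℕ) → (n : ℤ) → 𝔖.Stage n
  | 0, n => Stage.base 𝔖 n
  | k + 1, n => (stage k (n + 1)).cons

/-- The iterated twisted tensor product `A_n ⊗ A_{n+1} ⊗ ⋯ ⊗ A_{n+k}` (`k + 1` factors). -/
abbrev Iter (k : ℕ) (n : ℤ) : Type u := (𝔖.stage k n).carrier

/-- The inclusion `A_{n+1} ⊗ ⋯ ⊗ A_{n+1+k} → A_n ⊗ A_{n+1} ⊗ ⋯ ⊗ A_{n+1+k}`, `x ↦ 1 ⊗ x`. -/
def inr (k : ℕ) (n : ℤ) : 𝔖.Iter k (n + 1) →⋆ₐ[ℂ] 𝔖.Iter (k + 1) n := (𝔖.stage k (n + 1)).inr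

/-- The elementary tensor `x_n ⊗ x_{n+1} ⊗ ⋯ ⊗ x_{n+k}`. -/
def pure (x : ∀ i, A i) : (k : ℕ) → (n : ℤ) → 𝔖.Iter k n
  | 0, n => x n
  | k + 1, n => (𝔖.stage k (n + 1)).tmul (x n) (pure x k (n + 1))

variable {𝔖}

/-- `*`-homomorphisms that intertwine the twisting maps. -/
structure Stage.Hom {n : ℤ} (S S' : 𝔖.Stage n) where
  toHom : S.carrier →⋆ₐ[ℂ] S'.carrier
  comm : ∀ i h (a : A i) (b : S.carrier), (S'.T i h).toLin (toHom b ⊗ₜ a) =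
    toHom.toAlgHom.toLinearMap.lTensor (A i) ((S.T i h).toLin (b ⊗ₜ a))

/-- `A n → A n ⊗ S`, `a ↦ a ⊗ 1` -/
def Stage.baseHom {n : ℤ} (S : 𝔖.Stage (n + 1)) : Stage.Hom (Stage.base 𝔖 n) S.cons where
  toHom := TwistingMap.includeLeft (S.T n (lt_add_one n))
  comm i h a b := by
    have key : ∀ b : A n, ((𝔖.R i n h).extend _ _ (S.hexagon i n h (lt_add_one n))).toLin
        ((S.T n (lt_add_one n)).of (b ⊗ₜ 1) ⊗ₜ a) =
        (S.T n (lt_add_one n)).includeLeft.toAlgHom.toLinearMap.lTensor (A i)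
          ((𝔖.R i n h).toLin (b ⊗ₜ a)) := by
      intro b
      rw [TwistingMap.extend_toLin, TwistingMap.extLin_tmul, TwistingMap.map_one_left,
        TwistingMap.lam_tmul]
      induction (𝔖.R i n h).toLin (b ⊗ₜ a) using TensorProduct.induction_on with
      | zero => simp only [LinearMap.map_zero, LinearEquiv.map_zero, TensorProduct.zero_tmul,
          TensorProduct.tmul_zero]
      | add x y hx hy => rw [TensorProduct.add_tmul, map_add, map_add, map_add, hx, hy]
      | tmul u v => rfl
    exact key b

/-- `id ⊗ f : A n ⊗ S → A n ⊗ S'` -/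
def Stage.Hom.cons {n : ℤ} {S S' : 𝔖.Stage (n + 1)} (f : Stage.Hom S S') :
    Stage.Hom S.cons S'.cons where
  toHom := TwistingMap.mapRight (S.T n (lt_add_one n)) (S'.T n (lt_add_one n)) f.toHom
    (f.comm n (lt_add_one n))
  comm i h a x := by
    obtain ⟨x, rfl⟩ := (S.T n (lt_add_one n)).of.surjective x
    change ((𝔖.R i n h).extend _ _ (S'.hexagon i n h (lt_add_one n))).toLin
      ((S'.T n (lt_add_one n)).of (f.toHom.toAlgHom.toLinearMap.lTensor (A n) x) ⊗ₜ a) =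
      LinearMap.lTensor (A i) _ (((𝔖.R i n h).extend _ _ (S.hexagon i n h (lt_add_one n))).toLin
        ((S.T n (lt_add_one n)).of x ⊗ₜ a))
    rw [TwistingMap.extend_toLin, TwistingMap.extend_toLin]
    induction x using TensorProduct.induction_on with
    | zero => simp only [LinearMap.map_zero, LinearEquiv.map_zero, TensorProduct.zero_tmul,
        TensorProduct.tmul_zero]
    | add x y hx hy => simp only [
          LinearMap.map_add, LinearEquiv.map_add, TensorProduct.add_tmul, hx, hy]
    | tmul b c =>
      rw [LinearMap.lTensor_tmul, TwistingMap.extLin_tmul, TwistingMap.extLin_tmul]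
      change LinearMap.lTensor (A i) _ (TwistingMap.lam _ _ b ((S'.T i _).toLin (f.toHom c ⊗ₜ a))) = _
      rw [f.comm]
      induction (S.T i _).toLin (c ⊗ₜ a) using TensorProduct.induction_on with
      | zero => simp only [LinearMap.map_zero, LinearEquiv.map_zero, TensorProduct.zero_tmul,
          TensorProduct.tmul_zero]
      | add x y hx hy => simp only [LinearMap.map_add, LinearEquiv.map_add, hx, hy]
      | tmul u v =>
        rw [LinearMap.lTensor_tmul, TwistingMap.lam_tmul, TwistingMap.lam_tmul]
        induction (𝔖.R i n h).toLin (b ⊗ₜ u) using TensorProduct.induction_on with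
        | zero => simp only [LinearMap.map_zero, LinearEquiv.map_zero, TensorProduct.zero_tmul,
            TensorProduct.tmul_zero]
        | add x y hx hy => simp only [TensorProduct.add_tmul,
              LinearMap.map_add, LinearEquiv.map_add, hx, hy]
        | tmul p q => rfl

theorem Stage.baseHom_apply {n : ℤ} (S : 𝔖.Stage (n + 1)) (a : A n) :
    (Stage.baseHom S).toHom a = S.tmul a 1 := rfl

theorem Stage.Hom.cons_tmul {n : ℤ} {S S' : 𝔖.Stage (n + 1)} (f : Stage.Hom S S') (a : A n)
    (s : S.carrier) : f.cons.toHom (S.tmul a s) = S'.tmul a (f.toHom s) := rfl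

variable (𝔖)

/-- The inclusion `A_n ⊗ ⋯ ⊗ A_{n+k} → A_n ⊗ ⋯ ⊗ A_{n+k'}`, `x ↦ x ⊗ 1 ⊗ ⋯ ⊗ 1`, for `k ≤ k'`. -/
def incR : (k k' : ℕ) → (n : ℤ) → k ≤ k' → Stage.Hom (𝔖.stage k n) (𝔖.stage k' n)
  | 0, 0, _, _ => ⟨StarAlgHom.id ℂ _, fun i h a b => by
      change _ = LinearMap.lTensor _ LinearMap.id _
      rw [LinearMap.lTensor_id]; rfl⟩
  | 0, k' + 1, n, _ => Stage.baseHom (𝔖.stage k' (n + 1))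
  | k + 1, k' + 1, n, h => (incR k k' (n + 1) (Nat.le_of_succ_le_succ h)).cons

/-- The inclusion `A_n ⊗ ⋯ ⊗ A_{n+k} → A_{n'} ⊗ ⋯ ⊗ A_{n'+k'}`,
`x ↦ 1 ⊗ ⋯ ⊗ 1 ⊗ x ⊗ 1 ⊗ ⋯ ⊗ 1`, for `n' ≤ n` and `n + k ≤ n' + k'`. -/
def incl (k : ℕ) (n : ℤ) : (k' : ℕ) → (n' : ℤ) → n' ≤ n → n + k ≤ n' + k' →
    (𝔖.Iter k n →⋆ₐ[ℂ] 𝔖.Iter k' n')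
  | 0, n', h, h' =>
    have e : n = n' := by omega
    e ▸ (𝔖.incR k 0 n (by omega)).toHom
  | k' + 1, n', h, h' =>
    if e : n = n' then e ▸ (𝔖.incR k (k' + 1) n (by omega)).toHom
    else (𝔖.inr k' n').comp (incl k n k' (n' + 1) (by omega) (by push_cast at h'; omega))

theorem incl_eq (k k' : ℕ) (n : ℤ) (h : n ≤ n) (h' : n + k ≤ n + k') :
    𝔖.incl k n k' n h h' = (𝔖.incR k k' n (by omega)).toHom := by
  cases k' with
  | zero => rfl
  | succ k' => simp [incl]

theorem incl_ne (k k' : ℕ) (n n' : ℤ) (h : n' ≤ n) (h' : n + k ≤ n' + (k' + 1 : ℕ)) (hn : n ≠ n')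
    (x : 𝔖.Iter k n) :
    𝔖.incl k n (k' + 1) n' h h' x = 𝔖.inr k' n'
      (𝔖.incl k n k' (n' + 1) (by omega) (by push_cast at h'; omega) x) := by
  rw [incl, dif_neg hn]
  rfl

theorem incR_self (k : ℕ) (n : ℤ) (h : k ≤ k) : (𝔖.incR k k n h).toHom = StarAlgHom.id ℂ _ := by
  induction k generalizing n with
  | zero => rfl
  | succ k ih =>
    refine Stage.hom_ext fun a b => ?_
    refine (Stage.Hom.cons_tmul (𝔖.incR k k (n + 1) le_rfl) a b).trans ?_
    rw [ih]
    rfl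

theorem incR_incR (k₁ k₂ k₃ : ℕ) (n : ℤ) (h : k₁ ≤ k₂) (h' : k₂ ≤ k₃) (x : 𝔖.Iter k₁ n) :
    (𝔖.incR k₂ k₃ n h').toHom ((𝔖.incR k₁ k₂ n h).toHom x) =
      (𝔖.incR k₁ k₃ n (h.trans h')).toHom x := by
  induction k₁ generalizing k₂ k₃ n with
  | zero =>
    cases k₂ with
    | zero => rfl
    | succ k₂ =>
      cases k₃ with
      | zero => omega
      | succ k₃ =>
        refine (Stage.Hom.cons_tmul (𝔖.incR k₂ k₃ (n + 1) (by omega)) x 1).trans ?_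
        rw [map_one]
        rfl
  | succ k₁ ih =>
    cases k₂ with
    | zero => omega
    | succ k₂ =>
      cases k₃ with
      | zero => omega
      | succ k₃ =>
        have : ((𝔖.incR (k₂ + 1) (k₃ + 1) n h').toHom).comp ((𝔖.incR (k₁ + 1) (k₂ + 1) n h).toHom) =
            (𝔖.incR (k₁ + 1) (k₃ + 1) n (h.trans h')).toHom := by
          refine Stage.hom_ext fun a b => ?_
          refine (Stage.Hom.cons_tmul (𝔖.incR k₂ k₃ (n + 1) (by omega)) a
            ((𝔖.incR k₁ k₂ (n + 1) (by omega)).toHom b)).trans ?_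
          rw [ih]
          rfl
        exact DFunLike.congr_fun this x

theorem incl_incl (k₁ k₂ k₃ : ℕ) (n₁ n₂ n₃ : ℤ) (h : n₂ ≤ n₁) (h' : n₁ + k₁ ≤ n₂ + k₂)
    (l : n₃ ≤ n₂) (l' : n₂ + k₂ ≤ n₃ + k₃) (x : 𝔖.Iter k₁ n₁) :
    𝔖.incl k₂ n₂ k₃ n₃ l l' (𝔖.incl k₁ n₁ k₂ n₂ h h' x) =
      𝔖.incl k₁ n₁ k₃ n₃ (l.trans h) (h'.trans l') x := by
  induction k₃ generalizing k₂ n₂ n₃ with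
  | zero =>
    obtain rfl : n₂ = n₃ := by omega
    obtain rfl : n₁ = n₂ := by omega
    rw [incl_eq, incl_eq, incl_eq, incR_incR]
  | succ k₃ ih =>
    by_cases e : n₂ = n₃
    · subst e
      by_cases e' : n₁ = n₂
      · subst e'
        rw [incl_eq, incl_eq, incl_eq, incR_incR]
      · cases k₂ with
        | zero => omega
        | succ k₂ =>
          rw [incl_eq, incl_ne _ _ _ _ _ _ _ e', incl_ne _ _ _ _ _ _ _ e']
          have := ih k₂ (n₂ + 1) (n₂ + 1) (by omega) (by push_cast at h'; omega) le_rfl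
            (by push_cast at l'; omega)
          rw [← this, incl_eq]
          exact Stage.Hom.cons_tmul (𝔖.incR k₂ k₃ (n₂ + 1) (by omega)) 1 _
    · rw [incl_ne _ _ _ _ _ _ _ e, incl_ne _ _ _ _ _ _ _ (by omega), ih]

/-- The algebra `A_{n,m} = A_n ⊗_{R_{n,n+1}} A_{n+1} ⊗ ⋯ ⊗_{R_{m-1,m}} A_m`, for an interval
`I = [n, m]` of integers. -/
abbrev Local (I : NonemptyInterval ℤ) : Type u := 𝔖.Iter (I.snd - I.fst).toNat I.fst

/-- The inclusion `A_{n',m'} → A_{n,m}` for `[n', m'] ⊆ [n, m]`. -/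
def inclusion (I J : NonemptyInterval ℤ) (h : I ≤ J) : 𝔖.Local I →⋆ₐ[ℂ] 𝔖.Local J :=
  𝔖.incl _ _ _ _ (NonemptyInterval.le_def.1 h).1 (by
    have := I.fst_le_snd
    have := J.fst_le_snd
    have := NonemptyInterval.le_def.1 h
    omega)

instance : DirectedSystem 𝔖.Local (𝔖.inclusion · · ·) where
  map_self I x := by
    rw [inclusion, incl_eq, incR_self]; rfl
  map_map _ _ _ _ _ x := 𝔖.incl_incl _ _ _ _ _ _ _ _ _ _ x

/-- The union `⋃_{n ≤ m} A_{n,m}` (algebraic inductive limit). -/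
abbrev Union : Type u := DirectLimit 𝔖.Local 𝔖.inclusion

instance : Algebra ℂ 𝔖.Union :=
  Algebra.ofModule (fun r x y => smul_mul_assoc r x y) (fun r x y => mul_smul_comm r x y)

instance : StarRing 𝔖.Union where
  star_add := star_add

/-- The embedding of `A_{n,m}` into the union. -/
def toUnion (I : NonemptyInterval ℤ) : 𝔖.Local I →⋆ₐ[ℂ] 𝔖.Union where
  toFun x := ⟦⟨I, x⟩⟧
  map_one' := (DirectLimit.one_def I).symm
  map_zero' := (DirectLimit.zero_def I).symm
  map_mul' x y := (DirectLimit.mul_def I x y).symm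
  map_add' x y := (DirectLimit.add_def I x y).symm
  commutes' r := by
    rw [Algebra.algebraMap_eq_smul_one, Algebra.algebraMap_eq_smul_one, DirectLimit.one_def I,
      DirectLimit.smul_def]
  map_star' x := (DirectLimit.star_def I x).symm

end TwistSystem

/-! ### Enveloping C*-algebras -/

/-- A C*-seminorm on a complex `*`-algebra. -/
structure CStarSeminorm (A : Type u) [Ring A] [Algebra ℂ A] [StarRing A] extends
    Seminorm ℂ A where
  mul_le' : ∀ a b : A, toSeminorm (a * b) ≤ toSeminorm a * toSeminorm b
  star_mul_self' : ∀ a : A, toSeminorm (star a * a) = toSeminorm a * toSeminorm a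

/-- For every element, the C*-seminorms are bounded; then there is a largest C*-seminorm. -/
class CStarBounded (A : Type u) [Ring A] [Algebra ℂ A] [StarRing A] : Prop where
  bddAbove : ∀ a : A, BddAbove (Set.range fun p : CStarSeminorm A => p.toSeminorm a)

namespace CStarSeminorm

section
variable {A : Type u} [Ring A] [Algebra ℂ A] [StarRing A]

instance : Nonempty (CStarSeminorm A) :=
  ⟨{ toSeminorm := 0, mul_le' := by simp, star_mul_self' := by simp }⟩

theorem star_eq (p : CStarSeminorm A) (a : A) : p.toSeminorm (star a) = p.toSeminorm a := by
  have key : ∀ a : A, p.toSeminorm a ≤ p.toSeminorm (star a) := by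
    intro a
    have h1 := p.star_mul_self' a
    have h2 := p.mul_le' (star a) a
    have h3 := apply_nonneg p.toSeminorm a
    have h4 := apply_nonneg p.toSeminorm (star a)
    rcases h3.eq_or_lt with h | h
    · rw [← h]; exact h4
    · rw [h1] at h2
      exact le_of_mul_le_mul_right h2 h
  refine le_antisymm ?_ (key a)
  simpa using key (star a)

/-- The pull-back of a C*-seminorm along a `*`-homomorphism. -/
def comap {B : Type*} [Ring B] [Algebra ℂ B] [StarRing B] (p : CStarSeminorm B)
    (f : A →⋆ₐ[ℂ] B) : CStarSeminorm A where
  toSeminorm := p.toSeminorm.comp f.toAlgHom.toLinearMap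
  mul_le' a b := by simpa using p.mul_le' (f a) (f b)
  star_mul_self' a := by simpa [map_star] using p.star_mul_self' (f a)

@[simp] theorem comap_apply {B : Type*} [Ring B] [Algebra ℂ B] [StarRing B] (p : CStarSeminorm B)
    (f : A →⋆ₐ[ℂ] B) (a : A) : (p.comap f).toSeminorm a = p.toSeminorm (f a) := rfl

/-- The norm of a C*-algebra, as a C*-seminorm. -/
def ofCStarAlgebra (B : Type u) [CStarAlgebra B] : CStarSeminorm B where
  toSeminorm := normSeminorm ℂ B
  mul_le' a b := norm_mul_le a b
  star_mul_self' a := CStarRing.norm_star_mul_self (x := a)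

theorem one_le (p : CStarSeminorm A) : p.toSeminorm 1 ≤ 1 := by
  have h := p.star_mul_self' 1
  simp only [star_one, one_mul] at h
  have h3 := apply_nonneg p.toSeminorm (1 : A)
  nlinarith

/-- C*-seminorms of unitaries are at most one. -/
theorem le_one_of_unitary (p : CStarSeminorm A) {a : A} (ha : star a * a = 1) :
    p.toSeminorm a ≤ 1 := by
  have h := p.star_mul_self' a
  rw [ha] at h
  have h2 := p.one_le
  have h3 := apply_nonneg p.toSeminorm a
  nlinarith

/-- C*-seminorms of projections are at most one. -/
theorem le_one_of_proj (p : CStarSeminorm A) {a : A} (ha : star a * a = a) :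
    p.toSeminorm a ≤ 1 := by
  have h := p.star_mul_self' a
  rw [ha] at h
  have h3 := apply_nonneg p.toSeminorm a
  nlinarith

variable (A) in
/-- The elements on which the C*-seminorms are bounded form a subalgebra. -/
def boundedElements : Subalgebra ℂ A where
  carrier := {a | BddAbove (Set.range fun p : CStarSeminorm A => p.toSeminorm a)}
  mul_mem' := by
    rintro a b ⟨x, hx⟩ ⟨y, hy⟩
    refine ⟨|x| * |y|, ?_⟩
    rintro _ ⟨p, rfl⟩
    have h1 := hx ⟨p, rfl⟩
    have h2 := hy ⟨p, rfl⟩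
    dsimp only at h1 h2
    exact (p.mul_le' a b).trans (mul_le_mul (h1.trans (le_abs_self _)) (h2.trans (le_abs_self _))
      (apply_nonneg _ _) (abs_nonneg _))
  add_mem' := by
    rintro a b ⟨x, hx⟩ ⟨y, hy⟩
    refine ⟨x + y, ?_⟩
    rintro _ ⟨p, rfl⟩
    exact (map_add_le_add p.toSeminorm a b).trans (add_le_add (hx ⟨p, rfl⟩) (hy ⟨p, rfl⟩))
  algebraMap_mem' r := by
    refine ⟨‖r‖, ?_⟩
    rintro _ ⟨p, rfl⟩
    dsimp only
    rw [Algebra.algebraMap_eq_smul_one, map_smul_eq_mul]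
    exact mul_le_of_le_one_right (norm_nonneg _) p.one_le

theorem mem_boundedElements {a : A} : a ∈ boundedElements A ↔
    BddAbove (Set.range fun p : CStarSeminorm A => p.toSeminorm a) := Iff.rfl

theorem mem_boundedElements_of_le {a : A} (c : ℝ) (h : ∀ p : CStarSeminorm A, p.toSeminorm a ≤ c) :
    a ∈ boundedElements A := ⟨c, by rintro _ ⟨p, rfl⟩; exact h p⟩

theorem bounded_of_hom {B : Type u} [Ring B] [Algebra ℂ B] [StarRing B] [CStarBounded B]
    (f : B →⋆ₐ[ℂ] A) (b : B) : f b ∈ boundedElements A := by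
  obtain ⟨c, hc⟩ := CStarBounded.bddAbove b
  exact ⟨c, by rintro _ ⟨p, rfl⟩; exact hc ⟨p.comap f, rfl⟩⟩

variable (A) in
/-- The largest C*-seminorm of a `*`-algebra. -/
def max [CStarBounded A] : CStarSeminorm A where
  toFun a := ⨆ p : CStarSeminorm A, p.toSeminorm a
  map_zero' := by simp
  add_le' a b := ciSup_le fun p => (map_add_le_add p.toSeminorm a b).trans
    (add_le_add (le_ciSup (CStarBounded.bddAbove a) p) (le_ciSup (CStarBounded.bddAbove b) p))
  neg' a := by simp [map_neg_eq_map]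
  smul' r a := by
    simp only [map_smul_eq_mul]
    rw [Real.mul_iSup_of_nonneg (norm_nonneg r)]
  mul_le' a b := ciSup_le fun p => (p.mul_le' a b).trans
    (mul_le_mul (le_ciSup (CStarBounded.bddAbove a) p) (le_ciSup (CStarBounded.bddAbove b) p)
      (apply_nonneg _ _) ((apply_nonneg _ _).trans (le_ciSup (CStarBounded.bddAbove a) p)))
  star_mul_self' a := by
    refine le_antisymm (ciSup_le fun p => ?_) ?_
    · rw [p.star_mul_self']
      exact mul_le_mul (le_ciSup (CStarBounded.bddAbove a) p)
        (le_ciSup (CStarBounded.bddAbove a) p)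
        (apply_nonneg _ _) ((apply_nonneg _ _).trans (le_ciSup (CStarBounded.bddAbove a) p))
    · have h0 : 0 ≤ ⨆ p : CStarSeminorm A, p.toSeminorm a := Real.iSup_nonneg fun p =>
        apply_nonneg _ _
      have h1 : 0 ≤ ⨆ p : CStarSeminorm A, p.toSeminorm (star a * a) := Real.iSup_nonneg fun p =>
        apply_nonneg _ _
      have : (⨆ p : CStarSeminorm A, p.toSeminorm a) ≤
          √(⨆ p : CStarSeminorm A, p.toSeminorm (star a * a)) := by
        refine ciSup_le fun p => Real.le_sqrt_of_sq_le ?_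
        rw [sq, ← p.star_mul_self']
        exact le_ciSup (CStarBounded.bddAbove (star a * a)) p
      calc _ ≤ √(⨆ p : CStarSeminorm A, p.toSeminorm (star a * a)) *
            √(⨆ p : CStarSeminorm A, p.toSeminorm (star a * a)) :=
            mul_le_mul this this h0 (Real.sqrt_nonneg _)
        _ = _ := Real.mul_self_sqrt h1

theorem le_max [CStarBounded A] (p : CStarSeminorm A) (a : A) :
    p.toSeminorm a ≤ (max A).toSeminorm a :=
  le_ciSup (f := fun p : CStarSeminorm A => p.toSeminorm a) (CStarBounded.bddAbove a) p

end
end CStarSeminorm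

section Envelope
variable (A : Type u) [Ring A] [Algebra ℂ A] [StarRing A] [StarModule ℂ A] [CStarBounded A]

/-- The `*`-algebra `A`, equipped with its largest C*-seminorm. -/
def PreEnvelope : Type u := A

instance : SeminormedRing (PreEnvelope A) :=
  letI S : SeminormedAddCommGroup A := AddGroupSeminorm.toSeminormedAddCommGroup (E := A)
    (CStarSeminorm.max A).toSeminorm.toAddGroupSeminorm
  { (inferInstance : Ring A) with
    norm := S.norm
    toPseudoMetricSpace := S.toPseudoMetricSpace
    dist_eq := S.dist_eq
    norm_mul_le := (CStarSeminorm.max A).mul_le' }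

instance : Algebra ℂ (PreEnvelope A) := inferInstanceAs (Algebra ℂ A)
instance : StarRing (PreEnvelope A) := inferInstanceAs (StarRing A)
instance : StarModule ℂ (PreEnvelope A) := inferInstanceAs (StarModule ℂ A)

instance : NormedAlgebra ℂ (PreEnvelope A) where
  norm_smul_le r a := (map_smul_eq_mul (CStarSeminorm.max A).toSeminorm r a).le

/-- The enveloping C*-algebra: the (Hausdorff) completion of a `*`-algebra with respect to its
largest C*-seminorm. If `A = ⋃ A_i` is a directed union of finite-dimensional C*-algebras, the
largest C*-seminorm restricts to the C*-norm of every `A_i`, and the enveloping C*-algebra is the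
C*-inductive limit of the `A_i`. -/
def Envelope : Type u := UniformSpace.Completion (PreEnvelope A)

namespace Envelope

instance : NormedRing (Envelope A) :=
  inferInstanceAs (NormedRing (UniformSpace.Completion (PreEnvelope A)))
instance : CompleteSpace (Envelope A) :=
  inferInstanceAs (CompleteSpace (UniformSpace.Completion (PreEnvelope A)))
instance : Algebra ℂ (Envelope A) :=
  inferInstanceAs (Algebra ℂ (UniformSpace.Completion (PreEnvelope A)))

variable {A}

/-- The canonical map on the level of sets. -/
def coe (a : A) : Envelope A := UniformSpace.Completion.coe' (α := PreEnvelope A) a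

theorem denseRange_coe : DenseRange (coe (A := A)) :=
  UniformSpace.Completion.denseRange_coe (α := PreEnvelope A)
theorem norm_coe (a : A) : ‖coe a‖ = (CStarSeminorm.max A).toSeminorm a :=
  UniformSpace.Completion.norm_coe (E := PreEnvelope A) a
theorem coe_add (a b : A) : coe (a + b) = coe a + coe b :=
  UniformSpace.Completion.coe_add (α := PreEnvelope A) a b
theorem coe_zero : coe (0 : A) = 0 := rfl
theorem coe_one : coe (1 : A) = 1 := rfl
theorem coe_mul (a b : A) : coe (a * b) = coe a * coe b :=
  UniformSpace.Completion.coe_mul (α := PreEnvelope A) a b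
theorem coe_smul (r : ℂ) (a : A) : coe (r • a) = r • coe a :=
  UniformSpace.Completion.coe_smul (X := PreEnvelope A) r a

instance : NormedAlgebra ℂ (Envelope A) where
  norm_smul_le r a := norm_smul_le (β := UniformSpace.Completion (PreEnvelope A)) r a

theorem induction_on {p : Envelope A → Prop} (a : Envelope A) (hp : IsClosed {a | p a})
    (ih : ∀ a : A, p (coe a)) : p a := denseRange_coe.induction_on a hp ih

theorem uniformContinuous_star : UniformContinuous (star : PreEnvelope A → PreEnvelope A) := by
  have : Isometry (star : PreEnvelope A → PreEnvelope A) := by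
    refine Isometry.of_dist_eq fun a b => ?_
    rw [dist_eq_norm, dist_eq_norm, ← star_sub]
    exact (CStarSeminorm.max A).star_eq (a - b : PreEnvelope A)
  exact this.uniformContinuous

instance : Star (Envelope A) := ⟨UniformSpace.Completion.map (star : PreEnvelope A → PreEnvelope A)⟩

theorem continuous_star' : Continuous (star : Envelope A → Envelope A) :=
  UniformSpace.Completion.continuous_map

theorem coe_star (a : A) : coe (star a) = star (coe a) :=
  (UniformSpace.Completion.map_coe uniformContinuous_star (a : PreEnvelope A)).symm

instance : StarRing (Envelope A) where
  star_involutive a := by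
    induction a using induction_on with
    | hp => exact isClosed_eq (continuous_star'.comp continuous_star') continuous_id
    | ih a => rw [← coe_star, ← coe_star, star_star]
  star_mul a b := by
    induction a using induction_on with
    | hp => exact isClosed_eq (continuous_star'.comp (continuous_mul_const b))
              ((continuous_const_mul _).comp continuous_star')
    | ih a =>
    induction b using induction_on with
    | hp => exact isClosed_eq (continuous_star'.comp (continuous_const_mul _))
              ((continuous_mul_const _).comp continuous_star')
    | ih b => rw [← coe_star, ← coe_star, ← coe_mul, ← coe_mul, ← coe_star, star_mul]
  star_add a b := by
    induction a using induction_on with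
    | hp => exact isClosed_eq (continuous_star'.comp (continuous_add_const b))
              ((continuous_add_const _).comp continuous_star')
    | ih a =>
    induction b using induction_on with
    | hp => exact isClosed_eq (continuous_star'.comp (continuous_const_add _))
              ((continuous_const_add _).comp continuous_star')
    | ih b => rw [← coe_star, ← coe_star, ← coe_add, ← coe_add, ← coe_star, star_add]

instance : StarModule ℂ (Envelope A) where
  star_smul r a := by
    induction a using induction_on with
    | hp => exact isClosed_eq (continuous_star'.comp (continuous_const_smul r))
              ((continuous_const_smul _).comp continuous_star')
    | ih a => rw [← coe_smul, ← coe_star, ← coe_star, ← coe_smul, star_smul]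

instance : CStarRing (Envelope A) where
  norm_mul_self_le a := by
    induction a using induction_on with
    | hp => exact isClosed_le (continuous_norm.mul continuous_norm)
              (continuous_norm.comp (continuous_star'.mul continuous_id))
    | ih a =>
      rw [← coe_star, ← coe_mul, norm_coe, norm_coe, (CStarSeminorm.max A).star_mul_self']

instance : CStarAlgebra (Envelope A) where

variable (A) in
/-- The canonical `*`-homomorphism from a `*`-algebra to its enveloping C*-algebra. -/
def of : A →⋆ₐ[ℂ] Envelope A where
  toFun := coe
  map_one' := coe_one
  map_zero' := coe_zero
  map_mul' := coe_mul
  map_add' := coe_add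
  map_star' := coe_star
  commutes' r := by
    rw [Algebra.algebraMap_eq_smul_one, Algebra.algebraMap_eq_smul_one, coe_smul, coe_one]

theorem denseRange_of : DenseRange (of A) := denseRange_coe

theorem norm_of (a : A) : ‖of A a‖ = (CStarSeminorm.max A).toSeminorm a := norm_coe a

section Lift
variable {B : Type u} [CStarAlgebra B] (f : A →⋆ₐ[ℂ] B)

theorem norm_le (a : A) : ‖f a‖ ≤ (CStarSeminorm.max A).toSeminorm a :=
  ((CStarSeminorm.ofCStarAlgebra B).comap f).le_max a

theorem norm_sub_le' (a b : A) : ‖f a - f b‖ ≤ (CStarSeminorm.max A).toSeminorm (a - b) := by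
  rw [← map_sub]
  exact norm_le f (a - b)

theorem continuous_pre : Continuous (fun a : PreEnvelope A => f a) := by
  have : LipschitzWith 1 (fun a : PreEnvelope A => f a) := by
    refine LipschitzWith.of_dist_le_mul fun a b => ?_
    rw [dist_eq_norm, dist_eq_norm, NNReal.coe_one, one_mul]
    exact norm_sub_le' f a b
  exact this.continuous

/-- The extension of a `*`-homomorphism into a C*-algebra to the enveloping C*-algebra. -/
def lift : Envelope A →⋆ₐ[ℂ] B where
  __ := UniformSpace.Completion.extensionHom (α := PreEnvelope A) (f : A →+* B) (continuous_pre f)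
  commutes' r := by
    refine (UniformSpace.Completion.extensionHom_coe (α := PreEnvelope A) (f : A →+* B)
      (continuous_pre f) (algebraMap ℂ A r)).trans ?_
    exact f.toAlgHom.commutes r
  map_star' a := by
    induction a using induction_on with
    | hp => exact isClosed_eq (UniformSpace.Completion.continuous_extension.comp continuous_star')
              (continuous_star.comp UniformSpace.Completion.continuous_extension)
    | ih a =>
      rw [← coe_star]
      refine (UniformSpace.Completion.extensionHom_coe (α := PreEnvelope A) (f : A →+* B)
        (continuous_pre f) (star a : A)).trans (Eq.trans ?_ (congrArg star
        (UniformSpace.Completion.extensionHom_coe (α := PreEnvelope A) (f : A →+* B)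
        (continuous_pre f) a)).symm)
      exact map_star f a

theorem lift_of (a : A) : lift f (of A a) = f a :=
  UniformSpace.Completion.extensionHom_coe (α := PreEnvelope A) (f : A →+* B) (continuous_pre f) a

theorem continuous_lift : Continuous (lift f) := UniformSpace.Completion.continuous_extension

end Lift
end Envelope
end Envelope

section Bounded
open CStarSeminorm

instance TwistingMap.Tensor.bounded {A B : Type u} [Ring A] [Algebra ℂ A] [StarRing A]
    [StarModule ℂ A] [Ring B] [Algebra ℂ B] [StarRing B] [StarModule ℂ B] [CStarBounded A]
    [CStarBounded B] (R : TwistingMap A B) [R.StarCompat] : CStarBounded R.Tensor where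
  bddAbove x := by
    rw [← mem_boundedElements]
    obtain ⟨x, rfl⟩ := R.of.surjective x
    induction x using TensorProduct.induction_on with
    | zero => rw [map_zero]; exact zero_mem _
    | add x y hx hy => rw [map_add]; exact add_mem hx hy
    | tmul a b =>
      rw [← TwistingMap.tmul_def, TwistingMap.tmul_eq]
      exact mul_mem (bounded_of_hom _ a) (bounded_of_hom _ b)

variable {A : ℤ → Type u} [∀ i, Ring (A i)] [∀ i, Algebra ℂ (A i)]
    [∀ i, StarRing (A i)] [∀ i, StarModule ℂ (A i)] [∀ i, CStarBounded (A i)]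

instance TwistSystem.iter_bounded (𝔖 : TwistSystem A) (k : ℕ) (n : ℤ) :
    CStarBounded (𝔖.Iter k n) := by
  induction k generalizing n with
  | zero => exact (inferInstance : CStarBounded (A n))
  | succ k ih =>
    have := ih (n + 1)
    exact TwistingMap.Tensor.bounded ((𝔖.stage k (n + 1)).T n (lt_add_one n))

instance TwistSystem.union_bounded (𝔖 : TwistSystem A) : CStarBounded 𝔖.Union where
  bddAbove x := by
    rw [← mem_boundedElements]
    induction x using Quotient.inductionOn with
    | h x => exact bounded_of_hom (𝔖.toUnion x.1) x.2

end Bounded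

/-! ### The factors `H` (group algebra) and `Ĝ` (functions) -/

section GroupAlgebra
variable {K : Type u} [Group K]

/-- The involution of a complex group algebra, `(∑ c_h h)* = ∑ conj(c_h) h⁻¹`. -/
instance groupAlgebraStar : Star (MonoidAlgebra ℂ K) where
  star x := x.coeff.sum fun h c => MonoidAlgebra.single h⁻¹ (star c)

theorem star_single (h : K) (c : ℂ) :
    star (MonoidAlgebra.single h c) = MonoidAlgebra.single h⁻¹ (star c) := by
  change Finsupp.sum (MonoidAlgebra.single h c).coeff _ = _
  rw [MonoidAlgebra.coeff_single, Finsupp.sum_single_index]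
  simp

theorem groupAlgebra_star_add (x y : MonoidAlgebra ℂ K) : star (x + y) = star x + star y := by
  change Finsupp.sum (x + y).coeff _ = _
  rw [MonoidAlgebra.coeff_add, Finsupp.sum_add_index']
  · rfl
  · simp
  · intros; simp [MonoidAlgebra.single_add]

theorem groupAlgebra_star_zero : star (0 : MonoidAlgebra ℂ K) = 0 := by
  change Finsupp.sum (0 : MonoidAlgebra ℂ K).coeff _ = _
  simp

instance : StarRing (MonoidAlgebra ℂ K) where
  star_add := groupAlgebra_star_add
  star_involutive x := by
    induction x using MonoidAlgebra.induction_linear with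
    | zero => rw [groupAlgebra_star_zero, groupAlgebra_star_zero]
    | add x y hx hy => rw [groupAlgebra_star_add, groupAlgebra_star_add, hx, hy]
    | single h c => simp [star_single]
  star_mul x y := by
    induction x using MonoidAlgebra.induction_linear with
    | zero => simp [groupAlgebra_star_zero]
    | add x y hx hy => rw [add_mul, groupAlgebra_star_add, groupAlgebra_star_add, hx, hy, mul_add]
    | single h c =>
    induction y using MonoidAlgebra.induction_linear with
    | zero => simp [groupAlgebra_star_zero]
    | add x y hx hy => rw [mul_add, groupAlgebra_star_add, groupAlgebra_star_add, hx, hy, add_mul]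
    | single h' c' => simp [star_single, MonoidAlgebra.single_mul_single, mul_comm]

instance : StarModule ℂ (MonoidAlgebra ℂ K) where
  star_smul r x := by
    induction x using MonoidAlgebra.induction_linear with
    | zero => simp
    | add x y hx hy => rw [smul_add, star_add, star_add, hx, hy, smul_add]
    | single h c => simp [star_single]

instance : CStarBounded (MonoidAlgebra ℂ K) where
  bddAbove x := by
    rw [← CStarSeminorm.mem_boundedElements]
    induction x using MonoidAlgebra.induction_linear with
    | zero => exact zero_mem _
    | add x y hx hy => exact add_mem hx hy
    | single h c =>
      have : MonoidAlgebra.single h c = c • MonoidAlgebra.single h (1 : ℂ) := by simp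
      rw [this]
      refine Subalgebra.smul_mem _ (CStarSeminorm.mem_boundedElements_of_le 1 fun p =>
        p.le_one_of_unitary ?_) c
      simp [star_single, MonoidAlgebra.single_mul_single, MonoidAlgebra.one_def]

instance {X : Type u} [Finite X] : CStarBounded (X → ℂ) where
  bddAbove f := by
    classical
    cases nonempty_fintype X
    rw [← CStarSeminorm.mem_boundedElements]
    have : f = ∑ x, f x • (Pi.single x 1 : X → ℂ) := by
      ext y
      simp [Finset.sum_apply, Pi.single_apply]
    rw [this]
    refine sum_mem fun x _ => Subalgebra.smul_mem _
      (CStarSeminorm.mem_boundedElements_of_le 1 fun p => p.le_one_of_proj ?_) _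
    ext y
    by_cases h : y = x <;> simp [Pi.single_apply, h]

/-- The linear map on a group algebra with given values on the group elements. -/
def lcomb {M : Type*} [AddCommGroup M] [Module ℂ M] (f : K → M) : MonoidAlgebra ℂ K →ₗ[ℂ] M :=
  Finsupp.linearCombination ℂ f ∘ₗ (MonoidAlgebra.coeffLinearEquiv ℂ).toLinearMap

@[simp] theorem lcomb_single {M : Type*} [AddCommGroup M] [Module ℂ M] (f : K → M) (h : K) (c : ℂ) :
    lcomb f (MonoidAlgebra.single h c) = c • f h := by
  simp [lcomb]

end GroupAlgebra

section Factors
variable {G : Type u} [Group G] (H : Subgroup G)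

theorem single_eq_smul {K : Type*} (h : K) (c : ℂ) :
    MonoidAlgebra.single h c = c • MonoidAlgebra.single h (1 : ℂ) := by simp

/-- `R_{2n,2n+1} : Ĝ ⊗ H → H ⊗ Ĝ`, `f ⊗ h ↦ h ⊗ f(h ·)`, as a linear map. -/
def twistHGLin : (G → ℂ) ⊗[ℂ] MonoidAlgebra ℂ H →ₗ[ℂ] MonoidAlgebra ℂ H ⊗[ℂ] (G → ℂ) :=
  TensorProduct.lift (LinearMap.flip (lcomb fun h : H =>
    TensorProduct.mk ℂ (MonoidAlgebra ℂ H) (G → ℂ) (MonoidAlgebra.single h 1) ∘ₗ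
      LinearMap.funLeft ℂ ℂ fun x : G => (h : G) * x))

/-- `R_{2n-1,2n} : H ⊗ Ĝ → Ĝ ⊗ H`, `h ⊗ f ↦ f(· h) ⊗ h`, as a linear map. -/
def twistGHLin : MonoidAlgebra ℂ H ⊗[ℂ] (G → ℂ) →ₗ[ℂ] (G → ℂ) ⊗[ℂ] MonoidAlgebra ℂ H :=
  TensorProduct.lift (lcomb fun h : H =>
    (TensorProduct.mk ℂ (G → ℂ) (MonoidAlgebra ℂ H)).flip (MonoidAlgebra.single h 1) ∘ₗ
      LinearMap.funLeft ℂ ℂ fun x : G => x * (h : G))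

variable {H}

theorem twistHGLin_apply (f : G → ℂ) (h : H) (c : ℂ) :
    twistHGLin H (f ⊗ₜ MonoidAlgebra.single h c) =
      MonoidAlgebra.single h c ⊗ₜ fun x => f (h * x) := by
  simp only [twistHGLin, TensorProduct.lift.tmul, LinearMap.flip_apply, lcomb_single,
    LinearMap.smul_apply, LinearMap.comp_apply, TensorProduct.mk_apply]
  rw [TensorProduct.smul_tmul', ← single_eq_smul]
  rfl

theorem twistGHLin_apply (f : G → ℂ) (h : H) (c : ℂ) :
    twistGHLin H (MonoidAlgebra.single h c ⊗ₜ f) =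
      (fun x => f (x * h)) ⊗ₜ MonoidAlgebra.single h c := by
  simp only [twistGHLin, TensorProduct.lift.tmul, LinearMap.flip_apply, lcomb_single,
    LinearMap.smul_apply, LinearMap.comp_apply, TensorProduct.mk_apply]
  rw [← TensorProduct.tmul_smul, ← single_eq_smul]
  rfl

variable (H)

/-- The twisting map `R_{2n,2n+1} : Ĝ ⊗ H → H ⊗ Ĝ`, `f ⊗ h ↦ h ⊗ f(h ·)`, that is,
`δ_g ⊗ h ↦ h ⊗ δ_{h⁻¹g}`. -/
def twistHG : TwistingMap (MonoidAlgebra ℂ H) (G → ℂ) where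
  toLin := twistHGLin H
  map_one_left a := by
    induction a using MonoidAlgebra.induction_linear with
    | zero => simp
    | add x y hx hy => simp only [TensorProduct.tmul_add, TensorProduct.add_tmul, map_add, hx, hy]
    | single h c => rw [twistHGLin_apply]; rfl
  map_one_right b := by
    rw [MonoidAlgebra.one_def, twistHGLin_apply]
    simp
  comp_mul_right := TwistingMap.comp_mul_right_of _ (by
    intro f a a'
    induction a using MonoidAlgebra.induction_linear with
    | zero => simp
    | add x y hx hy => simp only [add_mul, TensorProduct.tmul_add, map_add, hx, hy]
    | single h c =>
    induction a' using MonoidAlgebra.induction_linear with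
    | zero => simp
    | add x y hx hy =>
      rw [mul_add, TensorProduct.tmul_add, map_add, hx, hy]
      simp only [map_add, LinearMap.comp_add, LinearMap.lTensor_add, LinearMap.add_comp,
        LinearMap.add_apply]
    | single h' c' =>
      simp only [MonoidAlgebra.single_mul_single, twistHGLin_apply, LinearMap.comp_apply,
        LinearMap.lTensor_tmul, LinearMap.flip_apply, TensorProduct.mk_apply, LinearEquiv.coe_coe,
        TensorProduct.assoc_symm_tmul, LinearMap.rTensor_tmul, LinearMap.mul'_apply,
        Subgroup.coe_mul, mul_assoc])
  comp_mul_left := TwistingMap.comp_mul_left_of _ (by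
    intro f f' a
    induction a using MonoidAlgebra.induction_linear with
    | zero => simp
    | add x y hx hy => simp only [TensorProduct.tmul_add, map_add, hx, hy]
    | single h c =>
      simp only [twistHGLin_apply, LinearMap.comp_apply, LinearMap.rTensor_tmul,
        TensorProduct.mk_apply, LinearEquiv.coe_coe, TensorProduct.assoc_tmul,
        LinearMap.lTensor_tmul, LinearMap.mul'_apply]
      rfl)

/-- The twisting map `R_{2n-1,2n} : H ⊗ Ĝ → Ĝ ⊗ H`, `h ⊗ f ↦ f(· h) ⊗ h`, that is,
`h ⊗ δ_g ↦ δ_{gh⁻¹} ⊗ h`. -/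
def twistGH : TwistingMap (G → ℂ) (MonoidAlgebra ℂ H) where
  toLin := twistGHLin H
  map_one_left a := by
    rw [MonoidAlgebra.one_def, twistGHLin_apply]
    simp
  map_one_right b := by
    induction b using MonoidAlgebra.induction_linear with
    | zero => simp
    | add x y hx hy => simp only [TensorProduct.tmul_add, TensorProduct.add_tmul, map_add, hx, hy]
    | single h c => rw [twistGHLin_apply]; rfl
  comp_mul_right := TwistingMap.comp_mul_right_of _ (by
    intro a f f'
    induction a using MonoidAlgebra.induction_linear with
    | zero => simp
    | add x y hx hy => simp only [TensorProduct.add_tmul, map_add, hx, hy]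
    | single h c =>
      simp only [twistGHLin_apply, LinearMap.comp_apply, LinearMap.lTensor_tmul,
        LinearMap.flip_apply, TensorProduct.mk_apply, LinearEquiv.coe_coe,
        TensorProduct.assoc_symm_tmul, LinearMap.rTensor_tmul, LinearMap.mul'_apply]
      rfl)
  comp_mul_left := TwistingMap.comp_mul_left_of _ (by
    intro a a' f
    induction a' using MonoidAlgebra.induction_linear with
    | zero => simp
    | add x y hx hy => simp only [mul_add, TensorProduct.add_tmul, map_add, hx, hy]
    | single h' c' =>
    induction a using MonoidAlgebra.induction_linear with
    | zero => simp
    | add x y hx hy =>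
      rw [add_mul, TensorProduct.add_tmul, map_add, hx, hy]
      simp only [map_add, LinearMap.comp_add, LinearMap.rTensor_add, LinearMap.add_comp,
        LinearMap.add_apply]
    | single h c =>
      simp only [MonoidAlgebra.single_mul_single, twistGHLin_apply, LinearMap.comp_apply,
        LinearMap.lTensor_tmul, TensorProduct.mk_apply, LinearEquiv.coe_coe,
        TensorProduct.assoc_tmul, LinearMap.rTensor_tmul, LinearMap.mul'_apply,
        Subgroup.coe_mul, mul_assoc])

variable {H}

theorem twistHG_single [DecidableEq G] (g : G) (h : H) :
    (twistHG H).toLin (Pi.single g 1 ⊗ₜ MonoidAlgebra.single h 1) =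
      MonoidAlgebra.single h 1 ⊗ₜ Pi.single ((h : G)⁻¹ * g) 1 := by
  refine (twistHGLin_apply _ _ _).trans (congrArg _ ?_)
  ext x
  simp [Pi.single_apply, eq_inv_mul_iff_mul_eq]

theorem twistGH_single [DecidableEq G] (g : G) (h : H) :
    (twistGH H).toLin (MonoidAlgebra.single h 1 ⊗ₜ Pi.single g 1) =
      Pi.single (g * (h : G)⁻¹) 1 ⊗ₜ MonoidAlgebra.single h 1 := by
  refine (twistGHLin_apply _ _ _).trans (congrArg (· ⊗ₜ[ℂ] MonoidAlgebra.single h (1 : ℂ)) ?_)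
  ext x
  simp [Pi.single_apply, eq_mul_inv_iff_mul_eq]

instance : (twistHG H).StarCompat where
  isStar x := by
    induction x using TensorProduct.induction_on with
    | zero => simp
    | add x y hx hy => simp only [TwistingMap.starMap_add, hx, hy]
    | tmul a f =>
    induction a using MonoidAlgebra.induction_linear with
    | zero => simp
    | add x y hx hy => simp only [TensorProduct.add_tmul, TwistingMap.starMap_add, hx, hy]
    | single h c =>
      rw [TwistingMap.starMap_tmul, star_single]
      change (twistHG H).starMap (twistHGLin H _) = _
      rw [twistHGLin_apply, TwistingMap.starMap_tmul, star_single]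
      change twistHGLin H _ = _
      rw [twistHGLin_apply]
      simp only [inv_inv, star_star]
      congr 1
      ext x
      simp

instance : (twistGH H).StarCompat where
  isStar x := by
    induction x using TensorProduct.induction_on with
    | zero => simp
    | add x y hx hy => simp only [TwistingMap.starMap_add, hx, hy]
    | tmul f a =>
    induction a using MonoidAlgebra.induction_linear with
    | zero => simp
    | add x y hx hy => simp only [TensorProduct.tmul_add, TwistingMap.starMap_add, hx, hy]
    | single h c =>
      rw [TwistingMap.starMap_tmul, star_single]
      change (twistGH H).starMap (twistGHLin H _) = _
      rw [twistGHLin_apply, TwistingMap.starMap_tmul, star_single]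
      change twistGHLin H _ = _
      rw [twistGHLin_apply]
      simp only [inv_inv, star_star]
      congr 1
      ext x
      simp

variable (H)

/-- The factors of the infinite tensor product: the group algebra of `H` and the algebra of
functions on `G`. -/
def Factor : Bool → Type u
  | true => MonoidAlgebra ℂ H
  | false => G → ℂ

instance : ∀ b, Ring (Factor H b)
  | true => inferInstanceAs (Ring (MonoidAlgebra ℂ H))
  | false => inferInstanceAs (Ring (G → ℂ))
instance : ∀ b, Algebra ℂ (Factor H b)
  | true => inferInstanceAs (Algebra ℂ (MonoidAlgebra ℂ H))
  | false => inferInstanceAs (Algebra ℂ (G → ℂ))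
instance : ∀ b, StarRing (Factor H b)
  | true => inferInstanceAs (StarRing (MonoidAlgebra ℂ H))
  | false => inferInstanceAs (StarRing (G → ℂ))
instance : ∀ b, StarModule ℂ (Factor H b)
  | true => inferInstanceAs (StarModule ℂ (MonoidAlgebra ℂ H))
  | false => inferInstanceAs (StarModule ℂ (G → ℂ))
instance [Finite G] : ∀ b, CStarBounded (Factor H b)
  | true => inferInstanceAs (CStarBounded (MonoidAlgebra ℂ H))
  | false => inferInstanceAs (CStarBounded (G → ℂ))

/-- The twisting maps of adjacent factors. -/
def twist : ∀ b b', TwistingMap (Factor H b) (Factor H b')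
  | true, false => twistHG H
  | false, true => twistGH H
  | true, true => TwistingMap.flip _ _
  | false, false => TwistingMap.flip _ _

instance : ∀ b b', (twist H b b').StarCompat
  | true, false => inferInstanceAs ((twistHG H).StarCompat)
  | false, true => inferInstanceAs ((twistGH H).StarCompat)
  | true, true => inferInstanceAs ((TwistingMap.flip _ _).StarCompat)
  | false, false => inferInstanceAs ((TwistingMap.flip _ _).StarCompat)

/-- `A i = H` (the group algebra) for even `i`, and `A i = Ĝ` for odd `i`. -/
abbrev SiteAlg (i : ℤ) : Type u := Factor H (decide (Even i))

end Factors

section HexagonFlip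
open TwistingMap
variable {A B C : Type u} [Ring A] [Algebra ℂ A] [Ring B] [Algebra ℂ B] [Ring C] [Algebra ℂ C]

theorem hexagon_flip_right (R : TwistingMap A B) : Hexagon R (flip B C) (flip A C) := by
  refine hexagon_iff.2 fun a b c => ?_
  rw [flip_toLin, extLin_tmul, flip_toLin, lam_tmul]
  induction R.toLin (b ⊗ₜ a) using TensorProduct.induction_on with
  | zero => simp
  | add x y hx hy => simp only [map_add, TensorProduct.add_tmul, hx, hy]
  | tmul p q => rfl

theorem hexagon_flip_left (R : TwistingMap B C) : Hexagon (flip A B) R (flip A C) := by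
  refine hexagon_iff.2 fun a b c => ?_
  rw [flip_toLin, mu_tmul, flip_toLin, LinearMap.lTensor_tmul]
  change a ⊗ₜ R.toLin (c ⊗ₜ b) = _
  induction R.toLin (c ⊗ₜ b) using TensorProduct.induction_on with
  | zero => simp
  | add x y hx hy => simp only [map_add, TensorProduct.add_tmul, TensorProduct.tmul_add, hx, hy]
  | tmul p q => rfl

end HexagonFlip

section System
variable {G : Type u} [Group G] (H : Subgroup G)
open TwistingMap

theorem hexagon_HGH : Hexagon (twistHG H) (twistGH H) (flip _ _) := by
  refine hexagon_iff.2 fun a f c => ?_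
  induction a using MonoidAlgebra.induction_linear with
  | zero => simp
  | add x y hx hy => simp only [map_add, TensorProduct.tmul_add, hx, hy]
  | single h r =>
  induction c using MonoidAlgebra.induction_linear with
  | zero => simp [mu]
  | add x y hx hy =>
    rw [TensorProduct.add_tmul, map_add, TensorProduct.add_tmul, map_add, ← hx, ← hy]
    simp only [mu, map_add, LinearMap.comp_add, LinearMap.rTensor_add, LinearMap.add_apply]
  | single k s =>
    change mu _ _ _ (twistHGLin H _) = extLin _ _ (twistGHLin H _ ⊗ₜ _)
    rw [twistHGLin_apply, twistGHLin_apply, mu_tmul, extLin_tmul, flip_toLin, lam_tmul,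
      LinearMap.lTensor_tmul]
    change _ ⊗ₜ[ℂ] twistGHLin H (_ ⊗ₜ _) = TensorProduct.assoc ℂ _ _ _ (twistHGLin H (_ ⊗ₜ _) ⊗ₜ _)
    rw [twistHGLin_apply, twistGHLin_apply, TensorProduct.assoc_tmul]
    simp only [mul_assoc]

theorem hexagon_GHG : Hexagon (twistGH H) (twistHG H) (flip _ _) := by
  refine hexagon_iff.2 fun f a f' => ?_
  induction a using MonoidAlgebra.induction_linear with
  | zero => simp
  | add x y hx hy => simp only [map_add, TensorProduct.tmul_add, TensorProduct.add_tmul, hx, hy]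
  | single h r =>
    change mu _ _ _ (twistGHLin H _) = extLin _ _ (twistHGLin H _ ⊗ₜ _)
    rw [twistHGLin_apply, twistGHLin_apply, mu_tmul, extLin_tmul, flip_toLin, flip_toLin, lam_tmul,
      LinearMap.lTensor_tmul]
    change _ ⊗ₜ[ℂ] twistHGLin H (_ ⊗ₜ _) = TensorProduct.assoc ℂ _ _ _ (twistGHLin H (_ ⊗ₜ _) ⊗ₜ _)
    rw [twistHGLin_apply, twistGHLin_apply, TensorProduct.assoc_tmul]

theorem hexagon_twist : ∀ b₁ b₂ b₃,
    Hexagon (twist H b₁ b₂) (twist H b₂ b₃) (flip (Factor H b₁) (Factor H b₃))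
  | true, false, true => hexagon_HGH H
  | false, true, false => hexagon_GHG H
  | true, true, _ => hexagon_flip_left _
  | false, false, _ => hexagon_flip_left _
  | true, false, false => hexagon_flip_right _
  | false, true, true => hexagon_flip_right _

/-- The factors `⋯, H, Ĝ, H, Ĝ, ⋯` with the twisting maps `R_{i,i+1}` of adjacent factors, all other
`R_{i,j}` being the flips. -/
def sys : TwistSystem (SiteAlg H) where
  R i j _ := if j = i + 1 then twist H _ _ else flip _ _
  starCompat i j _ := by
    split_ifs <;> infer_instance
  hexagon i j k hij hjk := by
    rw [if_neg (show ¬ k = i + 1 by omega)]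
    by_cases h1 : j = i + 1
    · by_cases h2 : k = j + 1
      · rw [if_pos h1, if_pos h2]
        exact hexagon_twist H _ _ _
      · rw [if_neg h2]
        exact hexagon_flip_right _
    · rw [if_neg h1]
      exact hexagon_flip_left _

/-- The C*-inductive limit `𝒜 = ⋯ ⊗ H ⊗ Ĝ ⊗ H ⊗ Ĝ ⊗ ⋯`. -/
abbrev InfiniteTensor [Finite G] : Type u := Envelope (sys H).Union

open Classical in
/-- The basis elements of the factors: `h ∈ H` and the delta function of `g ∈ G`. -/
def Factor.basis {H : Subgroup G} (h : H) (g : G) : ∀ b, Factor H b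
  | true => (MonoidAlgebra.single h 1 : MonoidAlgebra ℂ H)
  | false => (Pi.single g 1 : G → ℂ)

variable {H}

/-- The interval `[n, m]` -/
def interval (n m : ℤ) (h : n ≤ m) : NonemptyInterval ℤ := ⟨(n, m), h⟩

/-- The elementary tensor `a_n ⊗ ⋯ ⊗ a_m` of `A_{n,m}` with `a_{2x} = h x ∈ H` and
`a_{2x+1} = δ_{g x} ∈ Ĝ`. -/
def basisTensor (h : ℤ → H) (g : ℤ → G) (I : NonemptyInterval ℤ) : (sys H).Local I :=
  (sys H).pure (fun i => Factor.basis (h (i / 2)) (g (i / 2)) (decide (Even i))) _ _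

variable (H) in
/-- The image of `A_{n,m}` in `𝒜`. -/
def toInfinite [Finite G] (I : NonemptyInterval ℤ) : (sys H).Local I →⋆ₐ[ℂ] InfiniteTensor H :=
  (Envelope.of _).comp ((sys H).toUnion I)

end System

/-! ### The field algebra -/

section FieldAlgebra
variable {G : Type u} [Group G]

/-- The generators `δ_g(x)`, for `g ∈ G` and `x ∈ ℤ`, and `ρ_h(l)`, for `h ∈ H` and `l ∈ ℤ + 1/2`,
of the field algebra. Throughout, the half-integer `j + 1/2` is represented by the integer `j`; thus
`j + 1/2 < x` means `j < x`, and `j + 1/2 > x` means `x ≤ j`. -/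
inductive Gen (H : Subgroup G) : Type u
  | δ (g : G) (x : ℤ) : Gen H
  | ρ (h : H) (l : ℤ) : Gen H

/-- Families of elements of an algebra satisfying the relations of the field algebra. -/
structure IsFieldRep [Fintype G] (H : Subgroup G) {B : Type*} [Ring B]
    (δ : G → ℤ → B) (ρ : H → ℤ → B) : Prop where
  sum_δ : ∀ x, ∑ g, δ g x = 1
  ρ_one : ∀ l, ρ 1 l = 1
  δ_mul_self : ∀ g x, δ g x * δ g x = δ g x
  δ_mul_ne : ∀ g₁ g₂ x, g₁ ≠ g₂ → δ g₁ x * δ g₂ x = 0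
  ρ_mul : ∀ h₁ h₂ l, ρ h₁ l * ρ h₂ l = ρ (h₁ * h₂) l
  δ_comm : ∀ g₁ g₂ x x', δ g₁ x * δ g₂ x' = δ g₂ x' * δ g₁ x
  ρ_δ_lt : ∀ (h : H) (g : G) (l x : ℤ), l < x → ρ h l * δ g x = δ (h * g) x * ρ h l
  ρ_δ_gt : ∀ (h : H) (g : G) (l x : ℤ), x ≤ l → ρ h l * δ g x = δ g x * ρ h l
  ρ_ρ_gt : ∀ (h₁ h₂ : H) (l l' : ℤ), l' < l → ρ h₁ l * ρ h₂ l' = ρ h₂ l' * ρ (h₂⁻¹ * h₁ * h₂) l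
  ρ_ρ_lt : ∀ (h₁ h₂ : H) (l l' : ℤ), l < l' → ρ h₁ l * ρ h₂ l' = ρ (h₁ * h₂ * h₁⁻¹) l' * ρ h₁ l

section Rel
variable [Fintype G] (H : Subgroup G)
open Gen
open FreeAlgebra (ι)

/-- The defining relations of the local field algebra, as pairs of elements of the free algebra. -/
inductive Rel : FreeAlgebra ℂ (Gen H) → FreeAlgebra ℂ (Gen H) → Prop
  | sum_δ (x : ℤ) : Rel (∑ g : G, ι ℂ (δ g x)) 1
  | ρ_one (l : ℤ) : Rel (ι ℂ (ρ 1 l)) 1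
  | δ_mul_self (g : G) (x : ℤ) : Rel (ι ℂ (δ g x) * ι ℂ (δ g x)) (ι ℂ (δ g x))
  | δ_mul_ne (g₁ g₂ : G) (x : ℤ) : g₁ ≠ g₂ → Rel (ι ℂ (δ g₁ x) * ι ℂ (δ g₂ x)) 0
  | ρ_mul (h₁ h₂ : H) (l : ℤ) : Rel (ι ℂ (ρ h₁ l) * ι ℂ (ρ h₂ l)) (ι ℂ (ρ (h₁ * h₂) l))
  | δ_comm (g₁ g₂ : G) (x x' : ℤ) :
      Rel (ι ℂ (δ g₁ x) * ι ℂ (δ g₂ x')) (ι ℂ (δ g₂ x') * ι ℂ (δ g₁ x))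
  | ρ_δ_lt (h : H) (g : G) (l x : ℤ) : l < x →
      Rel (ι ℂ (ρ h l) * ι ℂ (δ g x)) (ι ℂ (δ (h * g) x) * ι ℂ (ρ h l))
  | ρ_δ_gt (h : H) (g : G) (l x : ℤ) : x ≤ l →
      Rel (ι ℂ (ρ h l) * ι ℂ (δ g x)) (ι ℂ (δ g x) * ι ℂ (ρ h l))
  | ρ_ρ_gt (h₁ h₂ : H) (l l' : ℤ) : l' < l →
      Rel (ι ℂ (ρ h₁ l) * ι ℂ (ρ h₂ l')) (ι ℂ (ρ h₂ l') * ι ℂ (ρ (h₂⁻¹ * h₁ * h₂) l))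
  | ρ_ρ_lt (h₁ h₂ : H) (l l' : ℤ) : l < l' →
      Rel (ι ℂ (ρ h₁ l) * ι ℂ (ρ h₂ l')) (ι ℂ (ρ (h₁ * h₂ * h₁⁻¹) l') * ι ℂ (ρ h₁ l))

end Rel

variable [Fintype G] (H : Subgroup G)

/-- The local field algebra `𝓕_{H,loc}`: the unital complex algebra with generators `δ_g(x)` and
`ρ_h(l)` and the relations `Rel`. -/
def LocalField : Type u := RingQuot (Rel H)

namespace LocalField

instance : Ring (LocalField H) := inferInstanceAs (Ring (RingQuot (Rel H)))
instance : Algebra ℂ (LocalField H) := inferInstanceAs (Algebra ℂ (RingQuot (Rel H)))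

/-- The quotient map from the free algebra. -/
def mk : FreeAlgebra ℂ (Gen H) →ₐ[ℂ] LocalField H := RingQuot.mkAlgHom ℂ (Rel H)

theorem mk_surjective : Function.Surjective (mk H) := RingQuot.mkAlgHom_surjective ℂ (Rel H)

theorem mk_eq {x y : FreeAlgebra ℂ (Gen H)} (h : Rel H x y) : mk H x = mk H y :=
  RingQuot.mkAlgHom_rel ℂ h

variable {H}

/-- The generator `δ_g(x)` -/
def δ (g : G) (x : ℤ) : LocalField H := mk H (FreeAlgebra.ι ℂ (Gen.δ g x))

/-- The generator `ρ_h(l)` -/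
def ρ (h : H) (l : ℤ) : LocalField H := mk H (FreeAlgebra.ι ℂ (Gen.ρ h l))

variable (H) in
theorem isFieldRep : IsFieldRep H (δ (H := H)) ρ where
  sum_δ x := by
    have h := mk_eq H (Rel.sum_δ x)
    simp only [map_sum, map_one] at h
    exact h
  ρ_one l := by
    have h := mk_eq H (Rel.ρ_one l)
    simp only [map_one] at h
    exact h
  δ_mul_self g x := by
    have h := mk_eq H (Rel.δ_mul_self g x)
    simp only [map_mul] at h
    exact h
  δ_mul_ne g₁ g₂ x hg := by
    have h := mk_eq H (Rel.δ_mul_ne g₁ g₂ x hg)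
    simp only [map_mul, map_zero] at h
    exact h
  ρ_mul h₁ h₂ l := by
    have h := mk_eq H (Rel.ρ_mul h₁ h₂ l)
    simp only [map_mul] at h
    exact h
  δ_comm g₁ g₂ x x' := by
    have h := mk_eq H (Rel.δ_comm g₁ g₂ x x')
    simp only [map_mul] at h
    exact h
  ρ_δ_lt h g l x hl := by
    have h := mk_eq H (Rel.ρ_δ_lt h g l x hl)
    simp only [map_mul] at h
    exact h
  ρ_δ_gt h g l x hl := by
    have h := mk_eq H (Rel.ρ_δ_gt h g l x hl)
    simp only [map_mul] at h
    exact h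
  ρ_ρ_gt h₁ h₂ l l' hl := by
    have h := mk_eq H (Rel.ρ_ρ_gt h₁ h₂ l l' hl)
    simp only [map_mul] at h
    exact h
  ρ_ρ_lt h₁ h₂ l l' hl := by
    have h := mk_eq H (Rel.ρ_ρ_lt h₁ h₂ l l' hl)
    simp only [map_mul] at h
    exact h

section Lift
variable {B : Type*} [Ring B] [Algebra ℂ B] {d : G → ℤ → B} {r : H → ℤ → B}

/-- The homomorphism from the free algebra given by images of the generators. -/
def preLift (d : G → ℤ → B) (r : H → ℤ → B) : FreeAlgebra ℂ (Gen H) →ₐ[ℂ] B :=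
  FreeAlgebra.lift ℂ fun s => match s with
    | Gen.δ g x => d g x
    | Gen.ρ h l => r h l

@[simp] theorem preLift_δ (g : G) (x : ℤ) : preLift d r (FreeAlgebra.ι ℂ (Gen.δ g x)) = d g x := by
  simp [preLift]
@[simp] theorem preLift_ρ (h : H) (l : ℤ) : preLift d r (FreeAlgebra.ι ℂ (Gen.ρ h l)) = r h l := by
  simp [preLift]

/-- The universal property of the local field algebra. -/
def lift (hd : IsFieldRep H d r) : LocalField H →ₐ[ℂ] B :=
  RingQuot.liftAlgHom ℂ ⟨preLift d r, by
    intro x y h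
    cases h with
    | sum_δ x => simpa using hd.sum_δ x
    | ρ_one l => simpa using hd.ρ_one l
    | δ_mul_self g x => simpa using hd.δ_mul_self g x
    | δ_mul_ne g₁ g₂ x h => simpa using hd.δ_mul_ne g₁ g₂ x h
    | ρ_mul h₁ h₂ l => simpa using hd.ρ_mul h₁ h₂ l
    | δ_comm g₁ g₂ x x' => simpa using hd.δ_comm g₁ g₂ x x'
    | ρ_δ_lt h g l x hl => simpa using hd.ρ_δ_lt h g l x hl
    | ρ_δ_gt h g l x hl => simpa using hd.ρ_δ_gt h g l x hl
    | ρ_ρ_gt h₁ h₂ l l' hl => simpa using hd.ρ_ρ_gt h₁ h₂ l l' hl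
    | ρ_ρ_lt h₁ h₂ l l' hl => simpa using hd.ρ_ρ_lt h₁ h₂ l l' hl⟩

theorem lift_mk (hd : IsFieldRep H d r) (x : FreeAlgebra ℂ (Gen H)) :
    lift hd (mk H x) = preLift d r x := RingQuot.liftAlgHom_mkAlgHom_apply ℂ _ _ x

@[simp] theorem lift_δ (hd : IsFieldRep H d r) (g : G) (x : ℤ) : lift hd (δ g x) = d g x := by
  rw [δ, lift_mk, preLift_δ]
@[simp] theorem lift_ρ (hd : IsFieldRep H d r) (h : H) (l : ℤ) : lift hd (ρ h l) = r h l := by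
  rw [ρ, lift_mk, preLift_ρ]

end Lift

/-- Induction on the generators. -/
theorem induction {p : LocalField H → Prop} (x : LocalField H) (hδ : ∀ g x, p (δ g x))
    (hρ : ∀ h l, p (ρ h l)) (hmap : ∀ c : ℂ, p (algebraMap ℂ _ c))
    (hadd : ∀ x y, p x → p y → p (x + y)) (hmul : ∀ x y, p x → p y → p (x * y)) : p x := by
  obtain ⟨x, rfl⟩ := mk_surjective H x
  induction x using FreeAlgebra.induction with
  | grade0 r => rw [AlgHom.commutes]; exact hmap r
  | grade1 s => exact match s with
    | Gen.δ g x => hδ g x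
    | Gen.ρ h l => hρ h l
  | mul a b ha hb => rw [map_mul]; exact hmul _ _ ha hb
  | add a b ha hb => rw [map_add]; exact hadd _ _ ha hb

end LocalField

/-- The opposite algebra with the complex conjugate scalar multiplication; conjugate linear
antihomomorphisms `A → A` are homomorphisms `A → ConjOp A`. -/
def ConjOp (A : Type u) : Type u := Aᵐᵒᵖ

/-- The identity map `A → ConjOp A`. -/
def ConjOp.op {A : Type u} (a : A) : ConjOp A := MulOpposite.op a
/-- The identity map `ConjOp A → A`. -/
def ConjOp.unop {A : Type u} (a : ConjOp A) : A := MulOpposite.unop a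

instance (A : Type u) [Ring A] : Ring (ConjOp A) := inferInstanceAs (Ring Aᵐᵒᵖ)
instance (A : Type u) [Ring A] [Algebra ℂ A] : Algebra ℂ (ConjOp A) :=
  RingHom.toAlgebra' ((algebraMap ℂ Aᵐᵒᵖ).comp (starRingEnd ℂ)) fun c x =>
    Algebra.commutes (A := Aᵐᵒᵖ) (starRingEnd ℂ c) x

namespace LocalField
variable {H : Subgroup G}

theorem isFieldRep_op : IsFieldRep H
    (fun g x => (MulOpposite.op (δ g x) : (LocalField H)ᵐᵒᵖ))
    (fun h l => (MulOpposite.op (ρ h⁻¹ l))) where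
  sum_δ x := by
    rw [← MulOpposite.op_one, ← (isFieldRep H).sum_δ x, Finset.op_sum]
  ρ_one l := by rw [inv_one, (isFieldRep H).ρ_one, MulOpposite.op_one]
  δ_mul_self g x := by rw [← MulOpposite.op_mul, (isFieldRep H).δ_mul_self]
  δ_mul_ne g₁ g₂ x h := by
    rw [← MulOpposite.op_mul, (isFieldRep H).δ_mul_ne _ _ _ h.symm, MulOpposite.op_zero]
  ρ_mul h₁ h₂ l := by rw [← MulOpposite.op_mul, (isFieldRep H).ρ_mul, mul_inv_rev]
  δ_comm g₁ g₂ x x' := by rw [← MulOpposite.op_mul, ← MulOpposite.op_mul, (isFieldRep H).δ_comm]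
  ρ_δ_lt h g l x hl := by
    rw [← MulOpposite.op_mul, ← MulOpposite.op_mul, (isFieldRep H).ρ_δ_lt _ _ _ _ hl]
    simp
  ρ_δ_gt h g l x hl := by
    rw [← MulOpposite.op_mul, ← MulOpposite.op_mul, (isFieldRep H).ρ_δ_gt _ _ _ _ hl]
  ρ_ρ_gt h₁ h₂ l l' hl := by
    rw [← MulOpposite.op_mul, ← MulOpposite.op_mul, (isFieldRep H).ρ_ρ_lt _ _ _ _ hl]
    simp [mul_assoc]
  ρ_ρ_lt h₁ h₂ l l' hl := by
    rw [← MulOpposite.op_mul, ← MulOpposite.op_mul, (isFieldRep H).ρ_ρ_gt _ _ _ _ hl]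
    simp [mul_assoc]

theorem isFieldRep_conjOp : IsFieldRep H (fun g x => ConjOp.op (δ g x : LocalField H))
    (fun h l => ConjOp.op (ρ h⁻¹ l : LocalField H)) := isFieldRep_op

/-- The conjugate linear antihomomorphism with `δ_g(x) ↦ δ_g(x)` and `ρ_h(l) ↦ ρ_{h⁻¹}(l)`. -/
def starHom : LocalField H →ₐ[ℂ] ConjOp (LocalField H) := lift isFieldRep_conjOp

theorem starHom_δ (g : G) (x : ℤ) : starHom (δ g x : LocalField H) = ConjOp.op (δ g x) :=
  lift_δ isFieldRep_conjOp g x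
theorem starHom_ρ (h : H) (l : ℤ) : starHom (ρ h l : LocalField H) = ConjOp.op (ρ h⁻¹ l) :=
  lift_ρ isFieldRep_conjOp h l

instance : Star (LocalField H) := ⟨fun x => ConjOp.unop (starHom x)⟩

@[simp] theorem star_δ (g : G) (x : ℤ) : star (δ g x : LocalField H) = δ g x :=
  congrArg ConjOp.unop (starHom_δ g x)
@[simp] theorem star_ρ (h : H) (l : ℤ) : star (ρ h l : LocalField H) = ρ h⁻¹ l :=
  congrArg ConjOp.unop (starHom_ρ h l)
theorem star_add' (x y : LocalField H) : star (x + y) = star x + star y :=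
  congrArg ConjOp.unop (map_add starHom x y)
theorem star_mul' (x y : LocalField H) : star (x * y) = star y * star x :=
  congrArg ConjOp.unop (map_mul starHom x y)
theorem star_algebraMap (c : ℂ) :
    star (algebraMap ℂ (LocalField H) c) = algebraMap ℂ (LocalField H) (star c) :=
  congrArg ConjOp.unop (starHom.commutes c)

/-- The involution of the local field algebra: `δ_g(x)* = δ_g(x)` and `ρ_h(l)* = ρ_{h⁻¹}(l)`. -/
instance : StarRing (LocalField H) where
  star_add := star_add'
  star_mul := star_mul'
  star_involutive x := by
    induction x using LocalField.induction with
    | hδ g x => simp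
    | hρ h l => simp
    | hmap c => rw [star_algebraMap, star_algebraMap, star_star]
    | hadd x y hx hy => rw [star_add', star_add', hx, hy]
    | hmul x y hx hy => rw [star_mul', star_mul', hx, hy]

instance : StarModule ℂ (LocalField H) where
  star_smul c x := by
    rw [Algebra.smul_def, star_mul, star_algebraMap, ← Algebra.commutes, ← Algebra.smul_def]

instance : CStarBounded (LocalField H) where
  bddAbove x := by
    rw [← CStarSeminorm.mem_boundedElements]
    induction x using LocalField.induction with
    | hδ g x =>
      refine CStarSeminorm.mem_boundedElements_of_le 1 fun p => p.le_one_of_proj ?_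
      rw [star_δ, (isFieldRep H).δ_mul_self]
    | hρ h l =>
      refine CStarSeminorm.mem_boundedElements_of_le 1 fun p => p.le_one_of_unitary ?_
      rw [star_ρ, (isFieldRep H).ρ_mul, inv_mul_cancel, (isFieldRep H).ρ_one]
    | hmap c => exact Subalgebra.algebraMap_mem _ c
    | hadd x y hx hy => exact add_mem hx hy
    | hmul x y hx hy => exact mul_mem hx hy

/-- The universal property of the local field algebra as a `*`-algebra. -/
def starLift {B : Type*} [Ring B] [Algebra ℂ B] [StarRing B] [StarModule ℂ B] {d : G → ℤ → B}
    {r : H → ℤ → B} (hd : IsFieldRep H d r) (hδ : ∀ g x, star (d g x) = d g x)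
    (hρ : ∀ h l, star (r h l) = r h⁻¹ l) : LocalField H →⋆ₐ[ℂ] B where
  __ := lift hd
  map_star' x := by
    change lift hd (star x) = star (lift hd x)
    induction x using LocalField.induction with
    | hδ g x => simp [hδ]
    | hρ h l => simp [hρ]
    | hmap c =>
      rw [star_algebraMap, AlgHom.commutes, AlgHom.commutes, Algebra.algebraMap_eq_smul_one,
        Algebra.algebraMap_eq_smul_one, star_smul, star_one]
    | hadd x y hx hy => rw [star_add, map_add, map_add, hx, hy, star_add]
    | hmul x y hx hy => rw [star_mul, map_mul, map_mul, hx, hy, star_mul]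

section
variable {B : Type*} [Ring B] [Algebra ℂ B] [StarRing B] [StarModule ℂ B] {d : G → ℤ → B}
    {r : H → ℤ → B} (hd : IsFieldRep H d r) (hδ : ∀ g x, star (d g x) = d g x)
    (hρ : ∀ h l, star (r h l) = r h⁻¹ l)
theorem starLift_δ (g : G) (x : ℤ) : starLift hd hδ hρ (δ g x) = d g x := lift_δ hd g x
theorem starLift_ρ (h : H) (l : ℤ) : starLift hd hδ hρ (ρ h l) = r h l := lift_ρ hd h l
end

end LocalField

/-- The field algebra `𝓕_H`: the C*-completion of the local field algebra. -/
abbrev FieldAlgebra : Type u := Envelope (LocalField H)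

namespace FieldAlgebra
variable {H}

/-- `δ_g(x) ∈ 𝓕_H` -/
def δ (g : G) (x : ℤ) : FieldAlgebra H := Envelope.of _ (LocalField.δ g x)
/-- `ρ_h(l) ∈ 𝓕_H` -/
def ρ (h : H) (l : ℤ) : FieldAlgebra H := Envelope.of _ (LocalField.ρ h l)

end FieldAlgebra
end FieldAlgebra

/-! ### The action of `D(H;G)` and the observable algebra -/

section Order
variable (A : Type u) [Ring A] [Algebra ℂ A] [StarRing A] [StarModule ℂ A] [CStarBounded A]

instance : PartialOrder (Envelope A) := CStarAlgebra.spectralOrder _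
instance : StarOrderedRing (Envelope A) := CStarAlgebra.spectralOrderedRing _

end Order

section Shift
variable {K A : Type*} [Group K] [Fintype K] [DecidableEq K] [Ring A] [StarRing A]

/-- The matrix `λ_c ⊗ a`, where `λ_c` is the matrix of the left translation by `c`. -/
def shift (c : K) (a : A) : CStarMatrix K K A :=
  CStarMatrix.ofMatrix fun s t => if s = c * t then a else 0

theorem shift_apply (c : K) (a : A) (s t : K) :
    shift c a s t = if s = c * t then a else 0 := rfl

theorem shift_mul (c c' : K) (a a' : A) : shift c a * shift c' a' = shift (c * c') (a * a') := by
  ext s t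
  simp only [CStarMatrix.mul_apply, shift_apply, mul_assoc]
  rw [Finset.sum_eq_single (c' * t)]
  · simp
  · intro j _ hj
    simp [hj]
  · simp

theorem shift_one : shift (1 : K) (1 : A) = 1 := by
  ext s t
  simp [shift_apply, CStarMatrix.one_apply]

theorem shift_zero (c : K) : shift c (0 : A) = 0 := by
  ext s t
  simp [shift_apply]

theorem shift_sum {ι : Type*} (I : Finset ι) (c : K) (a : ι → A) :
    ∑ i ∈ I, shift c (a i) = shift c (∑ i ∈ I, a i) := by
  classical
  induction I using Finset.induction_on with
  | empty => simp [shift_zero]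
  | insert i I hi ih =>
    rw [Finset.sum_insert hi, Finset.sum_insert hi, ih]
    ext s t
    simp only [CStarMatrix.add_apply, shift_apply]
    split_ifs <;> simp

theorem star_shift (c : K) (a : A) : star (shift c a) = shift c⁻¹ (star a) := by
  ext s t
  rw [CStarMatrix.star_apply, shift_apply, shift_apply]
  simp only [eq_inv_mul_iff_mul_eq, eq_comm (a := t)]
  split_ifs <;> simp

end Shift

namespace FieldAlgebra
set_option linter.style.haveILetI false
variable {G : Type u} [Group G] [Fintype G] {H : Subgroup G}

theorem isFieldRep : IsFieldRep H (δ (H := H)) ρ where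
  sum_δ x := by
    simp only [δ]
    rw [← map_sum, (LocalField.isFieldRep H).sum_δ, map_one]
  ρ_one l := by rw [ρ, (LocalField.isFieldRep H).ρ_one, map_one]
  δ_mul_self g x := by rw [δ, ← map_mul, (LocalField.isFieldRep H).δ_mul_self]
  δ_mul_ne g₁ g₂ x hg := by
    rw [δ, δ, ← map_mul, (LocalField.isFieldRep H).δ_mul_ne _ _ _ hg, map_zero]
  ρ_mul h₁ h₂ l := by rw [ρ, ρ, ← map_mul, (LocalField.isFieldRep H).ρ_mul, ρ]
  δ_comm g₁ g₂ x x' := by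
    rw [δ, δ, ← map_mul, (LocalField.isFieldRep H).δ_comm, map_mul]
  ρ_δ_lt h g l x hl := by
    rw [δ, δ, ρ, ← map_mul, (LocalField.isFieldRep H).ρ_δ_lt _ _ _ _ hl, map_mul]
  ρ_δ_gt h g l x hl := by
    rw [δ, ρ, ← map_mul, (LocalField.isFieldRep H).ρ_δ_gt _ _ _ _ hl, map_mul]
  ρ_ρ_gt h₁ h₂ l l' hl := by
    rw [ρ, ρ, ← map_mul, (LocalField.isFieldRep H).ρ_ρ_gt _ _ _ _ hl, map_mul]; rfl
  ρ_ρ_lt h₁ h₂ l l' hl := by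
    rw [ρ, ρ, ← map_mul, (LocalField.isFieldRep H).ρ_ρ_lt _ _ _ _ hl, map_mul]; rfl

theorem star_δ (g : G) (x : ℤ) : star (δ g x : FieldAlgebra H) = δ g x := by
  rw [δ, ← map_star, LocalField.star_δ]
theorem star_ρ (h : H) (l : ℤ) : star (ρ h l : FieldAlgebra H) = ρ h⁻¹ l := by
  rw [ρ, ← map_star, LocalField.star_ρ, ρ]

variable [H.Normal]

/-- `g h g⁻¹` as an element of the normal subgroup `H`. -/
abbrev conj (g : G) (h : H) : H := MulAut.conjNormal g h

theorem conj_one (g : G) : conj g (1 : H) = 1 := map_one (MulAut.conjNormal g)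
theorem conj_mul (g : G) (h h' : H) : conj g (h * h') = conj g h * conj g h' :=
  map_mul (MulAut.conjNormal g) h h'
theorem conj_inv (g : G) (h : H) : conj g h⁻¹ = (conj g h)⁻¹ := map_inv (MulAut.conjNormal g) h
theorem conj_conj (g g' : G) (h : H) : conj g (conj g' h) = conj (g * g') h := by
  rw [conj, conj, conj, map_mul, MulAut.mul_apply]
theorem conj_eq_one (g : G) (h : H) : conj g h = 1 ↔ h = 1 :=
  EmbeddingLike.map_eq_one_iff (f := MulAut.conjNormal g)

section Matrix
variable [Fintype H] [DecidableEq H]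

theorem isFieldRep_shift (g : G) : IsFieldRep H
    (fun f x => shift (1 : H) (δ (g * f) x : FieldAlgebra H))
    (fun t l => shift (conj g t) (ρ (conj g t) l)) where
  sum_δ x := by
    rw [shift_sum, ← shift_one, ← isFieldRep.sum_δ x]
    congr 1
    exact Fintype.sum_equiv (Equiv.mulLeft g) _ _ fun _ => rfl
  ρ_one l := by rw [conj_one, isFieldRep.ρ_one, shift_one]
  δ_mul_self f x := by rw [shift_mul, isFieldRep.δ_mul_self, one_mul]
  δ_mul_ne g₁ g₂ x hg := by
    rw [shift_mul, isFieldRep.δ_mul_ne _ _ _ (by simpa using hg), shift_zero]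
  ρ_mul h₁ h₂ l := by rw [shift_mul, isFieldRep.ρ_mul, conj_mul]
  δ_comm g₁ g₂ x x' := by rw [shift_mul, shift_mul, isFieldRep.δ_comm]
  ρ_δ_lt h f l x hl := by
    rw [shift_mul, shift_mul, isFieldRep.ρ_δ_lt _ _ _ _ hl, one_mul, mul_one]
    simp [MulAut.conjNormal_apply, mul_assoc]
  ρ_δ_gt h f l x hl := by
    rw [shift_mul, shift_mul, isFieldRep.ρ_δ_gt _ _ _ _ hl, one_mul, mul_one]
  ρ_ρ_gt h₁ h₂ l l' hl := by
    rw [shift_mul, shift_mul, isFieldRep.ρ_ρ_gt _ _ _ _ hl]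
    simp [mul_assoc]
  ρ_ρ_lt h₁ h₂ l l' hl := by
    rw [shift_mul, shift_mul, isFieldRep.ρ_ρ_lt _ _ _ _ hl]
    simp [mul_assoc]

/-- The `*`-homomorphism `𝓕_H → M_H(𝓕_H)` with `δ_f(x) ↦ 1 ⊗ δ_{gf}(x)` and
`ρ_t(l) ↦ λ_{gtg⁻¹} ⊗ ρ_{gtg⁻¹}(l)`. Its matrix coefficients give the action of `D(H;G)`. -/
def coaction (g : G) : FieldAlgebra H →⋆ₐ[ℂ] CStarMatrix H H (FieldAlgebra H) :=
  Envelope.lift (LocalField.starLift (isFieldRep_shift g)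
    (fun f x => by rw [star_shift, star_δ, inv_one])
    (fun t l => by rw [star_shift, star_ρ, conj_inv]))

theorem coaction_δ (g f : G) (x : ℤ) :
    coaction g (δ f x : FieldAlgebra H) = shift 1 (δ (g * f) x) := by
  rw [coaction, δ, Envelope.lift_of, LocalField.starLift_δ]

theorem coaction_ρ (g : G) (t : H) (l : ℤ) :
    coaction g (ρ t l : FieldAlgebra H) = shift (conj g t) (ρ (conj g t) l) := by
  rw [coaction, ρ, Envelope.lift_of, LocalField.starLift_ρ]

theorem continuous_entry (g : G) (s t : H) :
    Continuous fun F : FieldAlgebra H => coaction g F s t := by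
  have h1 : Continuous (coaction g : FieldAlgebra H → _) := Envelope.continuous_lift _
  have h2 : LipschitzWith 1 (fun M : CStarMatrix H H (FieldAlgebra H) => M s t) := by
    refine LipschitzWith.of_dist_le_mul fun M N => ?_
    rw [dist_eq_norm, dist_eq_norm, NNReal.coe_one, one_mul, ← CStarMatrix.sub_apply]
    exact CStarMatrix.norm_entry_le_norm
  exact h2.continuous.comp h1

/-- Induction on the generators. -/
theorem induction {p : FieldAlgebra H → Prop} (x : FieldAlgebra H) (hδ : ∀ g x, p (δ g x))
    (hρ : ∀ h l, p (ρ h l)) (hmap : ∀ c : ℂ, p (algebraMap ℂ _ c))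
    (hadd : ∀ x y, p x → p y → p (x + y)) (hmul : ∀ x y, p x → p y → p (x * y))
    (hp : IsClosed {x | p x}) : p x := by
  induction x using Envelope.induction_on with
  | hp => exact hp
  | ih a =>
    change p (Envelope.of _ a)
    induction a using LocalField.induction with
    | hδ g x => exact hδ g x
    | hρ h l => exact hρ h l
    | hmap c =>
      have h := hmap c
      rwa [← (Envelope.of (LocalField H)).toAlgHom.commutes c] at h
    | hadd x y hx hy => rw [map_add]; exact hadd _ _ hx hy
    | hmul x y hx hy => rw [map_mul]; exact hmul _ _ hx hy

theorem coaction_toeplitz (g : G) (F : FieldAlgebra H) (s t : H) :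
    coaction g F s t = coaction g F (s * t⁻¹) 1 := by
  induction F using induction generalizing s t with
  | hδ f x => simp [coaction_δ, shift_apply, mul_inv_eq_one]
  | hρ h l => simp [coaction_ρ, shift_apply, mul_inv_eq_iff_eq_mul]
  | hmap c =>
    rw [Algebra.algebraMap_eq_smul_one, map_smul, map_one, CStarMatrix.smul_apply,
      CStarMatrix.smul_apply, CStarMatrix.one_apply, CStarMatrix.one_apply]
    simp [mul_inv_eq_one]
  | hadd x y hx hy => rw [map_add, CStarMatrix.add_apply, CStarMatrix.add_apply, hx, hy]
  | hmul x y hx hy =>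
    rw [map_mul, CStarMatrix.mul_apply, CStarMatrix.mul_apply]
    refine Fintype.sum_equiv (Equiv.mulRight t⁻¹) _ _ fun j => ?_
    rw [Equiv.coe_mulRight, hx, hy, hx (s * t⁻¹)]
    simp
  | hp =>
    simp only [Set.ofPred_forall]
    exact isClosed_iInter fun s => isClosed_iInter fun t =>
      isClosed_eq (continuous_entry g s t) (continuous_entry g _ _)

end Matrix

/-- The action `γ_{(h,g)}` of the basis element `(h, g)` of `D(H;G)` on `𝓕_H`. By the lemmas
`γ_δ`, `γ_ρ`, `γ_one`, `γ_mul`, `γ_γ` and `continuous_γ`, it is the unique continuous linear action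
of `D(H;G)` which makes `𝓕_H` a module algebra and satisfies
`(h,g) δ_f(x) = δ_{h,e} δ_{gf}(x)` and `(h,g) ρ_t(l) = δ_{h,gtg⁻¹} ρ_h(l)`. -/
def γ (h : H) (g : G) : FieldAlgebra H →ₗ[ℂ] FieldAlgebra H :=
  letI : Fintype H := Fintype.ofFinite H
  letI : DecidableEq H := Classical.decEq H
  { toFun := fun F => coaction g F h 1
    map_add' := fun x y => by rw [map_add, CStarMatrix.add_apply]
    map_smul' := fun c x => by rw [map_smul, CStarMatrix.smul_apply, RingHom.id_apply] }

theorem γ_apply [i₁ : Fintype H] [i₂ : DecidableEq H] (h : H) (g : G) (F : FieldAlgebra H) :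
    γ h g F = coaction g F h 1 := by
  have e₁ : i₁ = Fintype.ofFinite H := Subsingleton.elim _ _
  have e₂ : i₂ = Classical.decEq H := Subsingleton.elim _ _
  subst e₁ e₂
  rfl

open Classical in
theorem γ_δ (h : H) (g f : G) (x : ℤ) :
    γ h g (δ f x) = if h = 1 then δ (g * f) x else 0 := by
  letI : Fintype H := Fintype.ofFinite H
  rw [γ_apply, coaction_δ, shift_apply, mul_one]

open Classical in
theorem γ_ρ (h : H) (g : G) (t : H) (l : ℤ) :
    γ h g (ρ t l) = if h = conj g t then ρ h l else 0 := by
  letI : Fintype H := Fintype.ofFinite H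
  rw [γ_apply, coaction_ρ, shift_apply, mul_one]
  split_ifs with e
  · rw [e]
  · rfl

open Classical in
/-- `a(1) = ε(a) 1` -/
theorem γ_one (h : H) (g : G) : γ h g (1 : FieldAlgebra H) = if h = 1 then 1 else 0 := by
  letI : Fintype H := Fintype.ofFinite H
  rw [γ_apply, map_one, CStarMatrix.one_apply]

/-- The module algebra property with respect to `Δ(h,g) = ∑ t, (t,g) ⊗ (t⁻¹h,g)`. -/
theorem γ_mul [Fintype H] (h : H) (g : G) (x y : FieldAlgebra H) :
    γ h g (x * y) = ∑ t : H, γ t g x * γ (t⁻¹ * h) g y := by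
  classical
  simp only [γ_apply]
  rw [map_mul, CStarMatrix.mul_apply]
  refine Fintype.sum_equiv ((Equiv.inv H).trans (Equiv.mulLeft h)) _ _ fun j => ?_
  rw [coaction_toeplitz g x]
  simp

theorem γ_star (h : H) (g : G) (x : FieldAlgebra H) : γ h g (star x) = star (γ h⁻¹ g x) := by
  classical
  letI : Fintype H := Fintype.ofFinite H
  rw [γ_apply, γ_apply, map_star, CStarMatrix.star_apply, coaction_toeplitz, one_mul]

theorem continuous_γ (h : H) (g : G) : Continuous (γ h g : FieldAlgebra H → FieldAlgebra H) := by
  classical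
  letI : Fintype H := Fintype.ofFinite H
  have := continuous_entry (H := H) g h 1
  simp only [← γ_apply] at this
  exact this

open Classical in
/-- The action is multiplicative for `(h₁,g₁)(h₂,g₂) = δ_{h₁g₁,g₁h₂} (h₁,g₁g₂)`. -/
theorem γ_γ (h₁ h₂ : H) (g₁ g₂ : G) (x : FieldAlgebra H) :
    γ h₁ g₁ (γ h₂ g₂ x) = if (h₁ * g₁ : G) = g₁ * h₂ then γ h₁ (g₁ * g₂) x else 0 := by
  letI : Fintype H := Fintype.ofFinite H
  have key : ∀ h₁ h₂ : H, (h₁ * g₁ : G) = g₁ * h₂ ↔ h₁ = conj g₁ h₂ := by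
    intro h₁ h₂
    rw [Subtype.ext_iff, MulAut.conjNormal_apply, eq_mul_inv_iff_mul_eq]
  simp only [key]
  induction x using induction generalizing h₁ h₂ with
  | hδ f x =>
    rw [γ_δ, γ_δ]
    by_cases e : h₂ = 1
    · rw [if_pos e, γ_δ, e, conj_one, mul_assoc]
      split_ifs <;> rfl
    · have : h₁ = conj g₁ h₂ → h₁ ≠ 1 := fun h h' => e ((conj_eq_one g₁ h₂).1 (h ▸ h'))
      rw [if_neg e, map_zero]
      split_ifs with e₁ e₂
      · exact absurd e₂ (this e₁)
      · rfl
      · rfl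
  | hρ t l =>
    rw [γ_ρ, γ_ρ, ← conj_conj]
    by_cases e : h₂ = conj g₂ t
    · rw [if_pos e, γ_ρ, e]
      split_ifs <;> rfl
    · have : h₁ = conj g₁ h₂ → h₁ ≠ conj g₁ (conj g₂ t) := fun h h' =>
        e ((MulAut.conjNormal g₁).injective (h.symm.trans h'))
      rw [if_neg e, map_zero]
      split_ifs with e₁ e₂
      · exact absurd e₂ (this e₁)
      · rfl
      · rfl
  | hmap c =>
    simp only [Algebra.algebraMap_eq_smul_one, map_smul, γ_one]
    by_cases e : h₂ = 1
    · rw [if_pos e, γ_one, e, conj_one]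
      split_ifs <;> simp
    · have : h₁ = conj g₁ h₂ → h₁ ≠ 1 := fun h h' => e ((conj_eq_one g₁ h₂).1 (h ▸ h'))
      rw [if_neg e, map_zero]
      split_ifs with e₁ e₂
      · exact absurd e₂ (this e₁)
      · simp
      · simp
  | hadd x y hx hy =>
    rw [map_add, map_add, hx, hy, map_add]
    split_ifs <;> simp
  | hmul x y hx hy =>
    rw [γ_mul, map_sum]
    rw [γ_mul h₁ (g₁ * g₂)]
    simp only [γ_mul h₁, hx, hy]
    rw [Finset.sum_comm]
    have : ∀ s t : H, ((if s = conj g₁ t then γ s (g₁ * g₂) x else 0) *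
        if s⁻¹ * h₁ = conj g₁ (t⁻¹ * h₂) then γ (s⁻¹ * h₁) (g₁ * g₂) y else 0) =
        if s = conj g₁ t then (if h₁ = conj g₁ h₂ then
          γ s (g₁ * g₂) x * γ (s⁻¹ * h₁) (g₁ * g₂) y else 0) else 0 := by
      intro s t
      by_cases e : s = conj g₁ t
      · have : s⁻¹ * h₁ = conj g₁ (t⁻¹ * h₂) ↔ h₁ = conj g₁ h₂ := by
          rw [conj_mul, conj_inv, e, mul_right_inj]
        simp only [this, if_pos e]
        split_ifs <;> simp
      · simp [e]
    simp only [this]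
    have h2 : ∀ s t : H, s = conj g₁ t ↔ (MulAut.conjNormal g₁).symm s = t := by
      intro s t
      rw [MulEquiv.symm_apply_eq]
    simp only [h2, Finset.sum_ite_eq, Finset.mem_univ, if_true]
    split_ifs <;> simp
  | hp =>
    simp only [Set.ofPred_forall]
    refine isClosed_iInter fun s => isClosed_iInter fun t =>
      isClosed_eq ((continuous_γ _ _).comp (continuous_γ _ _)) ?_
    split_ifs
    · exact continuous_γ _ _
    · exact continuous_const

variable (H) in
/-- The underlying vector space of `D(H;G)`, with basis `(h, g)`, `h ∈ H`, `g ∈ G`. -/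
abbrev Double : Type u := (H × G) →₀ ℂ

open Classical in
variable (H) in
/-- The counit of `D(H;G)`: `ε(h,g) = δ_{h,e}`. -/
def counit : Double H →ₗ[ℂ] ℂ :=
  Finsupp.linearCombination ℂ fun p => if p.1 = 1 then 1 else 0

variable (H) in
/-- The action of `D(H;G)` on `𝓕_H`. -/
def action : Double H →ₗ[ℂ] (FieldAlgebra H →ₗ[ℂ] FieldAlgebra H) :=
  Finsupp.linearCombination ℂ fun p => γ p.1 p.2

open Classical in
theorem invariant_iff (F : FieldAlgebra H) : (∀ a, action H a F = counit H a • F) ↔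
    ∀ h g, γ h g F = if h = 1 then F else 0 := by
  constructor
  · intro hF h g
    have := hF (Finsupp.single (h, g) 1)
    simp only [action, counit, Finsupp.linearCombination_single, one_smul, ite_smul,
      zero_smul] at this
    exact this
  · intro hF a
    induction a using Finsupp.induction_linear with
    | zero => simp
    | add a b ha hb => rw [map_add, map_add, LinearMap.add_apply, ha, hb, add_smul]
    | single p c =>
      simp only [action, counit, Finsupp.linearCombination_single, LinearMap.smul_apply, hF]
      split_ifs <;> simp

variable (H) in
/-- The observable algebra `𝒜_{(H,G)} = {F ∈ 𝓕_H : a(F) = ε(a) F for all a ∈ D(H;G)}`. -/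
def observable : StarSubalgebra ℂ (FieldAlgebra H) where
  carrier := {F | ∀ a, action H a F = counit H a • F}
  mul_mem' := by
    classical
    letI : Fintype H := Fintype.ofFinite H
    intro x y hx hy
    rw [Set.mem_ofPred_eq, invariant_iff] at *
    intro h g
    rw [γ_mul]
    simp only [hx, hy]
    rw [Finset.sum_eq_single 1]
    · simp
    · intro b _ hb; simp [hb]
    · simp
  add_mem' := by
    intro x y hx hy a
    rw [map_add, hx, hy, smul_add]
  algebraMap_mem' c := by
    classical
    rw [Set.mem_ofPred_eq, invariant_iff]
    intro h g
    rw [Algebra.algebraMap_eq_smul_one, map_smul, γ_one]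
    split_ifs <;> simp
  star_mem' := by
    classical
    intro x hx
    rw [Set.mem_ofPred_eq, invariant_iff] at *
    intro h g
    rw [γ_star, hx]
    by_cases e : h = 1 <;> simp [e]

theorem mem_observable {F : FieldAlgebra H} :
    F ∈ observable H ↔ ∀ a, action H a F = counit H a • F := Iff.rfl

theorem isClosed_observable : IsClosed (observable H : Set (FieldAlgebra H)) := by
  classical
  have : (observable H : Set (FieldAlgebra H)) =
      ⋂ h, ⋂ g, {F | γ h g F = if h = 1 then F else 0} := by
    ext F
    simp only [Set.mem_iInter, Set.mem_ofPred_eq]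
    exact invariant_iff F
  rw [this]
  refine isClosed_iInter fun h => isClosed_iInter fun g =>
    isClosed_eq (continuous_γ h g) ?_
  split_ifs
  · exact continuous_id
  · exact continuous_const

instance : CStarAlgebra (observable H) :=
  StarSubalgebra.cstarAlgebra (observable H) (h_closed := isClosed_observable)

/-- `v_h(x) = ∑ k, ρ_{kh⁻¹k⁻¹}(x - 1/2) δ_k(x) ρ_{khk⁻¹}(x + 1/2)` -/
def v (h : H) (x : ℤ) : FieldAlgebra H :=
  ∑ k : G, ρ (conj k h⁻¹) (x - 1) * δ k x * ρ (conj k h) x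

variable (H) in
/-- `w_g(l) = ∑ k, δ_k(l - 1/2) δ_{kg}(l + 1/2)`, where `l = j + 1/2` is represented by `j`. -/
def w (g : G) (j : ℤ) : FieldAlgebra H :=
  ∑ k : G, δ k j * δ (k * g) (j + 1)

/-- The field at the site `i`: `v_{h x}(x)` if `i = 2x`, and `w_{g x}(x + 1/2)` if `i = 2x + 1`. -/
def siteElement (h : ℤ → H) (g : ℤ → G) (i : ℤ) : FieldAlgebra H :=
  if Even i then v (h (i / 2)) (i / 2) else w H (g (i / 2)) (i / 2)

/-- The ordered product of the fields `siteElement h g i`, `i = n, n + 1, …, m`, for an interval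
`I = [n, m]`. -/
def siteProduct (h : ℤ → H) (g : ℤ → G) (I : NonemptyInterval ℤ) : FieldAlgebra H :=
  ((List.range ((I.snd - I.fst).toNat + 1)).map fun j => siteElement h g (I.fst + j)).prod

variable (H) in
/-- The `*`-algebra generated by `v_h(x)`, `x ∈ Λ ∩ ℤ`, and `w_g(l)`, `l ∈ Λ ∩ (ℤ + 1/2)`, where
`Λ` is the interval from `n` to `m`. -/
def localObservable (n m : ℤ) : StarSubalgebra ℂ (FieldAlgebra H) :=
  StarAlgebra.adjoin ℂ ({a | ∃ (h : H) (x : ℤ), n ≤ x ∧ x ≤ m ∧ a = v h x} ∪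
    {a | ∃ (g : G) (j : ℤ), n ≤ j ∧ j < m ∧ a = w H g j})

end FieldAlgebra

end GSpin

end

open scoped TensorProduct

noncomputable section

set_option linter.unusedSectionVars false

namespace GSpin

universe u

/-! ### Universal property of iterated twisted tensor products -/

namespace TwistingMap
variable {A B C : Type u} [Ring A] [Algebra ℂ A] [StarRing A] [StarModule ℂ A]
  [Ring B] [Algebra ℂ B] [StarRing B] [StarModule ℂ B]
  [Ring C] [Algebra ℂ C] [StarRing C] [StarModule ℂ C]
  {D : Type*} [Ring D] [Algebra ℂ D] [StarRing D]

/-! Think of the fields as operators on configurations `σ : ℤ → G`: `δ_g(x)` is the projection onto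
`σ(x) = g`, and `ρ_h(l)` translates by `h` from the left at all sites to the right of `l`. Then
`v_h(x)` is the right translation of `σ(x)` by `h⁻¹`, and `w_g(x + 1/2)` is the projection onto
`σ(x)⁻¹σ(x+1) = g`. Both are insensitive to left translations, which is why they are invariant. A
right translation at `x` changes only the two quotients that contain `σ(x)`, by `h` on one side or
by `h⁻¹` on the other. These are exactly the relations encoded in the twisting maps
(`intertwines_siteHom`), so the universal property of the iterated twisted tensor product yields
homomorphisms `iterLift` on all `A_{n,m}`, compatible with the inclusions.

Injectivity on `A_{n,m}` (`iterLift_injective`) is proved from the relations by splitting off the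
leftmost factor and showing that its basis is independent over the factors further right. For a
factor `H` at site `x`, the `v_h(x)` move `δ_k(x)` to different places while the other factors
commute with `δ_k(x)`. For a factor `Ĝ`, the `w_g` are orthogonal projections, and an endomorphism
translating the site `x` from the right moves `δ_k(x)` while fixing the other factors. The only
input beyond the relations is that the field algebra is not zero, which is seen on `ℓ²` of the
configurations.

An injective `*`-homomorphism out of a finite-dimensional C*-algebra is isometric
(`norm_map_of_finite`), so the map is isometric on a dense subalgebra, hence everywhere, and its
range is closed.

It remains to see that the local observables are dense in the observable algebra
(`observable_subset_of_isClosed`). Every local field operator lies, for a suitable window, in the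
span of the products `δ_g(n) a ρ_h(m + 1/2)` with a local observable `a`: the values at all sites of
the window are recovered from the one at `n` and the quotients `w`, and all `ρ` from the last one
and the single-site translations. Averaging the action of `(e,k)` over `k ∈ G` is continuous, fixes
the observables, and sends such a product to a multiple of `a`, which is zero unless `h = e`. So it
maps local fields to local observables, and density of the local fields gives the claim. -/

/-- The linear map `a ⊗ b ↦ f a * g b`. -/
def mulHom (f : A →⋆ₐ[ℂ] D) (g : B →⋆ₐ[ℂ] D) : A ⊗[ℂ] B →ₗ[ℂ] D :=
  LinearMap.mul' ℂ D ∘ₗ TensorProduct.map f.toAlgHom.toLinearMap g.toAlgHom.toLinearMap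

@[simp] theorem mulHom_tmul (f : A →⋆ₐ[ℂ] D) (g : B →⋆ₐ[ℂ] D) (a : A) (b : B) :
    mulHom f g (a ⊗ₜ b) = f a * g b := by
  simp only [mulHom, LinearMap.comp_apply, TensorProduct.map_tmul, LinearMap.mul'_apply]
  rfl

theorem mulHom_map_mul (f : A →⋆ₐ[ℂ] D) (g : B →⋆ₐ[ℂ] D) (a : A) (b : B) (x : A ⊗[ℂ] B) :
    mulHom f g (TensorProduct.map (LinearMap.mulLeft ℂ a) (LinearMap.mulRight ℂ b) x) =
      f a * mulHom f g x * g b := by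
  induction x using TensorProduct.induction_on with
  | zero => simp
  | add x y hx hy => simp only [map_add, hx, hy, mul_add, add_mul]
  | tmul u v => simp [mul_assoc]

/-- The homomorphisms `f` and `g` satisfy the commutation relation prescribed by `R`. -/
def Intertwines (R : TwistingMap A B) (f : A →⋆ₐ[ℂ] D) (g : B →⋆ₐ[ℂ] D) : Prop :=
  ∀ a b, g b * f a = mulHom f g (R.toLin (b ⊗ₜ a))

/-- The homomorphism `a ⊗ b ↦ f a * g b` on the twisted tensor product. -/
def lift (R : TwistingMap A B) [R.StarCompat] (f : A →⋆ₐ[ℂ] D) (g : B →⋆ₐ[ℂ] D)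
    (h : R.Intertwines f g) : R.Tensor →⋆ₐ[ℂ] D where
  toFun x := mulHom f g (R.of.symm x)
  map_one' := by simp [one_def]
  map_zero' := by simp
  map_add' x y := by simp
  commutes' r := by
    rw [Algebra.algebraMap_eq_smul_one, Algebra.algebraMap_eq_smul_one]
    simp [one_def]
  map_mul' x y := by
    obtain ⟨x, rfl⟩ := R.of.surjective x
    obtain ⟨y, rfl⟩ := R.of.surjective y
    simp only [mul_def, LinearEquiv.symm_apply_apply]
    induction x using TensorProduct.induction_on with
    | zero => simp
    | add x y hx hy => simp only [TensorProduct.add_tmul, map_add, hx, hy, add_mul]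
    | tmul a b =>
    induction y using TensorProduct.induction_on with
    | zero => simp
    | add x y hx hy => simp only [TensorProduct.tmul_add, map_add, hx, hy, mul_add]
    | tmul a' b' =>
      -- Both sides equal `f a * g b * f a' * g b'`; the intertwining relation is used once, for the
      -- two inner factors.
      rw [mulMap_tmul, mulHom_map_mul, ← h, mulHom_tmul, mulHom_tmul]
      simp only [mul_assoc]
  map_star' x := by
    obtain ⟨x, rfl⟩ := R.of.surjective x
    simp only [star_def, LinearEquiv.symm_apply_apply]
    induction x using TensorProduct.induction_on with
    | zero => simp
    | add x y hx hy => simp only [map_add, starMap_add, star_add, hx, hy]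
    -- The adjoint of `f a * g b` has the factors in the wrong order; the intertwining relation
    -- reorders them just as the involution of the twisted product does.
    | tmul a b => rw [starMap_tmul, ← h, mulHom_tmul, star_mul, map_star, map_star]

theorem lift_tmul (R : TwistingMap A B) [R.StarCompat] (f : A →⋆ₐ[ℂ] D) (g : B →⋆ₐ[ℂ] D)
    (h : R.Intertwines f g) (a : A) (b : B) : R.lift f g h (R.tmul a b) = f a * g b :=
  mulHom_tmul f g a b

theorem lift_of (R : TwistingMap A B) [R.StarCompat] (f : A →⋆ₐ[ℂ] D) (g : B →⋆ₐ[ℂ] D)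
    (h : R.Intertwines f g) (x : A ⊗[ℂ] B) : R.lift f g h (R.of x) = mulHom f g x := rfl

/-- In `g b * k c * f a` the last factor is moved to the left past `k c` by `R₃` and then past `g b`
by `R₁`, which is how the twisting map of a product is built. This is the inductive step for lifting
to more factors. -/
theorem Intertwines.extend {R₁ : TwistingMap A B} {R₂ : TwistingMap B C} {R₃ : TwistingMap A C}
    [R₂.StarCompat] {f : A →⋆ₐ[ℂ] D} {g : B →⋆ₐ[ℂ] D} {k : C →⋆ₐ[ℂ] D} (h : Hexagon R₁ R₂ R₃)
    (h₁ : R₁.Intertwines f g) (h₂ : R₂.Intertwines g k) (h₃ : R₃.Intertwines f k) :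
    (TwistingMap.extend R₁ R₂ R₃ h).Intertwines f (R₂.lift g k h₂) := by
  intro a x
  obtain ⟨x, rfl⟩ := R₂.of.surjective x
  rw [extend_toLin, lift_of]
  induction x using TensorProduct.induction_on with
  | zero => simp
  | add x y hx hy => simp only [TensorProduct.add_tmul, map_add, hx, hy, add_mul]
  | tmul b c =>
    rw [mulHom_tmul, mul_assoc, h₃, extLin_tmul]
    induction R₃.toLin (c ⊗ₜ a) using TensorProduct.induction_on with
    | zero => simp
    | add x y hx hy => simp only [map_add, hx, hy, mul_add]
    | tmul u v =>
      rw [mulHom_tmul, ← mul_assoc, h₁, lam_tmul]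
      induction R₁.toLin (b ⊗ₜ u) using TensorProduct.induction_on with
      | zero => simp
      | add x y hx hy => simp only [TensorProduct.add_tmul, map_add, hx, hy, add_mul]
      | tmul p q => simp [lift_of, mul_assoc]

/-- Every tensor is a sum of terms `𝓑 i ⊗ c i`, so injectivity follows from that of `g` once the
elements `f (𝓑 i)` are independent over the range of `g`, which is the content of `hf`. -/
theorem lift_injective {ι : Type*} [Fintype ι] (𝓑 : Module.Basis ι ℂ A) (R : TwistingMap A B)
    [R.StarCompat] {f : A →⋆ₐ[ℂ] D} {g : B →⋆ₐ[ℂ] D} (h : R.Intertwines f g)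
    (hg : Function.Injective g)
    (hf : ∀ c : ι → B, ∑ i, f (𝓑 i) * g (c i) = 0 → ∀ i, g (c i) = 0) :
    Function.Injective (R.lift f g h) := by
  refine (injective_iff_map_eq_zero _).2 fun x hx => ?_
  obtain ⟨x, rfl⟩ := R.of.surjective x
  obtain ⟨c, rfl⟩ := TensorProduct.eq_repr_basis_left 𝓑 x
  rw [Finsupp.sum_fintype _ _ (by simp)] at hx ⊢
  rw [lift_of, map_sum] at hx
  simp only [mulHom_tmul] at hx
  have : ∀ i, c i = 0 := fun i => hg (by rw [hf c hx i, map_zero])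
  simp [this]

end TwistingMap

/-! ### Homomorphisms on iterated products and on their union -/

namespace TwistSystem
variable {A : ℤ → Type u} [∀ i, Ring (A i)] [∀ i, Algebra ℂ (A i)]
    [∀ i, StarRing (A i)] [∀ i, StarModule ℂ (A i)] {𝔖 : TwistSystem A}
    {D : Type*} [Ring D] [Algebra ℂ D] [StarRing D] {φ : ∀ i, A i →⋆ₐ[ℂ] D}

variable (𝔖 φ) in
/-- Homomorphisms on the factors which satisfy the commutation relations of the system. -/
def Intertwines : Prop := ∀ i j h, (𝔖.R i j h).Intertwines (φ i) (φ j)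

variable (φ) in
/-- A homomorphism on a stage which satisfies the commutation relations with the factors on the
left. -/
structure StageLift {n : ℤ} (S : 𝔖.Stage n) where
  toHom : S.carrier →⋆ₐ[ℂ] D
  intertwines : ∀ i h, (S.T i h).Intertwines (φ i) toHom

/-- The extension of a homomorphism to one more factor. -/
def StageLift.cons (hφ : 𝔖.Intertwines φ) {n : ℤ} {S : 𝔖.Stage (n + 1)} (f : StageLift φ S) :
    StageLift φ S.cons where
  toHom := (S.T n (lt_add_one n)).lift (φ n) f.toHom (f.intertwines n (lt_add_one n))
  intertwines i h := TwistingMap.Intertwines.extend (S.hexagon i n h (lt_add_one n)) (hφ i n h)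
    (f.intertwines n (lt_add_one n)) (f.intertwines i (h.trans (lt_add_one n)))

theorem StageLift.cons_tmul (hφ : 𝔖.Intertwines φ) {n : ℤ} {S : 𝔖.Stage (n + 1)}
    (f : StageLift φ S) (a : A n) (s : S.carrier) :
    (f.cons hφ).toHom (S.tmul a s) = φ n a * f.toHom s :=
  TwistingMap.lift_tmul _ _ _ (f.intertwines n (lt_add_one n)) a s

/-- The homomorphism `A_n ⊗ ⋯ ⊗ A_{n+k} → D`, with its commutation relations. -/
def iterStageLift (hφ : 𝔖.Intertwines φ) : (k : ℕ) → (n : ℤ) → StageLift φ (𝔖.stage k n)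
  | 0, n => ⟨φ n, fun i h => hφ i n h⟩
  | k + 1, n => (iterStageLift hφ k (n + 1)).cons hφ

/-- The homomorphism `a_n ⊗ ⋯ ⊗ a_{n+k} ↦ φ a_n ⋯ φ a_{n+k}`. -/
def iterLift (hφ : 𝔖.Intertwines φ) (k : ℕ) (n : ℤ) : 𝔖.Iter k n →⋆ₐ[ℂ] D :=
  (iterStageLift hφ k n).toHom

variable (hφ : 𝔖.Intertwines φ)

theorem iterLift_tmul (k : ℕ) (n : ℤ) (a : A n) (s : 𝔖.Iter k (n + 1)) :
    iterLift hφ (k + 1) n ((𝔖.stage k (n + 1)).tmul a s) = φ n a * iterLift hφ k (n + 1) s :=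
  StageLift.cons_tmul hφ _ a s

theorem iterLift_inr (k : ℕ) (n : ℤ) (s : 𝔖.Iter k (n + 1)) :
    iterLift hφ (k + 1) n (𝔖.inr k n s) = iterLift hφ k (n + 1) s := by
  refine (iterLift_tmul hφ k n 1 s).trans ?_
  rw [map_one, one_mul]

theorem iterLift_incR (k k' : ℕ) (n : ℤ) (h : k ≤ k') (s : 𝔖.Iter k n) :
    iterLift hφ k' n ((𝔖.incR k k' n h).toHom s) = iterLift hφ k n s := by
  induction k generalizing k' n with
  | zero =>
    cases k' with
    | zero => rfl
    | succ k' =>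
      refine (iterLift_tmul hφ k' n s 1).trans ?_
      rw [map_one, mul_one]
      rfl
  | succ k ih =>
    cases k' with
    | zero => omega
    | succ k' =>
      have : (iterLift hφ (k' + 1) n).comp (𝔖.incR (k + 1) (k' + 1) n h).toHom =
          iterLift hφ (k + 1) n := by
        refine Stage.hom_ext fun a b => ?_
        refine (iterLift_tmul hφ k' n a ((𝔖.incR k k' (n + 1) (by omega)).toHom b)).trans ?_
        rw [ih]
        exact (iterLift_tmul hφ k n a b).symm
      exact DFunLike.congr_fun this s

/-- Padding with units on either side only multiplies by `1`. Hence the maps on the local algebras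
are compatible with the direct system and descend to the union. -/
theorem iterLift_incl (k k' : ℕ) (n n' : ℤ) (h : n' ≤ n) (h' : n + k ≤ n' + k')
    (s : 𝔖.Iter k n) : iterLift hφ k' n' (𝔖.incl k n k' n' h h' s) = iterLift hφ k n s := by
  induction k' generalizing n' with
  | zero =>
    obtain rfl : n = n' := by omega
    rw [incl_eq, iterLift_incR]
  | succ k' ih =>
    by_cases e : n = n'
    · subst e
      rw [incl_eq, iterLift_incR]
    · rw [incl_ne _ _ _ _ _ _ _ e, iterLift_inr, ih]

theorem iterLift_pure (x : ∀ i, A i) (k : ℕ) (n : ℤ) :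
    iterLift hφ k n (𝔖.pure x k n) =
      ((List.range (k + 1)).map fun j : ℕ => φ (n + j) (x (n + j))).prod := by
  induction k generalizing n with
  | zero =>
    -- The factor depends on the index, so `n + 0` cannot simply be rewritten to `n`; the comparison
    -- is stated for a variable index and proved by substitution.
    have : ∀ m, m = n → φ n (x n) = φ m (x m) := by rintro _ rfl; rfl
    refine (this (n + (0 : ℕ)) (by simp)).trans ?_
    simp
  | succ k ih =>
    refine (iterLift_tmul hφ k n (x n) _).trans ?_
    rw [ih, List.range_succ_eq_map (n := k + 1), List.map_cons, List.prod_cons, List.map_map]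
    have : ∀ m m', m = m' → φ m (x m) = φ m' (x m') := by rintro _ _ rfl; rfl
    congr 1
    · exact this _ _ (by simp)
    · congr 1
      refine List.map_congr_left fun j _ => ?_
      exact this _ _ (by push_cast; ring)

/-- A subalgebra which contains the images of the factors contains the image of the product. -/
theorem iterLift_mem (S : Subalgebra ℂ D) (k : ℕ) (n : ℤ)
    (hS : ∀ i, n ≤ i → i ≤ n + k → ∀ a, φ i a ∈ S) (s : 𝔖.Iter k n) :
    iterLift hφ k n s ∈ S := by
  induction k generalizing n with
  | zero => exact hS n le_rfl (by simp) s
  | succ k ih =>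
    obtain ⟨s, rfl⟩ := ((𝔖.stage k (n + 1)).T n (lt_add_one n)).of.surjective s
    induction s using TensorProduct.induction_on with
    | zero => rw [map_zero]; exact (map_zero (iterLift hφ (k + 1) n)).symm ▸ zero_mem S
    | add x y hx hy =>
      rw [map_add]
      exact (map_add (iterLift hφ (k + 1) n) _ _).symm ▸ add_mem hx hy
    | tmul a b =>
      refine (iterLift_tmul hφ k n a b).symm ▸ mul_mem (hS n le_rfl (by omega) a) ?_
      exact ih (n + 1) (fun i h h' => hS i (by omega) (by push_cast; omega)) b

/-- The image of the product contains the images of the factors. -/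
theorem mem_range_iterLift (k : ℕ) (n i : ℤ) (h : n ≤ i) (h' : i ≤ n + k) (a : A i) :
    φ i a ∈ Set.range (iterLift hφ k n) :=
  -- The witness is `1 ⊗ ⋯ ⊗ a ⊗ ⋯ ⊗ 1`, the image of `a` under the inclusion of the product with
  -- the single factor `A i`.
  ⟨𝔖.incl 0 i k n h (by simpa using h') a, iterLift_incl hφ 0 k i n h _ a⟩

/-- The homomorphism on the union of the algebras `A_{n,m}`. -/
def unionLift : 𝔖.Union →⋆ₐ[ℂ] D where
  toFun := DirectLimit.lift 𝔖.inclusion (fun I x => iterLift hφ _ I.fst x)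
    fun _ _ _ x => (iterLift_incl hφ _ _ _ _ _ _ x).symm
  -- The interval is arbitrary: the unit of the union is the class of the unit of any local algebra.
  map_one' := (congrArg _ (DirectLimit.one_def (interval 0 0 le_rfl))).trans
    (map_one (iterLift hφ _ _))
  map_zero' := (congrArg _ (DirectLimit.zero_def (interval 0 0 le_rfl))).trans
    (map_zero (iterLift hφ _ _))
  map_mul' := DirectLimit.induction₂ _ fun I x y => by
    rw [DirectLimit.mul_def]
    exact map_mul (iterLift hφ _ _) x y
  map_add' := DirectLimit.induction₂ _ fun I x y => by
    rw [DirectLimit.add_def]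
    exact map_add (iterLift hφ _ _) x y
  commutes' r := by
    rw [← (𝔖.toUnion (interval 0 0 le_rfl)).toAlgHom.commutes r]
    exact (iterLift hφ _ _).toAlgHom.commutes r
  map_star' := DirectLimit.induction _ fun I x => by
    rw [DirectLimit.star_def]
    exact map_star (iterLift hφ _ _) x

theorem exists_toUnion (x : 𝔖.Union) : ∃ I y, 𝔖.toUnion I y = x := by
  induction x using Quotient.inductionOn with
  | h x => exact ⟨x.1, x.2, rfl⟩

theorem finite_iter [∀ i, Module.Finite ℂ (A i)] (k : ℕ) (n : ℤ) :
    Module.Finite ℂ (𝔖.Iter k n) := by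
  induction k generalizing n with
  | zero => exact (inferInstance : Module.Finite ℂ (A n))
  | succ k ih =>
    have := ih (n + 1)
    exact (inferInstance : Module.Finite ℂ (A n ⊗[ℂ] 𝔖.Iter k (n + 1)))

end TwistSystem

/-! ### Commutation relations of the local observables -/

namespace FieldAlgebra
variable {G : Type u} [Group G] [Fintype G] {H : Subgroup G}

/-- The projections at one site add up to `1`. Fixing the value `k` at that site turns the sums over
`G` in `v` and `w` into single terms. -/
theorem ext_mul_δ (x : ℤ) {a b : FieldAlgebra H} (h : ∀ k, a * δ k x = b * δ k x) : a = b := by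
  rw [← mul_one a, ← mul_one b, ← isFieldRep.sum_δ x, Finset.mul_sum, Finset.mul_sum]
  exact Finset.sum_congr rfl fun k _ => h k

theorem δ_mul_δ [DecidableEq G] (k k' : G) (x : ℤ) :
    (δ k x * δ k' x : FieldAlgebra H) = if k = k' then δ k x else 0 := by
  split_ifs with e
  · rw [e, isFieldRep.δ_mul_self]
  · exact isFieldRep.δ_mul_ne _ _ _ e

theorem commute_δ_δ (k k' : G) (x y : ℤ) : Commute (δ k x : FieldAlgebra H) (δ k' y) :=
  isFieldRep.δ_comm k k' x y

theorem commute_ρ_δ (h : H) (k : G) {l x : ℤ} (hl : x ≤ l) :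
    Commute (ρ h l : FieldAlgebra H) (δ k x) := isFieldRep.ρ_δ_gt h k l x hl

/-! ### Left translation at a single site -/

/-- The product `ρ_c(x - 1/2) ρ_{c⁻¹}(x + 1/2)`, which acts by left translation on the site `x`
alone. -/
def siteShift (c : H) (x : ℤ) : FieldAlgebra H := ρ c (x - 1) * ρ c⁻¹ x

theorem siteShift_one (x : ℤ) : siteShift (1 : H) x = 1 := by
  rw [siteShift, inv_one, isFieldRep.ρ_one, isFieldRep.ρ_one, one_mul]

/-- Moving `ρ_{c⁻¹}(x + 1/2)` to the right of `ρ_d(x - 1/2)` conjugates it to `d⁻¹c⁻¹d`, and the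
remaining `d⁻¹` completes it to `(cd)⁻¹`. -/
theorem siteShift_mul (c d : H) (x : ℤ) :
    siteShift c x * siteShift d x = siteShift (c * d) x := by
  rw [siteShift, siteShift, mul_assoc, ← mul_assoc (ρ c⁻¹ x),
    isFieldRep.ρ_ρ_gt _ _ _ _ (sub_one_lt x), mul_assoc (ρ d (x - 1)), isFieldRep.ρ_mul,
    ← mul_assoc, isFieldRep.ρ_mul, siteShift]
  simp [mul_assoc]

theorem star_siteShift (c : H) (x : ℤ) : star (siteShift c x) = siteShift c⁻¹ x := by
  rw [siteShift, star_mul, star_ρ, star_ρ, isFieldRep.ρ_ρ_gt _ _ _ _ (sub_one_lt x), siteShift]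
  simp

theorem siteShift_mul_ρ (c : H) (x : ℤ) : siteShift c x * ρ c x = ρ c (x - 1) := by
  rw [siteShift, mul_assoc, isFieldRep.ρ_mul, inv_mul_cancel, isFieldRep.ρ_one, mul_one]

theorem siteShift_mul_δ (c : H) (k : G) (x : ℤ) :
    siteShift c x * δ k x = δ (c * k) x * siteShift c x := by
  rw [siteShift, mul_assoc, isFieldRep.ρ_δ_gt _ _ _ _ le_rfl, ← mul_assoc,
    isFieldRep.ρ_δ_lt _ _ _ _ (sub_one_lt x), mul_assoc]

/-- A site to the right of `x` is translated by `c` and by `c⁻¹`, which cancel; a site to the left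
of `x` is not moved at all. -/
theorem commute_siteShift_δ (c : H) (k : G) {x y : ℤ} (h : x ≠ y) :
    Commute (siteShift c x) (δ k y) := by
  rcases lt_or_gt_of_ne h with h | h
  · rw [commute_iff_eq, siteShift, mul_assoc, isFieldRep.ρ_δ_lt _ _ _ _ h, ← mul_assoc,
      isFieldRep.ρ_δ_lt _ _ _ _ (by omega), mul_assoc]
    simp
  · exact (commute_ρ_δ _ _ (by omega)).mul_left (commute_ρ_δ _ _ (by omega))

/-- With `x ≤ l` the site `x` lies to the left of the half-integer `l + 1/2`, so the two
translations act on disjoint sets of sites. In the relations, the conjugations of `h` by `c⁻¹` and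
by `c` cancel. For a cut to the left of `x`, the element `c` would be conjugated by `h`. -/
theorem commute_siteShift_ρ (c h : H) {x l : ℤ} (hl : x ≤ l) :
    Commute (siteShift c x) (ρ h l) := by
  rcases hl.eq_or_lt with rfl | hl
  · rw [commute_iff_eq, siteShift, mul_assoc, isFieldRep.ρ_mul, ← mul_assoc,
      isFieldRep.ρ_ρ_gt _ _ _ _ (sub_one_lt x), mul_assoc, isFieldRep.ρ_mul]
    simp
  · rw [commute_iff_eq, siteShift, mul_assoc, isFieldRep.ρ_ρ_lt _ _ _ _ hl, ← mul_assoc,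
      isFieldRep.ρ_ρ_lt _ _ _ _ (by omega), mul_assoc]
    simp [mul_assoc]

theorem commute_siteShift_siteShift (c d : H) {x y : ℤ} (h : x ≠ y) :
    Commute (siteShift c x) (siteShift d y) := by
  rcases lt_or_gt_of_ne h with h | h
  · exact (commute_siteShift_ρ _ _ (by omega)).mul_right (commute_siteShift_ρ _ _ (by omega))
  · exact ((commute_siteShift_ρ _ _ (by omega)).mul_right
      (commute_siteShift_ρ _ _ (by omega))).symm

/-! ### Right translation at a single site -/

section Normal
variable [H.Normal]

/-- The factor `ρ(x + 1/2)` does not act on the site `x`, so it can be moved to the left of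
`δ_k(x)`, where it joins `ρ(x - 1/2)`. -/
theorem v_eq (h : H) (x : ℤ) :
    v h x = ∑ k : G, siteShift (conj k h⁻¹) x * δ k x := by
  refine Finset.sum_congr rfl fun k _ => ?_
  rw [mul_assoc, ← isFieldRep.ρ_δ_gt _ _ _ _ le_rfl, siteShift, ← mul_assoc, conj_inv, inv_inv]

theorem v_mul_δ (h : H) (k : G) (x : ℤ) :
    v h x * δ k x = siteShift (conj k h⁻¹) x * δ k x := by
  classical
  simp only [v_eq, Finset.sum_mul, mul_assoc, δ_mul_δ, mul_ite, mul_zero]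
  rw [Finset.sum_ite_eq' Finset.univ k, if_pos (Finset.mem_univ _)]

/-- Translating the value `k` from the left by `kh⁻¹k⁻¹` gives `kh⁻¹`: the `k`-dependent left
translations fit together to the right translation by `h⁻¹`. -/
theorem v_mul_δ' (h : H) (k : G) (x : ℤ) :
    v h x * δ k x = δ (k * (h : G)⁻¹) x * siteShift (conj k h⁻¹) x := by
  rw [v_mul_δ, siteShift_mul_δ]
  simp [MulAut.conjNormal_apply, mul_assoc]

theorem v_mul_δ_comm (h : H) (k : G) (x : ℤ) :
    v h x * δ k x = δ (k * (h : G)⁻¹) x * v h x := by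
  classical
  refine ext_mul_δ x fun k' => ?_
  rw [mul_assoc, mul_assoc, v_mul_δ' h k', δ_mul_δ, ← mul_assoc, δ_mul_δ]
  simp only [mul_left_inj]
  by_cases e : k = k'
  · rw [if_pos e, if_pos e, v_mul_δ', e]
  · rw [if_neg e, if_neg e, mul_zero, zero_mul]

theorem δ_mul_v (h : H) (k : G) (x : ℤ) : δ k x * v h x = v h x * δ (k * h) x := by
  rw [v_mul_δ_comm, mul_inv_cancel_right]

/-- On the value `k`, the first translation leads to `kf⁻¹`, so the second uses the conjugate by
`kf⁻¹`; indeed `(kf⁻¹)h⁻¹(kf⁻¹)⁻¹ · kf⁻¹k⁻¹ = k(hf)⁻¹k⁻¹`. -/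
theorem v_mul (h f : H) (x : ℤ) : v h x * v f x = v (h * f) x := by
  refine ext_mul_δ x fun k => ?_
  rw [mul_assoc, v_mul_δ', ← mul_assoc, v_mul_δ, mul_assoc, v_mul_δ]
  have : δ (k * (f : G)⁻¹) x * siteShift (conj k f⁻¹) x = siteShift (conj k f⁻¹) x * δ k x := by
    rw [← v_mul_δ', v_mul_δ]
  rw [this, ← mul_assoc, siteShift_mul]
  congr 2
  ext
  simp [MulAut.conjNormal_apply, mul_assoc]

theorem v_one (x : ℤ) : v (1 : H) x = 1 := by
  refine ext_mul_δ x fun k => ?_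
  rw [v_mul_δ, inv_one, conj_one, siteShift_one]

theorem star_v (h : H) (x : ℤ) : star (v h x) = v h⁻¹ x := by
  rw [v_eq, star_sum]
  refine Eq.trans ?_ (mul_one (v h⁻¹ x))
  rw [← isFieldRep.sum_δ x, Finset.mul_sum]
  -- In the adjoint, `k` is the value after the translation. Since `v_{h⁻¹}` sends `k'` to `k'h`,
  -- the value before it is `k' = kh⁻¹`.
  refine Fintype.sum_equiv (Equiv.mulRight (h : G)⁻¹) _ _ fun k => ?_
  rw [star_mul, star_δ, star_siteShift, v_mul_δ']
  congr 2
  · simp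
  · ext
    simp [MulAut.conjNormal_apply, mul_assoc]

theorem commute_v_δ (h : H) (k : G) {x y : ℤ} (hxy : x ≠ y) : Commute (v h x) (δ k y) := by
  rw [v_eq]
  exact Commute.sum_left _ _ _ fun _ _ =>
    (commute_siteShift_δ _ _ hxy).mul_left (commute_δ_δ _ _ _ _)

theorem commute_v_siteShift (h c : H) {x y : ℤ} (hxy : x ≠ y) :
    Commute (v h x) (siteShift c y) := by
  rw [v_eq]
  exact Commute.sum_left _ _ _ fun _ _ =>
    (commute_siteShift_siteShift _ _ hxy).mul_left (commute_siteShift_δ _ _ hxy.symm).symm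

theorem commute_v_v (h f : H) {x y : ℤ} (hxy : x ≠ y) : Commute (v h x) (v f y) := by
  rw [v_eq f]
  exact Commute.sum_right _ _ _ fun _ _ =>
    (commute_v_siteShift _ _ hxy).mul_right (commute_v_δ _ _ hxy)

theorem commute_v_ρ (h c : H) {x l : ℤ} (hl : x ≤ l) : Commute (v h x) (ρ c l) := by
  rw [v_eq]
  exact Commute.sum_left _ _ _ fun _ _ =>
    (commute_siteShift_ρ _ _ hl).mul_left (commute_ρ_δ _ _ hl).symm

end Normal

/-! ### The projections onto the quotients of neighbouring values -/

theorem commute_w_δ (g k : G) (j y : ℤ) : Commute (w H g j) (δ k y) :=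
  Commute.sum_left _ _ _ fun _ _ => (commute_δ_δ _ _ _ _).mul_left (commute_δ_δ _ _ _ _)

theorem commute_w_w (g k : G) (j y : ℤ) : Commute (w H g j) (w H k y) :=
  Commute.sum_right _ _ _ fun _ _ => (commute_w_δ _ _ _ _).mul_right (commute_w_δ _ _ _ _)

/-- The strict inequality puts both end points `j` and `j + 1` to the left of the half-integer `l +
1/2`. -/
theorem commute_w_ρ (g : G) (c : H) {j l : ℤ} (hl : j < l) : Commute (w H g j) (ρ c l) :=
  Commute.sum_left _ _ _ fun _ _ =>
    ((commute_ρ_δ _ _ hl.le).mul_right (commute_ρ_δ _ _ (by omega))).symm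

/-- Once the value at `j` is known to be `k`, prescribing the quotient `g` amounts to prescribing
the value `kg` at `j + 1`. -/
theorem δ_mul_w (k g : G) (j : ℤ) : δ k j * w H g j = δ k j * δ (k * g) (j + 1) := by
  classical
  simp only [w, Finset.mul_sum, ← mul_assoc, δ_mul_δ, ite_mul, zero_mul]
  rw [Finset.sum_ite_eq, if_pos (Finset.mem_univ _)]

theorem w_mul_δ (k g : G) (j : ℤ) : w H g j * δ k j = δ (k * g) (j + 1) * δ k j := by
  rw [(commute_w_δ _ _ _ _).eq, δ_mul_w, isFieldRep.δ_comm]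

theorem sum_w (j : ℤ) : ∑ g, w H g j = 1 := by
  refine ext_mul_δ j fun k => ?_
  rw [Finset.sum_mul, one_mul]
  simp only [w_mul_δ]
  have : ∑ g, (δ (k * g) (j + 1) : FieldAlgebra H) = ∑ g, δ g (j + 1) :=
    Fintype.sum_equiv (Equiv.mulLeft k) _ _ fun _ => rfl
  rw [← Finset.sum_mul, this, isFieldRep.sum_δ, one_mul]

theorem w_mul_w [DecidableEq G] (g g' : G) (j : ℤ) :
    w H g j * w H g' j = if g = g' then w H g j else 0 := by
  refine ext_mul_δ j fun k => ?_
  rw [mul_assoc, w_mul_δ, (commute_δ_δ _ _ _ _).eq, ← mul_assoc, w_mul_δ, mul_assoc,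
    (commute_δ_δ _ _ _ _).eq, ← mul_assoc, δ_mul_δ]
  simp only [mul_right_inj]
  split_ifs
  · rw [w_mul_δ]
  · rw [zero_mul]

theorem star_w (g : G) (j : ℤ) : star (w H g j) = w H g j := by
  rw [w, star_sum]
  refine Finset.sum_congr rfl fun k _ => ?_
  rw [star_mul, star_δ, star_δ, isFieldRep.δ_comm]

/-! ### The mixed relations, matching the twisting maps -/

section Normal
variable [H.Normal]

theorem commute_v_w (h : H) (g : G) {x j : ℤ} (h₁ : x ≠ j) (h₂ : x ≠ j + 1) :
    Commute (v h x) (w H g j) :=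
  Commute.sum_right _ _ _ fun _ _ => (commute_v_δ _ _ h₁).mul_right (commute_v_δ _ _ h₂)

/-- Right translation of `σ(x)` by `h⁻¹` multiplies the quotient `σ(x)⁻¹σ(x+1)` by `h` from the
left, so it equals `g` afterwards exactly if it was `h⁻¹g` before. This is the relation of
`twistHG`. -/
theorem w_mul_v_left (h : H) (g : G) (x : ℤ) :
    w H g x * v h x = v h x * w H ((h : G)⁻¹ * g) x := by
  rw [w, Finset.sum_mul, w, Finset.mul_sum]
  refine Fintype.sum_equiv (Equiv.mulRight (h : G)) _ _ fun k => ?_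
  rw [mul_assoc, ← (commute_v_δ h _ (by omega)).eq, ← mul_assoc, δ_mul_v]
  simp [mul_assoc]

/-- Here the right end point is translated, so the quotient `g` becomes `gh⁻¹`. This is the relation
of `twistGH`. -/
theorem v_mul_w_right (h : H) (g : G) (x : ℤ) :
    v h (x + 1) * w H g x = w H (g * (h : G)⁻¹) x * v h (x + 1) := by
  rw [w, Finset.mul_sum, w, Finset.sum_mul]
  refine Finset.sum_congr rfl fun k _ => ?_
  rw [← mul_assoc, (commute_v_δ h _ (by omega)).eq, mul_assoc, v_mul_δ_comm]
  simp [mul_assoc]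

end Normal

/-! ### Invariance -/

section Invariance
variable [H.Normal]
open Classical

/-- The action grades the fields by `H`, and under `g` the two factors have the degrees `gcg⁻¹` and
its inverse. Only one term of the coproduct survives, and the total degree is trivial. -/
theorem γ_siteShift (h : H) (g : G) (c : H) (x : ℤ) :
    γ h g (siteShift c x) = if h = 1 then siteShift (conj g c) x else 0 := by
  let _ : Fintype H := Fintype.ofFinite H
  rw [siteShift, γ_mul, Finset.sum_eq_single (conj g c)]
  · rw [γ_ρ, if_pos rfl, γ_ρ, conj_inv]
    simp only [mul_eq_left, siteShift]
    split_ifs with e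
    · rw [e, mul_one]
    · rw [mul_zero]
  · intro t _ ht
    rw [γ_ρ, if_neg ht, zero_mul]
  · simp

/-- Multiplication by an element of degree one. -/
theorem γ_mul_of_neutral {a a' : FieldAlgebra H} {g : G}
    (ha : ∀ h, γ h g a = if h = 1 then a' else 0) (h : H) (b : FieldAlgebra H) :
    γ h g (a * b) = a' * γ h g b := by
  let _ : Fintype H := Fintype.ofFinite H
  rw [γ_mul, Finset.sum_eq_single 1]
  · rw [ha, if_pos rfl, inv_one, one_mul]
  · intro t _ ht
    rw [ha, if_neg ht, zero_mul]
  · simp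

/-- Each summand has trivial degree, and the action of `g` sends the summand with index `k` to the
one with index `gk`. The sum over the whole group is therefore fixed; the same reindexing works for
`w`. -/
theorem v_mem_observable (h : H) (x : ℤ) : v h x ∈ observable H := by
  rw [mem_observable, invariant_iff]
  intro t g
  rw [v_eq, map_sum]
  simp only [γ_mul_of_neutral fun t => γ_siteShift t g _ x, γ_δ, mul_ite, mul_zero]
  split_ifs
  · refine Fintype.sum_equiv (Equiv.mulLeft g) _ _ fun k => ?_
    rw [conj_conj]
    rfl
  · simp

theorem w_mem_observable (g : G) (j : ℤ) : w H g j ∈ observable H := by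
  rw [mem_observable, invariant_iff]
  intro t k
  rw [w, map_sum]
  simp only [γ_mul_of_neutral fun t => γ_δ t k _ j, γ_δ, mul_ite, mul_zero]
  split_ifs
  · refine Fintype.sum_equiv (Equiv.mulLeft k) _ _ fun k => ?_
    simp [mul_assoc]
  · simp

end Invariance

/-! ### The homomorphisms on the factors -/

section Factor
variable [H.Normal]

/-- The homomorphism `h ↦ v_h(x)` on the group algebra. -/
def vHom (x : ℤ) : MonoidAlgebra ℂ H →⋆ₐ[ℂ] FieldAlgebra H where
  __ := MonoidAlgebra.lift ℂ (FieldAlgebra H) H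
    { toFun := fun h => v h x, map_one' := v_one x, map_mul' := fun h f => (v_mul h f x).symm }
  map_star' a := by
    change MonoidAlgebra.lift ℂ _ H _ _ = star (MonoidAlgebra.lift ℂ _ H _ _)
    induction a using MonoidAlgebra.induction_linear with
    | zero => simp
    | add a b ha hb => rw [star_add, map_add, map_add, star_add, ha, hb]
    | single h c => simp [star_single, star_v]

theorem vHom_single (x : ℤ) (h : H) (c : ℂ) : vHom x (MonoidAlgebra.single h c) = c • v h x := by
  change MonoidAlgebra.lift ℂ _ H _ _ = _
  simp

variable (H) in
/-- The homomorphism `δ_g ↦ w_g(j)` on the algebra of functions. -/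
def wHom (j : ℤ) : (G → ℂ) →⋆ₐ[ℂ] FieldAlgebra H where
  toFun f := ∑ g, f g • w H g j
  map_one' := by simp [sum_w]
  map_zero' := by simp
  map_add' f f' := by simp [add_smul, Finset.sum_add_distrib]
  map_mul' f f' := by
    classical
    rw [Finset.sum_mul_sum]
    refine Finset.sum_congr rfl fun g _ => ?_
    simp only [smul_mul_smul, w_mul_w, smul_ite, smul_zero]
    rw [Finset.sum_ite_eq, if_pos (Finset.mem_univ _)]
    rfl
  commutes' r := by
    simp [Algebra.algebraMap_eq_smul_one, ← Finset.smul_sum, sum_w]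
  map_star' f := by
    rw [star_sum]
    exact Finset.sum_congr rfl fun g _ => by rw [star_smul, star_w]; rfl

theorem wHom_apply (j : ℤ) (f : G → ℂ) : wHom H j f = ∑ g, f g • w H g j := rfl

theorem wHom_single [DecidableEq G] (j : ℤ) (g : G) : wHom H j (Pi.single g 1) = w H g j := by
  rw [wHom_apply, Finset.sum_eq_single g]
  · simp
  · intro k _ hk
    simp [hk]
  · simp

variable (H) in
/-- The homomorphisms `h ↦ v_h(x)` and `δ_g ↦ w_g(x + 1/2)` on the factors. -/
def factorHom (x : ℤ) : ∀ b, Factor H b →⋆ₐ[ℂ] FieldAlgebra H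
  | true => vHom x
  | false => wHom H x

variable (H) in
/-- The homomorphism on the factor `A i`. -/
def siteHom (i : ℤ) : SiteAlg H i →⋆ₐ[ℂ] FieldAlgebra H := factorHom H (i / 2) _

/-- Reduces properties of the image of a factor to its generators. It is applied with centralizers,
with the fixed points of an endomorphism, and with the algebras of observables. -/
theorem factorHom_mem {S : Subalgebra ℂ (FieldAlgebra H)} {x : ℤ} {b : Bool}
    (hv : b = true → ∀ h : H, v h x ∈ S) (hw : b = false → ∀ g, w H g x ∈ S) (a : Factor H b) :
    factorHom H x b a ∈ S := by
  cases b with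
  | true =>
    change vHom x (a : MonoidAlgebra ℂ H) ∈ S
    change MonoidAlgebra ℂ H at a
    induction a using MonoidAlgebra.induction_linear with
    | zero => rw [map_zero]; exact zero_mem S
    | add a b ha hb => rw [map_add]; exact add_mem ha hb
    | single h c => rw [vHom_single]; exact S.smul_mem (hv rfl h) c
  | false => exact sum_mem fun g _ => S.smul_mem (hw rfl g) _

theorem intertwines_twistHG (x : ℤ) : (twistHG H).Intertwines (vHom x) (wHom H x) := by
  intro a f
  change wHom H x f * vHom x a = TwistingMap.mulHom (vHom x) (wHom H x) (twistHGLin H (f ⊗ₜ a))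
  induction a using MonoidAlgebra.induction_linear with
  | zero => simp
  | add a b ha hb => rw [map_add, mul_add, ha, hb, TensorProduct.tmul_add, map_add, map_add]
  | single h c =>
    rw [twistHGLin_apply, TwistingMap.mulHom_tmul, vHom_single, mul_smul_comm, smul_mul_assoc,
      wHom_apply, wHom_apply, Finset.sum_mul, Finset.mul_sum]
    congr 1
    refine Fintype.sum_equiv (Equiv.mulLeft (h : G)⁻¹) _ _ fun g => ?_
    simp [w_mul_v_left]

theorem intertwines_twistGH (x : ℤ) : (twistGH H).Intertwines (wHom H x) (vHom (x + 1)) := by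
  intro f a
  change vHom (x + 1) a * wHom H x f =
    TwistingMap.mulHom (wHom H x) (vHom (x + 1)) (twistGHLin H (a ⊗ₜ f))
  induction a using MonoidAlgebra.induction_linear with
  | zero => simp
  | add a b ha hb => rw [map_add, add_mul, ha, hb, TensorProduct.add_tmul, map_add, map_add]
  | single h c =>
    rw [twistGHLin_apply, TwistingMap.mulHom_tmul, vHom_single, mul_smul_comm, smul_mul_assoc,
      wHom_apply, wHom_apply, Finset.sum_mul, Finset.mul_sum]
    congr 1
    refine Fintype.sum_equiv (Equiv.mulRight (h : G)⁻¹) _ _ fun g => ?_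
    simp [v_mul_w_right]

theorem commute_factorHom {x : ℤ} {b : Bool} {a : Factor H b} {c : FieldAlgebra H}
    (hv : b = true → ∀ h : H, Commute c (v h x)) (hw : b = false → ∀ g, Commute c (w H g x)) :
    Commute c (factorHom H x b a) := by
  have := factorHom_mem (S := Subalgebra.centralizer ℂ {c}) (x := x) (b := b)
    (fun e h => by
      rw [Subalgebra.mem_centralizer_iff]
      rintro _ rfl
      exact (hv e h).eq)
    (fun e g => by
      rw [Subalgebra.mem_centralizer_iff]
      rintro _ rfl
      exact (hw e g).eq) a
  exact (Subalgebra.mem_centralizer_iff ℂ).1 this c rfl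

/-- The pair `(x, b)` stands for the factor with index `2x` (a copy of `H`, `b = true`) or `2x + 1`
(a copy of `Ĝ`). The hypothesis says that the indices differ by at least two; then no translated
site is shared with another translation or is an end point of the quotient, and everything commutes.
-/
theorem intertwines_flip {x y : ℤ} {b b' : Bool}
    (h : 2 * x + (cond b 0 1) + 1 < 2 * y + (cond b' 0 1)) :
    (TwistingMap.flip _ _).Intertwines (factorHom H x b) (factorHom H y b') := by
  intro a a'
  rw [TwistingMap.flip_toLin, TwistingMap.mulHom_tmul]
  have key : Commute (factorHom H x b a) (factorHom H y b' a') := by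
    refine commute_factorHom (fun e' h' => ?_) (fun e' g' => ?_)
    · refine (commute_factorHom (fun e h => ?_) (fun e g => ?_)).symm
      · subst e e'; simp at h
        exact commute_v_v _ _ (by omega)
      · subst e e'; simp at h
        exact commute_v_w _ _ (by omega) (by omega)
    · refine (commute_factorHom (fun e h => ?_) (fun e g => ?_)).symm
      · subst e e'; simp at h
        exact (commute_v_w _ _ (by omega) (by omega)).symm
      · exact commute_w_w _ _ _ _
  exact key.eq.symm

theorem intertwines_twist {x y : ℤ} {b b' : Bool}
    (h : 2 * x + (cond b 0 1) + 1 = 2 * y + (cond b' 0 1)) :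
    (twist H b b').Intertwines (factorHom H x b) (factorHom H y b') := by
  cases b <;> cases b' <;> simp only [cond_true, cond_false] at h
  · omega
  · obtain rfl : y = x + 1 := by omega
    exact intertwines_twistGH x
  · obtain rfl : y = x := by omega
    exact intertwines_twistHG _
  · omega

/-- Recovers the index of a factor from its site and its kind, so that linear arithmetic can treat
both parities at once. -/
theorem two_mul_div_add_cond (i : ℤ) : 2 * (i / 2) + (cond (decide (Even i)) 0 1) = i := by
  by_cases h : Even i
  · simp only [h, decide_true, cond_true]
    rw [Int.even_iff] at h
    omega
  · simp only [h, decide_false, cond_false]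
    rw [Int.not_even_iff] at h
    omega

variable (H) in
theorem intertwines_siteHom : (sys H).Intertwines (siteHom H) := by
  intro i j hij
  have hi := two_mul_div_add_cond i
  have hj := two_mul_div_add_cond j
  by_cases h : j = i + 1
  · have : (sys H).R i j hij = twist H _ _ := if_pos h
    rw [this]
    exact intertwines_twist (by omega)
  · have : (sys H).R i j hij = TwistingMap.flip _ _ := if_neg h
    rw [this]
    exact intertwines_flip (by omega)

end Factor

end FieldAlgebra

/-! ### A representation of the field algebra -/

section Lattice
variable {X : Type*}

theorem perm_one_symm_apply (x : X) : (1 : Equiv.Perm X).symm x = x := rfl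

open Classical in
-- The partial sum over `t` is dominated by the partial sum of `f` over `e⁻¹(t)`. This bound gives
-- both square summability of the image and operator norm at most one.
theorem sum_norm_weightedPerm_le (e : Equiv.Perm X) (s : Set X) (f : lp (fun _ : X => ℂ) 2)
    (t : Finset X) :
    ∑ x ∈ t, ‖if x ∈ s then f (e.symm x) else 0‖ ^ (2 : ENNReal).toReal ≤
      ‖f‖ ^ (2 : ENNReal).toReal := by
  refine le_trans ?_ (lp.sum_rpow_le_norm_rpow (by norm_num) f (t.map e.symm.toEmbedding))
  rw [Finset.sum_map]
  refine Finset.sum_le_sum fun x _ => ?_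
  split_ifs
  · exact le_rfl
  · simp

open Classical in
/-- The operator `f ↦ 1_s · (f ∘ e⁻¹)` on `ℓ²(X)`. -/
def weightedPerm (e : Equiv.Perm X) (s : Set X) :
    lp (fun _ : X => ℂ) 2 →L[ℂ] lp (fun _ : X => ℂ) 2 :=
  LinearMap.mkContinuous
    { toFun := fun f => ⟨fun x => if x ∈ s then f (e.symm x) else 0,
        memℓp_gen' (sum_norm_weightedPerm_le e s f)⟩
      map_add' := fun f f' => by
        ext x
        simp only [lp.coeFn_add, Pi.add_apply]
        split_ifs <;> simp
      map_smul' := fun c f => by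
        ext x
        simp only [lp.coeFn_smul, Pi.smul_apply, RingHom.id_apply]
        split_ifs <;> simp } 1 fun f => by
    rw [one_mul]
    exact lp.norm_le_of_forall_sum_le (by norm_num) (norm_nonneg f)
      (sum_norm_weightedPerm_le e s f)

open Classical in
theorem weightedPerm_apply (e : Equiv.Perm X) (s : Set X) (f : lp (fun _ : X => ℂ) 2) (x : X) :
    weightedPerm e s f x = if x ∈ s then f (e.symm x) else 0 := rfl

theorem weightedPerm_mul (e e' : Equiv.Perm X) (s s' : Set X) :
    weightedPerm e s * weightedPerm e' s' = weightedPerm (e * e') (s ∩ e.symm ⁻¹' s') := by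
  classical
  ext f x
  simp only [mul_apply_eq_comp, weightedPerm_apply, Set.mem_inter_iff,
    Set.mem_preimage, ite_and]
  rfl

theorem weightedPerm_one_univ : weightedPerm (1 : Equiv.Perm X) Set.univ = 1 := by
  ext f x
  simp [weightedPerm_apply, perm_one_symm_apply]

theorem weightedPerm_empty (e : Equiv.Perm X) : weightedPerm e ∅ = 0 := by
  ext f x
  simp [weightedPerm_apply]

theorem star_weightedPerm (e : Equiv.Perm X) (s : Set X) :
    star (weightedPerm e s) = weightedPerm e.symm (e ⁻¹' s) := by
  classical
  rw [ContinuousLinearMap.star_eq_adjoint, eq_comm, ContinuousLinearMap.eq_adjoint_iff]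
  intro f g
  -- Substituting `e x` for `x` in the second sum makes the two inner products agree term by term.
  rw [lp.inner_eq_tsum, lp.inner_eq_tsum, 
    ← e.tsum_eq fun x => inner ℂ (f x) (weightedPerm e s g x)]
  refine tsum_congr fun x => ?_
  rw [weightedPerm_apply, weightedPerm_apply, Set.mem_preimage, Equiv.symm_symm,
    Equiv.symm_apply_apply]
  split_ifs <;> simp

end Lattice

/-! ### The representation on square summable functions of configurations -/

section Representation
variable {G : Type u} [Group G]

/-- The configuration with the value `h` to the right of the half-integer `l` and `1` to its
left. -/
def cut (h : G) (l : ℤ) : ℤ → G := fun y => if l < y then h else 1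

theorem cut_mul (h h' : G) (l : ℤ) : cut h l * cut h' l = cut (h * h') l := by
  ext y
  simp only [cut, Pi.mul_apply]
  split_ifs <;> simp

theorem cut_one (l : ℤ) : cut (1 : G) l = 1 := by
  ext y
  simp [cut]

/-- The representation on the configurations `ℤ → G`: `δ_g(x)` is the projection onto the
configurations with the value `g` at `x`, and `ρ_h(l)` is the left translation by `h` to the right
of `l`. -/
theorem isFieldRep_weightedPerm [Fintype G] (H : Subgroup G) : IsFieldRep H
    (fun g x => weightedPerm (1 : Equiv.Perm (ℤ → G)) {σ | σ x = g})
    (fun h l => weightedPerm (Equiv.mulLeft (cut (h : G) l)) Set.univ) where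
  sum_δ x := by
    classical
    ext f σ
    rw [sum_apply, lp.coeFn_sum, Finset.sum_apply]
    simp [weightedPerm_apply, perm_one_symm_apply]
  ρ_one l := by
    rw [Subgroup.coe_one, cut_one, Equiv.mulLeft_one, weightedPerm_one_univ]
  δ_mul_self g x := by
    rw [weightedPerm_mul]
    congr 1
    ext σ
    simp [perm_one_symm_apply]
  δ_mul_ne g₁ g₂ x h := by
    rw [weightedPerm_mul, ← weightedPerm_empty]
    congr 1
    ext σ
    simp only [Set.mem_inter_iff, Set.mem_preimage, Set.mem_ofPred_eq, Set.mem_empty_iff_false,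
      iff_false, not_and]
    rintro rfl e
    exact h e
  ρ_mul h₁ h₂ l := by
    rw [weightedPerm_mul, Set.preimage_univ, Set.inter_self, ← Equiv.mulLeft_mul, cut_mul,
      Subgroup.coe_mul]
  δ_comm g₁ g₂ x x' := by
    rw [weightedPerm_mul, weightedPerm_mul]
    congr 1
    ext σ
    simp [perm_one_symm_apply, and_comm]
  ρ_δ_lt h g l x hl := by
    rw [weightedPerm_mul, weightedPerm_mul, one_mul, mul_one]
    congr 1
    ext σ
    simp [cut, hl, inv_mul_eq_iff_eq_mul]
  ρ_δ_gt h g l x hl := by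
    rw [weightedPerm_mul, weightedPerm_mul, one_mul, mul_one]
    congr 1
    ext σ
    simp [cut, hl.not_gt]
  ρ_ρ_gt h₁ h₂ l l' hl := by
    rw [weightedPerm_mul, weightedPerm_mul, Set.preimage_univ, Set.preimage_univ,
      ← Equiv.mulLeft_mul, ← Equiv.mulLeft_mul]
    congr 2
    ext y
    simp only [cut, Pi.mul_apply]
    split_ifs
    · simp [mul_assoc]
    · omega
    · simp
    · simp
  ρ_ρ_lt h₁ h₂ l l' hl := by
    rw [weightedPerm_mul, weightedPerm_mul, Set.preimage_univ, Set.preimage_univ,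
      ← Equiv.mulLeft_mul, ← Equiv.mulLeft_mul]
    congr 2
    ext y
    simp only [cut, Pi.mul_apply]
    split_ifs
    · simp [mul_assoc]
    · simp
    · omega
    · simp

/-- A presentation by generators and relations could collapse; the representation on configurations
shows that it does not. This is needed for the complex numbers to embed as scalars, the starting
point of all injectivity statements. -/
instance [Fintype G] (H : Subgroup G) : Nontrivial (FieldAlgebra H) := by
  classical
  let π : LocalField H →⋆ₐ[ℂ] _ := LocalField.starLift (isFieldRep_weightedPerm H)
    (fun g x => by rw [star_weightedPerm]; rfl)
    (fun h l => by
      rw [star_weightedPerm, Equiv.mulLeft_symm, Set.preimage_univ]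
      congr 2
      ext y
      simp only [cut, Pi.inv_apply]
      split_ifs <;> simp)
  refine ⟨0, 1, fun h => ?_⟩
  have h1 := congrArg (Envelope.lift π) h
  rw [map_zero, map_one] at h1
  -- The coefficient of a basis vector at its own configuration tells the identity from zero.
  have h2 := congrArg (fun T => T (lp.single 2 (1 : ℤ → G) (1 : ℂ)) 1) h1
  simp at h2

end Representation

/-! ### Injectivity on the local algebras -/

namespace FieldAlgebra
variable {G : Type u} [Group G] [Fintype G] {H : Subgroup G}

/-- The fields `ρ` multiply values from the left, which commutes with multiplying the value at one
site from the right. So the `ρ` can be kept while the `δ(j)` are relabelled. -/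
theorem isFieldRep_siteTranslate (j : ℤ) (s : G) : IsFieldRep H
    (fun g x => (δ (if x = j then g * s else g) x : FieldAlgebra H)) ρ where
  sum_δ x := by
    by_cases e : x = j
    · simp only [if_pos e]
      rw [← isFieldRep.sum_δ x]
      exact Fintype.sum_equiv (Equiv.mulRight s) _ _ fun _ => rfl
    · simp only [if_neg e]
      exact isFieldRep.sum_δ x
  ρ_one := isFieldRep.ρ_one
  δ_mul_self g x := isFieldRep.δ_mul_self _ x
  δ_mul_ne g₁ g₂ x h := isFieldRep.δ_mul_ne _ _ x (by split_ifs <;> simpa using h)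
  ρ_mul := isFieldRep.ρ_mul
  δ_comm g₁ g₂ x x' := isFieldRep.δ_comm _ _ x x'
  ρ_δ_lt h g l x hl := by
    rw [isFieldRep.ρ_δ_lt _ _ _ _ hl]
    split_ifs <;> simp [mul_assoc]
  ρ_δ_gt h g l x hl := isFieldRep.ρ_δ_gt _ _ _ _ hl
  ρ_ρ_gt := isFieldRep.ρ_ρ_gt
  ρ_ρ_lt := isFieldRep.ρ_ρ_lt

variable (H) in
/-- The endomorphism of the field algebra given by a right translation at the site `j`. -/
def siteTranslate (j : ℤ) (s : G) : FieldAlgebra H →⋆ₐ[ℂ] FieldAlgebra H :=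
  Envelope.lift (LocalField.starLift (isFieldRep_siteTranslate j s) (fun _ _ => star_δ _ _) star_ρ)

theorem siteTranslate_δ (j : ℤ) (s g : G) (x : ℤ) :
    siteTranslate H j s (δ g x) = δ (if x = j then g * s else g) x := by
  rw [siteTranslate, δ, Envelope.lift_of, LocalField.starLift_δ]

theorem siteTranslate_ρ (j : ℤ) (s : G) (h : H) (l : ℤ) :
    siteTranslate H j s (ρ h l) = ρ h l := by
  rw [siteTranslate, ρ, Envelope.lift_of, LocalField.starLift_ρ, ρ]

theorem siteTranslate_w {j i : ℤ} (h₁ : i ≠ j) (h₂ : i + 1 ≠ j) (s g : G) :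
    siteTranslate H j s (w H g i) = w H g i := by
  simp only [w, map_sum, map_mul, siteTranslate_δ, if_neg h₁, if_neg h₂]

/-- Orthogonality of the projections isolates `w_g(j) c_g = 0`. Fixing the value `k` at `j` gives
`δ_k(j) δ_{kg}(j+1) c_g = 0`, and translating the site `j` replaces `δ_k(j)` by any `δ_{ks}(j)`
without touching the rest. Summing over `s` and then over `k` removes both projections. -/
theorem eq_zero_of_sum_w_mul {j : ℤ} {c : G → FieldAlgebra H}
    (hc : ∀ g s, siteTranslate H j s (c g) = c g) (h : ∑ g, w H g j * c g = 0) (g : G) :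
    c g = 0 := by
  classical
  have h1 : w H g j * c g = 0 := by
    have := congrArg (w H g j * ·) h
    simpa only [Finset.mul_sum, ← mul_assoc, w_mul_w, ite_mul, zero_mul, mul_zero,
      Finset.sum_ite_eq, Finset.mem_univ, if_true] using this
  have h2 : ∀ k s, δ (k * s) j * (δ (k * g) (j + 1) * c g) = 0 := by
    intro k s
    have := congrArg (fun a => siteTranslate H j s (δ k j * a)) h1
    simpa [← mul_assoc, δ_mul_w, siteTranslate_δ, hc] using this
  have h3 : ∀ k, δ (k * g) (j + 1) * c g = 0 := by
    intro k
    rw [← one_mul (δ (k * g) (j + 1) * c g), ← isFieldRep.sum_δ j, Finset.sum_mul]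
    refine Finset.sum_eq_zero fun s _ => ?_
    simpa using h2 k (k⁻¹ * s)
  rw [← one_mul (c g), ← isFieldRep.sum_δ (j + 1), Finset.sum_mul]
  refine Finset.sum_eq_zero fun k _ => ?_
  simpa using h3 (k * g⁻¹)

variable [H.Normal]

theorem siteTranslate_v {j x : ℤ} (hx : x ≠ j) (s : G) (h : H) :
    siteTranslate H j s (v h x) = v h x := by
  simp only [v, map_sum, map_mul, siteTranslate_δ, siteTranslate_ρ, if_neg hx]

/-- Since `v_h(x)` sends the value `k` to `kh⁻¹`, compressing the sum between `δ_{kh₀⁻¹}(x)` and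
`δ_k(x)` leaves only the term with `h = h₀`, because the coefficients preserve the value at `x`.
Letting `k` vary gives `v_{h₀}(x) c_{h₀} = 0`, and `v_{h₀}(x)` is invertible. -/
theorem eq_zero_of_sum_v_mul [Fintype H] {x : ℤ} {c : H → FieldAlgebra H}
    (hc : ∀ h k, Commute (c h) (δ k x)) (h : ∑ h, v h x * c h = 0) (h₀ : H) : c h₀ = 0 := by
  classical
  have h1 : v h₀ x * c h₀ = 0 := by
    refine ext_mul_δ x fun k => ?_
    have := congrArg (δ (k * (h₀ : G)⁻¹) x * · * δ k x) h
    simp only [Finset.mul_sum, Finset.sum_mul, mul_assoc, (hc _ k).eq, mul_zero, zero_mul] at this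
    rw [Finset.sum_eq_single h₀] at this
    · rw [mul_assoc, (hc h₀ k).eq, zero_mul, ← this, ← mul_assoc, ← mul_assoc, ← mul_assoc,
        mul_assoc (δ _ x), v_mul_δ_comm, ← mul_assoc, isFieldRep.δ_mul_self]
    · intro f _ hf
      rw [← mul_assoc (v f x), v_mul_δ_comm, ← mul_assoc, ← mul_assoc,
        isFieldRep.δ_mul_ne _ _ _ (by simpa using hf.symm), zero_mul, zero_mul]
    · simp
  rw [← one_mul (c h₀), ← v_one x, ← inv_mul_cancel h₀, ← v_mul, mul_assoc, h1, mul_zero]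

/-- Combines the two independence statements. The condition on the coefficients depends on the kind
of the factor, and in either case it holds for all that is generated by the factors further to the
right. -/
theorem exists_basis_factor (x : ℤ) (b : Bool) :
    ∃ (ι : Type u) (_ : Fintype ι) (𝓑 : Module.Basis ι ℂ (Factor H b)),
      ∀ c : ι → FieldAlgebra H, (b = true → ∀ i k, Commute (c i) (δ k x)) →
        (b = false → ∀ i s, siteTranslate H x s (c i) = c i) →
        ∑ i, factorHom H x b (𝓑 i) * c i = 0 → ∀ i, c i = 0 := by
  cases b with
  | true =>
    let _ : Fintype H := Fintype.ofFinite H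
    refine ⟨H, inferInstance, Module.Basis.ofRepr (M := MonoidAlgebra ℂ H)
      (MonoidAlgebra.coeffLinearEquiv ℂ), fun c hc _ h => eq_zero_of_sum_v_mul (hc rfl) ?_⟩
    rw [← h]
    refine Finset.sum_congr rfl fun i _ => ?_
    congr 1
    refine Eq.trans ?_ (congrArg (vHom x) (rfl : (MonoidAlgebra.single i 1 : MonoidAlgebra ℂ H) = _))
    rw [vHom_single, one_smul]
  | false =>
    classical
    refine ⟨G, inferInstance, Pi.basisFun ℂ G, fun c _ hc h => eq_zero_of_sum_w_mul (hc rfl) ?_⟩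
    rw [← h]
    refine Finset.sum_congr rfl fun i _ => ?_
    congr 1
    change _ = wHom H x (Pi.basisFun ℂ G i)
    rw [Pi.basisFun_apply, wHom_single]

/-- Scalars are admissible as coefficients in `exists_basis_factor`, and they embed into the field
algebra because it is nontrivial. -/
theorem factorHom_injective (x : ℤ) (b : Bool) : Function.Injective (factorHom H x b) := by
  refine (injective_iff_map_eq_zero _).2 fun a ha => ?_
  obtain ⟨ι, _, 𝓑, h⟩ := exists_basis_factor (H := H) x b
  have := h (fun i => algebraMap ℂ _ (𝓑.repr a i)) (fun _ _ _ => Algebra.commutes _ _)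
    (fun _ _ _ => AlgHomClass.commutes _ _) (by
      conv_rhs => rw [← ha, ← 𝓑.sum_repr a, map_sum]
      refine Finset.sum_congr rfl fun i _ => ?_
      rw [map_smul, ← Algebra.commutes, ← Algebra.smul_def])
  refine 𝓑.ext_elem fun i => ?_
  rw [map_zero, Finsupp.zero_apply]
  exact (algebraMap ℂ (FieldAlgebra H)).injective ((this i).trans (map_zero _).symm)

/-- Induction by splitting off the leftmost factor: its basis is independent over the image of the
remaining product, on which injectivity is already known. -/
theorem iterLift_injective (k : ℕ) (n : ℤ) :
    Function.Injective (TwistSystem.iterLift (intertwines_siteHom H) k n) := by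
  induction k generalizing n with
  | zero => exact factorHom_injective _ _
  | succ k ih =>
    obtain ⟨ι, _, 𝓑, h⟩ := exists_basis_factor (H := H) (n / 2) (decide (Even n))
    have hn := two_mul_div_add_cond n
    refine TwistingMap.lift_injective 𝓑 _
      ((TwistSystem.iterStageLift (intertwines_siteHom H) k (n + 1)).intertwines n (lt_add_one n))
      (ih (n + 1)) fun c hc => h _ ?_ ?_ hc
    -- For even `n` the remaining translations act on sites to the right of `n / 2`, and the
    -- projections `w` commute with all `δ`.
    · intro e i k'
      rw [e, cond_true] at hn
      have := TwistSystem.iterLift_mem (intertwines_siteHom H)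
        (Subalgebra.centralizer ℂ {(δ k' (n / 2) : FieldAlgebra H)}) k (n + 1)
        (fun i hi _ a => factorHom_mem (fun e' h => ?_) (fun _ g => ?_) a) (c i)
      · exact ((Subalgebra.mem_centralizer_iff ℂ).1 this _ rfl).symm
      · rw [Subalgebra.mem_centralizer_iff]
        rintro _ rfl
        have hi' := two_mul_div_add_cond i
        rw [e', cond_true] at hi'
        exact (commute_v_δ _ _ (by omega)).eq.symm
      · rw [Subalgebra.mem_centralizer_iff]
        rintro _ rfl
        exact (commute_w_δ _ _ _ _).eq.symm
    -- For odd `n` the remaining factors involve `δ` only at sites to the right of `n / 2`, so the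
    -- translation at `n / 2` fixes them.
    · intro e i s
      rw [e, cond_false] at hn
      refine TwistSystem.iterLift_mem (intertwines_siteHom H)
        (AlgHom.equalizer (siteTranslate H (n / 2) s).toAlgHom (AlgHom.id ℂ _)) k (n + 1)
        (fun i hi _ a => factorHom_mem (fun _ h => ?_) (fun e' g => ?_) a) (c i)
      · exact siteTranslate_v (by omega) s h
      · have hi' := two_mul_div_add_cond i
        rw [e', cond_false] at hi'
        exact siteTranslate_w (by omega) (by omega) s g

end FieldAlgebra

/-! ### The conditional expectation onto the observable algebra -/

/-- The elements which map a subspace into itself by left multiplication. -/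
def leftStabilizer {A : Type*} [Ring A] [Algebra ℂ A] (S : Submodule ℂ A) : Subalgebra ℂ A where
  carrier := {b | ∀ s ∈ S, b * s ∈ S}
  mul_mem' := fun ha hb s hs => by rw [mul_assoc]; exact ha _ (hb s hs)
  add_mem' := fun ha hb s hs => by rw [add_mul]; exact S.add_mem (ha s hs) (hb s hs)
  algebraMap_mem' := fun c s hs => by rw [← Algebra.smul_def]; exact S.smul_mem c hs

theorem mem_leftStabilizer_span {A : Type*} [Ring A] [Algebra ℂ A] {X : Set A} {b : A}
    (h : ∀ s ∈ X, b * s ∈ Submodule.span ℂ X) : b ∈ leftStabilizer (Submodule.span ℂ X) := by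
  intro s hs
  induction hs using Submodule.span_induction with
  | mem s hs => exact h s hs
  | zero => rw [mul_zero]; exact zero_mem _
  | add s t _ _ hs ht => rw [mul_add]; exact add_mem hs ht
  | smul c s _ hs => rw [mul_smul_comm]; exact Submodule.smul_mem _ c hs

namespace FieldAlgebra
variable {G : Type u} [Group G] [Fintype G] {H : Subgroup G} [H.Normal]

theorem v_mem_localObservable {n m x : ℤ} (h₁ : n ≤ x) (h₂ : x ≤ m) (h : H) :
    v h x ∈ localObservable H n m :=
  StarAlgebra.subset_adjoin ℂ _ (Or.inl ⟨h, x, h₁, h₂, rfl⟩)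

theorem w_mem_localObservable {n m j : ℤ} (h₁ : n ≤ j) (h₂ : j < m) (g : G) :
    w H g j ∈ localObservable H n m :=
  StarAlgebra.subset_adjoin ℂ _ (Or.inr ⟨g, j, h₁, h₂, rfl⟩)

theorem localObservable_le_observable (n m : ℤ) : localObservable H n m ≤ observable H := by
  refine StarAlgebra.adjoin_le ?_
  rintro _ (⟨h, x, -, -, rfl⟩ | ⟨g, j, -, -, rfl⟩)
  · exact v_mem_observable h x
  · exact w_mem_observable g j

/-- The generators act on sites up to `m` only, all of which lie to the left of the half-integer `m
+ 1/2`. -/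
theorem commute_ρ_of_mem_localObservable (c : H) {n m : ℤ} {a : FieldAlgebra H}
    (ha : a ∈ localObservable H n m) : Commute a (ρ c m) := by
  have : localObservable H n m ≤ StarSubalgebra.centralizer ℂ {(ρ c m : FieldAlgebra H)} := by
    refine StarAlgebra.adjoin_le ?_
    rintro _ (⟨h, x, -, hx, rfl⟩ | ⟨g, j, -, hj, rfl⟩) <;>
      refine (StarSubalgebra.mem_centralizer_iff ℂ).2 ?_ <;> rintro _ rfl <;> rw [star_ρ]
    · exact ⟨(commute_v_ρ h _ hx).eq.symm, (commute_v_ρ h _ hx).eq.symm⟩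
    · exact ⟨(commute_w_ρ g _ hj).eq.symm, (commute_w_ρ g _ hj).eq.symm⟩
  exact ((StarSubalgebra.mem_centralizer_iff ℂ).1 (this ha) _ rfl).1.symm

/-! ### Local fields as sums of products `δ_g(n) a ρ_h(m + 1/2)` -/

variable (H) in
/-- The elements `δ_g(n) a ρ_h(m + 1/2)` with a local observable `a`. -/
def windowSet (n m : ℤ) : Set (FieldAlgebra H) :=
  {F | ∃ (g : G) (h : H), ∃ a ∈ localObservable H n m, F = δ g n * a * ρ h m}

variable (H) in
/-- The field operators which leave the span of `windowSet H n m` invariant. -/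
def windowAlgebra (n m : ℤ) : Subalgebra ℂ (FieldAlgebra H) :=
  leftStabilizer (Submodule.span ℂ (windowSet H n m))

theorem δ_left_mem_windowAlgebra (k : G) (n m : ℤ) : δ k n ∈ windowAlgebra H n m := by
  classical
  refine mem_leftStabilizer_span ?_
  rintro _ ⟨g, h, a, ha, rfl⟩
  rw [← mul_assoc, ← mul_assoc, δ_mul_δ]
  split_ifs with e
  · exact Submodule.subset_span ⟨k, h, a, ha, rfl⟩
  · rw [zero_mul, zero_mul]
    exact zero_mem _

/-- The field `ρ_c(m + 1/2)` commutes with everything to its right in the product and is absorbed by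
the last factor. -/
theorem ρ_right_mem_windowAlgebra (c : H) {n m : ℤ} (hnm : n ≤ m) :
    ρ c m ∈ windowAlgebra H n m := by
  refine mem_leftStabilizer_span ?_
  rintro _ ⟨g, h, a, ha, rfl⟩
  have := ((commute_ρ_δ c g hnm).mul_right (commute_ρ_of_mem_localObservable c ha).symm).eq
  rw [← mul_assoc, this, mul_assoc, isFieldRep.ρ_mul]
  exact Submodule.subset_span ⟨g, c * h, a, ha, rfl⟩

theorem v_mem_windowAlgebra (f : H) {n m x : ℤ} (h₁ : n ≤ x) (h₂ : x ≤ m) :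
    v f x ∈ windowAlgebra H n m := by
  refine mem_leftStabilizer_span ?_
  rintro _ ⟨g, h, a, ha, rfl⟩
  have hm := mul_mem (v_mem_localObservable h₁ h₂ f) ha
  -- Only a translation at the left end `x = n` changes the value there; otherwise `g' = g`. The
  -- translation is then absorbed by the local observable.
  obtain ⟨g', hg'⟩ : ∃ g', v f x * δ g n = δ g' n * v f x := by
    rcases h₁.eq_or_lt with rfl | h₁
    · exact ⟨_, v_mul_δ_comm f g n⟩
    · exact ⟨g, (commute_v_δ f g h₁.ne').eq⟩
  rw [← mul_assoc, ← mul_assoc, hg', mul_assoc (δ g' n)]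
  exact Submodule.subset_span ⟨g', h, _, hm, rfl⟩

theorem w_mem_windowAlgebra (k : G) {n m j : ℤ} (h₁ : n ≤ j) (h₂ : j < m) :
    w H k j ∈ windowAlgebra H n m := by
  refine mem_leftStabilizer_span ?_
  rintro _ ⟨g, h, a, ha, rfl⟩
  rw [← mul_assoc, ← mul_assoc, (commute_w_δ k g j n).eq, mul_assoc (δ g n)]
  exact Submodule.subset_span ⟨g, h, _, mul_mem (w_mem_localObservable h₁ h₂ k) ha, rfl⟩

/-- The value at `x + 1` is determined by the value at `x` and the quotient of the two: `δ_k(x+1)`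
is the sum of `w_{g⁻¹k}(x + 1/2) δ_g(x)`. So all values are reached from the left end. -/
theorem δ_mem_windowAlgebra (k : G) {n m x : ℤ} (h₁ : n ≤ x) (h₂ : x ≤ m) :
    δ k x ∈ windowAlgebra H n m := by
  induction x, h₁ using Int.leInduction generalizing k with
  | base => exact δ_left_mem_windowAlgebra k n m
  | succ x hx ih =>
    have : (δ k (x + 1) : FieldAlgebra H) = ∑ g, w H (g⁻¹ * k) x * δ g x := by
      simp only [w_mul_δ, mul_inv_cancel_left]
      rw [← Finset.mul_sum, isFieldRep.sum_δ, mul_one]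
    rw [this]
    exact sum_mem fun g _ => mul_mem (w_mem_windowAlgebra _ hx (by omega)) (ih g (by omega))

/-- Inverts `v_eq`: at the value `g`, the left translation by `c` is the right translation by
`g⁻¹cg`, that is, `v_h(x)` with `h = g⁻¹c⁻¹g`. -/
theorem siteShift_mem_windowAlgebra (c : H) {n m x : ℤ} (h₁ : n ≤ x) (h₂ : x ≤ m) :
    siteShift c x ∈ windowAlgebra H n m := by
  have : siteShift c x = ∑ g : G, v (conj g⁻¹ c⁻¹) x * δ g x := by
    simp only [v_mul_δ, ← conj_inv, conj_conj, inv_inv, mul_inv_cancel]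
    rw [← mul_one (siteShift c x), ← isFieldRep.sum_δ x, Finset.mul_sum]
    refine Finset.sum_congr rfl fun g _ => ?_
    rw [conj, map_one, MulAut.one_apply]
  rw [this]
  exact sum_mem fun g _ => mul_mem (v_mem_windowAlgebra _ h₁ h₂) (δ_mem_windowAlgebra g h₁ h₂)

/-- Translating everything to the right of `l - 1/2` means translating the site `l` and everything
to the right of `l + 1/2`. So all cuts are reached from the right end of the window. -/
theorem ρ_mem_windowAlgebra (c : H) {n m l : ℤ} (h₁ : n ≤ l) (h₂ : l ≤ m) :
    ρ c l ∈ windowAlgebra H n m := by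
  induction l, h₂ using Int.leInductionDown with
  | base => exact ρ_right_mem_windowAlgebra c h₁
  | pred l hl ih =>
    rw [← siteShift_mul_ρ]
    exact mul_mem (siteShift_mem_windowAlgebra c (by omega) hl) (ih (by omega))

/-- Asking for all windows from some size on lets two elements share a window, with no need to
compare the algebras of different windows. -/
theorem exists_mem_windowAlgebra (a : LocalField H) :
    ∃ N : ℕ, ∀ K : ℕ, N ≤ K → Envelope.of _ a ∈ windowAlgebra H (-K) K := by
  induction a using LocalField.induction with
  | hδ g x => exact ⟨x.natAbs, fun K hK => δ_mem_windowAlgebra g (by omega) (by omega)⟩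
  | hρ h l => exact ⟨l.natAbs, fun K hK => ρ_mem_windowAlgebra h (by omega) (by omega)⟩
  | hmap c =>
    refine ⟨0, fun K _ => ?_⟩
    rw [show Envelope.of (LocalField H) (algebraMap ℂ _ c) = algebraMap ℂ _ c from
      (Envelope.of (LocalField H)).toAlgHom.commutes c]
    exact Subalgebra.algebraMap_mem _ c
  | hadd x y hx hy =>
    obtain ⟨N, hN⟩ := hx
    obtain ⟨N', hN'⟩ := hy
    refine ⟨max N N', fun K hK => ?_⟩
    rw [map_add]
    exact add_mem (hN K (by omega)) (hN' K (by omega))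
  | hmul x y hx hy =>
    obtain ⟨N, hN⟩ := hx
    obtain ⟨N', hN'⟩ := hy
    refine ⟨max N N', fun K hK => ?_⟩
    rw [map_mul]
    exact mul_mem (hN K (by omega)) (hN' K (by omega))

/-- An operator that leaves the span invariant lies in the span, being its own product with `1`. -/
theorem one_mem_span_windowSet (n m : ℤ) : 1 ∈ Submodule.span ℂ (windowSet H n m) := by
  rw [← isFieldRep.sum_δ n]
  refine sum_mem fun g _ => Submodule.subset_span ⟨g, 1, 1, one_mem _, ?_⟩
  rw [isFieldRep.ρ_one, mul_one, mul_one]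

/-! ### Averaging over the group -/

variable (H) in
/-- The conditional expectation `F ↦ |G|⁻¹ ∑ g, (e,g) F` onto the observable algebra. -/
def expectation : FieldAlgebra H →ₗ[ℂ] FieldAlgebra H :=
  (Fintype.card G : ℂ)⁻¹ • ∑ g : G, γ 1 g

theorem expectation_apply (F : FieldAlgebra H) :
    expectation H F = (Fintype.card G : ℂ)⁻¹ • ∑ g : G, γ 1 g F := by
  simp [expectation]

theorem continuous_expectation : Continuous (expectation H) := by
  have : (expectation H : FieldAlgebra H → FieldAlgebra H) =
      fun F => (Fintype.card G : ℂ)⁻¹ • ∑ g : G, γ 1 g F := funext fun F => expectation_apply F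
  rw [this]
  exact Continuous.const_smul (continuous_finsetSum _ fun g _ => continuous_γ 1 g)
    (Fintype.card G : ℂ)⁻¹

theorem expectation_of_mem {F : FieldAlgebra H} (hF : F ∈ observable H) :
    expectation H F = F := by
  rw [mem_observable, invariant_iff] at hF
  simp only [expectation_apply, hF, if_true]
  rw [Finset.sum_const, Finset.card_univ, ← Nat.cast_smul_eq_nsmul ℂ, smul_smul,
    inv_mul_cancel₀ (Nat.cast_ne_zero.2 Fintype.card_ne_zero), one_smul]

/-- On `δ_g(n) a ρ_h(m + 1/2)` the component of trivial degree vanishes unless `h = 1`, and then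
averaging spreads `δ_g(n)` evenly over all values, leaving `|G|⁻¹ a`. -/
theorem expectation_mem_localObservable {n m : ℤ} {F : FieldAlgebra H}
    (hF : F ∈ Submodule.span ℂ (windowSet H n m)) :
    expectation H F ∈ localObservable H n m := by
  classical
  induction hF using Submodule.span_induction with
  | zero => rw [map_zero]; exact zero_mem _
  | add s t _ _ hs ht => rw [map_add]; exact add_mem hs ht
  | smul c s _ hs => rw [map_smul]; exact (localObservable H n m).smul_mem hs c
  | mem F hF =>
    obtain ⟨g, h, a, ha, rfl⟩ := hF
    have ha' := (invariant_iff a).1 (localObservable_le_observable n m ha)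
    -- The first two factors have trivial degree, so the degree of the product is that of `ρ_h`,
    -- namely `khk⁻¹`.
    have key : ∀ k, γ 1 k (δ g n * a * ρ h m) = δ (k * g) n * (if h = 1 then a else 0) := by
      intro k
      rw [mul_assoc, γ_mul_of_neutral fun t => γ_δ t k g n,
        γ_mul_of_neutral fun t => ha' t k, γ_ρ]
      simp only [eq_comm (a := (1 : H)), conj_eq_one]
      split_ifs
      · rw [isFieldRep.ρ_one, mul_one]
      · rw [mul_zero]
    have sum : ∑ k, (δ (k * g) n : FieldAlgebra H) = 1 :=
      (Fintype.sum_equiv (Equiv.mulRight g) _ _ fun _ => rfl).trans (isFieldRep.sum_δ n)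
    simp only [expectation_apply, key]
    rw [← Finset.sum_mul, sum, one_mul]
    refine (localObservable H n m).smul_mem ?_ _
    split_ifs
    · exact ha
    · exact zero_mem _

/-- The local observables are dense in the observable algebra. -/
theorem observable_subset_of_isClosed {S : Set (FieldAlgebra H)} (hS : IsClosed S)
    (h : ∀ n m, n ≤ m → (localObservable H n m : Set (FieldAlgebra H)) ⊆ S) :
    (observable H : Set (FieldAlgebra H)) ⊆ S := by
  intro F hF
  rw [← expectation_of_mem hF]
  -- The averaged operator lies in `S` for every field operator, invariant or not. This is what
  -- allows the passage to the dense local field algebra.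
  clear hF
  induction F using Envelope.induction_on with
  | hp => exact hS.preimage continuous_expectation
  | ih a =>
    obtain ⟨N, hN⟩ := exists_mem_windowAlgebra a
    refine h (-N) N (by omega) (expectation_mem_localObservable ?_)
    have := hN N le_rfl _ (one_mem_span_windowSet _ _)
    rwa [mul_one] at this

end FieldAlgebra

/-! ### The isomorphism -/

/-- An injective `*`-homomorphism is isometric on the image of a finite-dimensional `*`-algebra. -/
theorem norm_map_of_finite {L B C : Type*} [Ring L] [Algebra ℂ L] [StarRing L]
    [Module.Finite ℂ L] [CStarAlgebra B] [CStarAlgebra C] (ι : L →⋆ₐ[ℂ] B) (ψ : B →⋆ₐ[ℂ] C)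
    (h : Function.Injective fun a => ψ (ι a)) (a : L) : ‖ψ (ι a)‖ = ‖ι a‖ := by
  -- The image of `ι` is finite-dimensional, hence closed, hence a C*-algebra on its own, and
  -- injective `*`-homomorphisms of C*-algebras preserve the norm.
  have hfin : FiniteDimensional ℂ (Subalgebra.toSubmodule ι.range.toSubalgebra) :=
    (inferInstance : Module.Finite ℂ ι.toAlgHom.toLinearMap.range)
  have hcl : IsClosed (ι.range : Set B) :=
    (Subalgebra.toSubmodule ι.range.toSubalgebra).closed_of_finiteDimensional
  let _ : CStarAlgebra ι.range := StarSubalgebra.cstarAlgebra ι.range (h_closed := hcl)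
  refine NonUnitalStarAlgHom.norm_map (ψ.comp ι.range.subtype) ?_ ⟨ι a, a, rfl⟩
  rintro ⟨_, a, rfl⟩ ⟨_, b, rfl⟩ hab
  -- Injectivity of the composite already gives equal preimages in `L`; injectivity of `ι` is not
  -- needed separately.
  exact Subtype.ext (congrArg ι (h hab))

namespace FieldAlgebra
variable {G : Type u} [Group G] [Fintype G] {H : Subgroup G}

instance finite_factor : ∀ b, Module.Finite ℂ (Factor H b)
  | true => Module.Finite.equiv
      (MonoidAlgebra.coeffLinearEquiv ℂ : MonoidAlgebra ℂ H ≃ₗ[ℂ] _).symm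
  | false => inferInstanceAs (Module.Finite ℂ (G → ℂ))

variable [H.Normal]

theorem factorHom_basis (x : ℤ) (h : H) (g : G) (b : Bool) :
    factorHom H x b (Factor.basis h g b) = if b then v h x else w H g x := by
  classical
  cases b with
  | true => exact (vHom_single x h 1).trans (one_smul _ _)
  | false =>
    have : Factor.basis h g false = (Pi.single g 1 : G → ℂ) := by rw [Factor.basis]
    exact (congrArg (wHom H x) this).trans (wHom_single x g)

theorem siteHom_basis (i : ℤ) (h : H) (g : G) :
    siteHom H i (Factor.basis h g _) = if Even i then v h (i / 2) else w H g (i / 2) := by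
  refine (factorHom_basis _ _ _ _).trans ?_
  simp only [decide_eq_true_eq]

/-- Brings the product into the form of `iterLift_pure`, with a natural number as index that is cast
inside the function. -/
theorem siteProduct_eq (h : ℤ → H) (g : ℤ → G) (I : NonemptyInterval ℤ) : siteProduct h g I =
    ((List.range ((I.snd - I.fst).toNat + 1)).map fun j : ℕ =>
      siteElement h g (I.fst + (j : ℤ))).prod := by
  simp [siteProduct, ← List.map_eq_flatMap, Function.comp_def]

theorem iterLift_basisTensor (h : ℤ → H) (g : ℤ → G) (I : NonemptyInterval ℤ) :
    TwistSystem.iterLift (intertwines_siteHom H) _ _ (basisTensor h g I) = siteProduct h g I := by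
  rw [basisTensor, TwistSystem.iterLift_pure, siteProduct_eq]
  congr 1
  exact List.map_congr_left fun j _ => siteHom_basis _ _ _

theorem range_iterLift (n m : ℤ) (hnm : 2 * n ≤ 2 * m) :
    Set.range (TwistSystem.iterLift (intertwines_siteHom H)
      ((interval (2 * n) (2 * m) hnm).snd - (interval (2 * n) (2 * m) hnm).fst).toNat
      (interval (2 * n) (2 * m) hnm).fst) = localObservable H n m := by
  change Set.range (TwistSystem.iterLift (intertwines_siteHom H) (2 * m - 2 * n).toNat (2 * n)) = _
  refine Set.Subset.antisymm ?_ ?_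
  · rintro _ ⟨a, rfl⟩
    -- An even index `2x` in `[2n, 2m]` has `n ≤ x ≤ m`, whereas an odd index `2x + 1` has `n ≤ x <
    -- m`; these are the two ranges in `localObservable`.
    refine TwistSystem.iterLift_mem _ (localObservable H n m).toSubalgebra _ _
      (fun i h₁ h₂ a => factorHom_mem (fun e h => ?_) (fun e g => ?_) a) a
    · exact v_mem_localObservable (by omega) (by omega) h
    · have hi := two_mul_div_add_cond i
      rw [e, cond_false] at hi
      exact w_mem_localObservable (by omega) (by omega) g
  · have : localObservable H n m ≤ (TwistSystem.iterLift (intertwines_siteHom H)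
        (2 * m - 2 * n).toNat (2 * n)).range := by
      refine StarAlgebra.adjoin_le ?_
      rintro _ (⟨h, x, h₁, h₂, rfl⟩ | ⟨g, j, h₁, h₂, rfl⟩)
      · have hx := TwistSystem.mem_range_iterLift (intertwines_siteHom H) (2 * m - 2 * n).toNat
          -- The group element `1` is a dummy: at an even index only `h` matters. Below, the roles
          -- are exchanged.
          (2 * n) (2 * x) (by omega) (by omega) (Factor.basis h 1 _)
        rw [siteHom_basis, if_pos (by simp), Int.mul_ediv_cancel_left x two_ne_zero] at hx
        exact hx
      · have hj := TwistSystem.mem_range_iterLift (intertwines_siteHom H) (2 * m - 2 * n).toNat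
          (2 * n) (2 * j + 1) (by omega) (by omega) (Factor.basis 1 g _)
        rw [siteHom_basis, if_neg (by simp), show (2 * j + 1) / 2 = j by omega] at hj
        exact hj
    exact this

/-! ### The homomorphism on the infinite tensor product -/

variable (H) in
/-- The homomorphism from the infinite tensor product to the field algebra. -/
def tensorHom : InfiniteTensor H →⋆ₐ[ℂ] FieldAlgebra H :=
  Envelope.lift (TwistSystem.unionLift (intertwines_siteHom H))

theorem tensorHom_toInfinite (I : NonemptyInterval ℤ) (a : (sys H).Local I) :
    tensorHom H (toInfinite H I a) = TwistSystem.iterLift (intertwines_siteHom H) _ _ a :=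
  Envelope.lift_of _ _

theorem induction_toInfinite {p : InfiniteTensor H → Prop} (hp : IsClosed {a | p a})
    (ih : ∀ I a, p (toInfinite H I a)) (a : InfiniteTensor H) : p a := by
  induction a using Envelope.induction_on with
  | hp => exact hp
  | ih a =>
    obtain ⟨I, a, rfl⟩ := TwistSystem.exists_toUnion a
    exact ih I a

/-- By density it suffices to consider a single local algebra, which is finite-dimensional and on
which the composite is injective. No description of the largest C*-seminorm is needed. -/
theorem norm_tensorHom (a : InfiniteTensor H) : ‖tensorHom H a‖ = ‖a‖ := by
  have hc : Continuous (tensorHom H) := Envelope.continuous_lift _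
  refine induction_toInfinite (isClosed_eq hc.norm continuous_norm) (fun I a => ?_) a
  have : Module.Finite ℂ ((sys H).Local I) := TwistSystem.finite_iter _ _
  refine norm_map_of_finite (toInfinite H I) (tensorHom H) ?_ a
  simp only [tensorHom_toInfinite]
  exact iterLift_injective _ _

theorem tensorHom_mem (a : InfiniteTensor H) : tensorHom H a ∈ observable H := by
  have hc : Continuous (tensorHom H) := Envelope.continuous_lift _
  refine induction_toInfinite (isClosed_observable.preimage hc) (fun I a => ?_) a
  change tensorHom H (toInfinite H I a) ∈ observable H
  rw [tensorHom_toInfinite]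
  exact TwistSystem.iterLift_mem _ (observable H).toSubalgebra _ _ (fun i _ _ a =>
    factorHom_mem (fun _ h => v_mem_observable h _) (fun _ g => w_mem_observable g _) a) a

theorem tensorHom_surjective {F : FieldAlgebra H} (hF : F ∈ observable H) :
    ∃ a, tensorHom H a = F := by
  have hi : Isometry (tensorHom H) := AddMonoidHomClass.isometry_of_norm _ norm_tensorHom
  -- An isometry from a complete space has closed range, so containing the local observables is
  -- enough.
  refine observable_subset_of_isClosed hi.isClosedEmbedding.isClosed_range (fun n m h => ?_) hF
  rw [← range_iterLift n m (by omega)]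
  rintro _ ⟨a, rfl⟩
  exact ⟨toInfinite H _ a, tensorHom_toInfinite _ a⟩

variable (H) in
/-- The isomorphism from the infinite tensor product onto the observable algebra. -/
def tensorEquiv : InfiniteTensor H ≃⋆ₐ[ℂ] observable H :=
  StarAlgEquiv.ofBijective ((tensorHom H).codRestrict (observable H) tensorHom_mem) (by
    constructor
    · intro a b h
      have hi : Isometry (tensorHom H) := AddMonoidHomClass.isometry_of_norm _ norm_tensorHom
      exact hi.injective (congrArg Subtype.val h)
    · rintro ⟨F, hF⟩
      obtain ⟨a, ha⟩ := tensorHom_surjective hF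
      exact ⟨a, Subtype.ext ha⟩)

theorem coe_tensorEquiv (a : InfiniteTensor H) : (tensorEquiv H a : FieldAlgebra H) =
    tensorHom H a := rfl

end FieldAlgebra

end GSpin

end

open GSpin GSpin.FieldAlgebra in
theorem theorem3p1 {G : Type*} [Group G] [Fintype G] (H : Subgroup G) [H.Normal] :
    ∃ Φ : InfiniteTensor H ≃⋆ₐ[ℂ] observable H,
      (∀ a, ‖Φ a‖ = ‖a‖) ∧
      (∀ (h f : H) (g : G),
        (Φ (toInfinite H (interval 0 2 (by norm_num))
          (basisTensor (fun x => if x = 0 then h else f) (fun _ => g) _)) : FieldAlgebra H) =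
        v h 0 * w H g 0 * v f 1) ∧
      (∀ (I : NonemptyInterval ℤ) (h : ℤ → H) (g : ℤ → G),
        (Φ (toInfinite H I (basisTensor h g I)) : FieldAlgebra H) = siteProduct h g I) ∧
      (∀ (n m : ℤ) (hnm : 2 * n ≤ 2 * m),
        Function.Injective (fun a => Φ (toInfinite H (interval (2 * n) (2 * m) hnm) a)) ∧
        Set.range (fun a =>
          (Φ (toInfinite H (interval (2 * n) (2 * m) hnm) a) : FieldAlgebra H)) =
          localObservable H n m) := by
  have key : ∀ (I : NonemptyInterval ℤ) (h : ℤ → H) (g : ℤ → G),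
      (tensorEquiv H (toInfinite H I (basisTensor h g I)) : FieldAlgebra H) =
        siteProduct h g I := by
    intro I h g
    rw [coe_tensorEquiv, tensorHom_toInfinite, iterLift_basisTensor]
  refine ⟨tensorEquiv H, norm_tensorHom, fun h f g => ?_, key,
    fun n m hnm => ⟨fun a b hab => ?_, ?_⟩⟩
  · rw [key, siteProduct_eq]
    -- The indices `0, 1, 2` belong to the sites `0, 0, 1`, where the chosen family of elements of
    -- `H` takes the values `h` at `0` and `f` at `1`.
    have : List.range (((interval 0 2 (by norm_num)).snd -
        (interval 0 2 (by norm_num)).fst).toNat + 1) = [0, 1, 2] := rfl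
    rw [this]
    have h0 : (interval 0 2 (by norm_num)).fst = 0 := rfl
    simp [h0, siteElement, mul_assoc]
  · have := congrArg Subtype.val hab
    simp only [coe_tensorEquiv, tensorHom_toInfinite] at this
    exact iterLift_injective _ _ this
  · simp only [coe_tensorEquiv, tensorHom_toInfinite]
    exact range_iterLift n m hnm
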